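/- Let $Q=(0,1)^2$, let $f_1,f_2:\mathbb R^2\to(0,\infty)$ be Lipschitz continuous and $Q$-periodic (that is, $1$-periodic in each variable) with $f_1<f_2$, and let $\omega\subset\mathbb R^2$ be a bounded open set with Lipschitz boundary. Write $x=(x',x_3)\in\mathbb R^2\times\mathbb R$ and, for $\varepsilon>0$, set $$V_\varepsilon=\{(x',x_3): x'\in\omega,\ \varepsilon f_1(x'/\varepsilon)<x_3<\varepsilon f_2(x'/\varepsilon)\},$$ with outer unit normal $\nu_\varepsilon$ on $\partial V_\varepsilon$. Let $n_i(x')=(-\nabla f_i(x'),1)$, $\mathbf e_3=(0,0,1)$, and let $A_{\mathrm{hom}}$ be the constant $3\times 3$ matrix $$\begin{aligned} A_{\mathrm{hom}}:={}&\frac1{4\pi}\sum_{i=1}^{2}\int_Q\int_{\mathbb R^2}\Bigl(\frac{n_i(x')\otimes n_i(z'+x')}{\sqrt{|z'|^2+|f_i(z'+x')-f_i(x')|^2}}-\frac{n_i(x')\otimes n_i(z'+x')}{\sqrt{|z'|^2+1}}\Bigr)\,dz'\,dx'\\ &-\frac1{2\pi}\int_Q\int_{\mathbb R^2}\Bigl(\frac{n_1(x')\otimes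 n_2(z'+x')}{\sqrt{|z'|^2+|f_2(z'+x')-f_1(x')|^2}}-\frac{n_1(x')\otimes n_2(z'+x')}{\sqrt{|z'|^2+1}}\Bigr)\,dz'\,dx'\\ &+\frac1{4\pi}\int_Q\int_{\mathbb R^2}\Bigl(\frac{I-\mathbf e_3\otimes\mathbf e_3}{(|z'|^2+1)^{3/2}}-\frac{3(z',0)\otimes(z',0)}{(|z'|^2+1)^{5/2}}\Bigr)(f_2-f_1)(z'+x')\,(f_2-f_1)(x')\,dz'\,dx'. \end{aligned}$$ Let $\overline M_\varepsilon\in H^1(\omega;\mathbb S^2)$ for every $\varepsilon>0$, let $m_0\in H^1(\omega;\mathbb S^2)$, and suppose that $\overline M_\varepsilon\rightharpoonup m_0$ weakly in $H^1(\omega;\mathbb R^3)$ as $\varepsilon\to0^+$. On the lateral part of $\partial V_\varepsilon$, where $x'\in\partial\omega$, let $\overline M_\varepsilon(x')$ denote the trace of $\overline M_\varepsilon$ on $\partial\omega$. Then for every $\varepsilon>0$ the double integral below converges absolutely, and, as $\varepsilon\to0^+$, $$\frac1{4\pi\varepsilon}\int_{\partial V_\varepsilon}\int_{\partial V_\varepsilon}\frac{1}{|x-y|}\,(\overline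 M_\varepsilon(x')\cdot\nu_\varepsilon(x))\,(\overline M_\varepsilon(y')\cdot\nu_\varepsilon(y))\,d\mathcal H^2(x)\,d\mathcal H^2(y)\;\longrightarrow\;\int_\omega A_{\mathrm{hom}}\,m_0\cdot m_0\,dx'.$$ -/

import Mathlib

open MeasureTheory Filter Set Topology
open scoped Gradient

namespace RoughFilm

noncomputable section

/-- The plane `ℝ²` with its Euclidean norm. -/
abbrev Plane := EuclideanSpace ℝ (Fin 2)

/-- The space `ℝ³` with its Euclidean norm. -/
abbrev Space := EuclideanSpace ℝ (Fin 3)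

/-- The horizontal part `x'` of `x = (x', x₃)`. -/
def proj (x : Space) : Plane := !₂[x 0, x 1]

/-- The open unit cell `Q = (0,1) × (0,1)`. -/
def unitCell : Set Plane := {x | ∀ i, x i ∈ Ioo (0 : ℝ) 1}

/-- Periodicity with period cell `Q`. -/
def IsCellPeriodic (f : Plane → ℝ) : Prop :=
  ∀ (x : Plane) (i : Fin 2), f (x + EuclideanSpace.single i 1) = f x

/-- `ω` has Lipschitz boundary: near each boundary point, in suitable orthonormal coordinates,
`ω` is the region strictly above the graph of a Lipschitz function. -/
def HasLipschitzBoundary (ω : Set Plane) : Prop :=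
  ∀ x ∈ frontier ω, ∃ U ∈ 𝓝 x, ∃ (R : Plane ≃ₗᵢ[ℝ] Plane) (γ : ℝ → ℝ),
    (∃ K, LipschitzWith K γ) ∧ ∀ y ∈ U, y ∈ ω ↔ γ (R y 0) < R y 1

/-! ### Sobolev maps -/

/-- `v` is the weak partial derivative `∂ᵢ u` on the open set `ω`. -/
def HasWeakPartial (ω : Set Plane) (u : Plane → Space) (i : Fin 2) (v : Plane → Space) : Prop :=
  ∀ φ : Plane → ℝ, ContDiff ℝ ((⊤ : ℕ∞) : WithTop ℕ∞) φ → HasCompactSupport φ → tsupport φ ⊆ ω →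
    ∫ x in ω, fderiv ℝ φ x (EuclideanSpace.single i 1) • u x = -∫ x in ω, φ x • v x

/-- `u ∈ H¹(ω; ℝ³)` with weak partial derivatives `Du 0`, `Du 1`. -/
def IsH1With (ω : Set Plane) (u : Plane → Space) (Du : Fin 2 → Plane → Space) : Prop :=
  MemLp u 2 (volume.restrict ω) ∧
    ∀ i, MemLp (Du i) 2 (volume.restrict ω) ∧ HasWeakPartial ω u i (Du i)

/-- `u ∈ H¹(ω; 𝕊²)`. -/
def MemH1Sphere (ω : Set Plane) (u : Plane → Space) : Prop :=
  (∃ Du, IsH1With ω u Du) ∧ ∀ᵐ x ∂(volume.restrict ω), ‖u x‖ = 1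

/-- Weak convergence `v ε ⇀ w` in `L²(ω; ℝ³)` as `ε → 0⁺`. -/
def WeakTendstoL2 (ω : Set Plane) (v : ℝ → Plane → Space) (w : Plane → Space) : Prop :=
  ∀ ψ : Plane → Space, MemLp ψ 2 (volume.restrict ω) →
    Tendsto (fun ε => ∫ x in ω, inner ℝ (v ε x) (ψ x)) (𝓝[>] 0) (𝓝 (∫ x in ω, inner ℝ (w x) (ψ x)))

/-- Weak convergence `M ε ⇀ m` in `H¹(ω; ℝ³)` as `ε → 0⁺`: the maps and their weak partial
derivatives (unique up to null sets) converge weakly in `L²`. -/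
def WeakTendstoH1 (ω : Set Plane) (M : ℝ → Plane → Space) (m : Plane → Space) : Prop :=
  ∃ (DM : ℝ → Fin 2 → Plane → Space) (Dm : Fin 2 → Plane → Space),
    (∀ ε > 0, IsH1With ω (M ε) (DM ε)) ∧ IsH1With ω m Dm ∧
    WeakTendstoL2 ω M m ∧ ∀ i, WeakTendstoL2 ω (fun ε => DM ε i) (Dm i)

/-- `a` is the one-sided approximate limit of `u` at `x` from within `ω`. -/
def IsTraceAt (ω : Set Plane) (u : Plane → Space) (x : Plane) (a : Space) : Prop :=
  Tendsto (fun r => ⨍ y in Metric.ball x r ∩ ω, ‖u y - a‖) (𝓝[>] 0) (𝓝 0)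

open Classical in
/-- The boundary trace of `u` on `∂ω`. For a Sobolev map on a bounded set with Lipschitz boundary
the one-sided approximate limit exists at `ℋ¹`-almost every boundary point and equals the trace;
the value on the exceptional null set is irrelevant and is put equal to `0`. -/
def boundaryTrace (ω : Set Plane) (u : Plane → Space) (x : Plane) : Space :=
  if h : ∃ a, IsTraceAt ω u x a then h.choose else 0

open Classical in
/-- The map `u` on `ω` together with its trace on `∂ω`. -/
def valueOnClosure (ω : Set Plane) (u : Plane → Space) (x : Plane) : Space :=
  if x ∈ ω then u x else boundaryTrace ω u x

/-! ### The film and its surface charges -/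

/-- The film `V_ε = {(x', x₃) : x' ∈ ω, ε f₁(x'/ε) < x₃ < ε f₂(x'/ε)}`. -/
def film (ω : Set Plane) (f₁ f₂ : Plane → ℝ) (ε : ℝ) : Set Space :=
  {x | proj x ∈ ω ∧ ε * f₁ (ε⁻¹ • proj x) < x 2 ∧ x 2 < ε * f₂ (ε⁻¹ • proj x)}

/-- `ν` is the outer unit normal to `V` at `x`: up to cones around the tangent plane of arbitrarily
small aperture, `V` coincides near `x` with the half-space `{y : (y - x) · ν < 0}`. -/
def IsOuterNormalAt (V : Set Space) (x ν : Space) : Prop :=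
  ‖ν‖ = 1 ∧ ∀ δ > 0, ∀ᶠ y in 𝓝 x,
    (inner ℝ (y - x) ν < -(δ * ‖y - x‖) → y ∈ V) ∧ (δ * ‖y - x‖ < inner ℝ (y - x) ν → y ∉ V)

open Classical in
/-- The outer unit normal field of `V`. It exists at `ℋ²`-almost every boundary point of a set with
Lipschitz boundary; the value elsewhere is irrelevant and is put equal to `0`. -/
def outerNormal (V : Set Space) (x : Space) : Space :=
  if h : ∃ ν, IsOuterNormalAt V x ν then h.choose else 0

/-- The surface measure `ℋ²` on `∂V_ε`. -/
def surfaceMeasure (ω : Set Plane) (f₁ f₂ : Plane → ℝ) (ε : ℝ) : Measure Space :=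
  (Measure.euclideanHausdorffMeasure 2).restrict (frontier (film ω f₁ f₂ ε))

/-- The surface charge `M(x') · ν_ε(x)` at `x ∈ ∂V_ε`. -/
def surfaceCharge (ω : Set Plane) (f₁ f₂ : Plane → ℝ) (ε : ℝ) (M : Plane → Space) (x : Space) : ℝ :=
  inner ℝ (valueOnClosure ω M (proj x)) (outerNormal (film ω f₁ f₂ ε) x)

/-- The Coulomb interaction density of the surface charges at `x` and `y`. -/
def coulombDensity (ω : Set Plane) (f₁ f₂ : Plane → ℝ) (ε : ℝ) (M : Plane → Space) (x y : Space) : ℝ :=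
  1 / ‖x - y‖ * surfaceCharge ω f₁ f₂ ε M x * surfaceCharge ω f₁ f₂ ε M y

/-! ### The homogenized matrix -/

/-- `n(x') = (-∇f(x'), 1)`. -/
def graphNormal (f : Plane → ℝ) (x : Plane) : Space := !₂[-(∇ f x) 0, -(∇ f x) 1, 1]

/-- The matrix
`∫_Q ∫_{ℝ²} (n_f(x') ⊗ n_g(z'+x') / √(|z'|² + |g(z'+x') - f(x')|²)
  - n_f(x') ⊗ n_g(z'+x') / √(|z'|² + 1)) dz' dx'`. -/
def chargeMatrix (f g : Plane → ℝ) : Matrix (Fin 3) (Fin 3) ℝ := fun i j =>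
  ∫ x in unitCell, ∫ z : Plane,
    (graphNormal f x i * graphNormal g (z + x) j / √(‖z‖ ^ 2 + |g (z + x) - f x| ^ 2)
      - graphNormal f x i * graphNormal g (z + x) j / √(‖z‖ ^ 2 + 1))

/-- The vector `(z', 0)`. -/
def lift (z : Plane) : Space := !₂[z 0, z 1, 0]

/-- The matrix `I - e₃ ⊗ e₃`. -/
def horizontalId : Matrix (Fin 3) (Fin 3) ℝ := 1 - Matrix.single 2 2 1

/-- The matrix
`∫_Q ∫_{ℝ²} ((I - e₃ ⊗ e₃) / (|z'|² + 1)^{3/2} - 3 (z',0) ⊗ (z',0) / (|z'|² + 1)^{5/2})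
  (f₂ - f₁)(z'+x') (f₂ - f₁)(x') dz' dx'`. -/
def dipoleMatrix (f₁ f₂ : Plane → ℝ) : Matrix (Fin 3) (Fin 3) ℝ := fun i j =>
  ∫ x in unitCell, ∫ z : Plane,
    (horizontalId i j / (‖z‖ ^ 2 + 1) ^ (3 / 2 : ℝ)
      - 3 * (lift z i * lift z j) / (‖z‖ ^ 2 + 1) ^ (5 / 2 : ℝ))
      * ((f₂ (z + x) - f₁ (z + x)) * (f₂ x - f₁ x))

/-- The homogenized matrix `A_hom`. -/
def Ahom (f₁ f₂ : Plane → ℝ) : Matrix (Fin 3) (Fin 3) ℝ :=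
  (1 / (4 * Real.pi)) • chargeMatrix f₁ f₁ + (1 / (4 * Real.pi)) • chargeMatrix f₂ f₂
    - (1 / (2 * Real.pi)) • chargeMatrix f₁ f₂ + (1 / (4 * Real.pi)) • dipoleMatrix f₁ f₂

/-- The quadratic form `A m · m`. -/
def quadForm (A : Matrix (Fin 3) (Fin 3) ℝ) (m : Space) : ℝ := ∑ i, (∑ j, A i j * m j) * m i

end

end RoughFilm

/-! Apart from a lateral face of area `O(ε)`, the charged surface consists of the graphs of `ε
fᵢ(·/ε)`. There the area element times the charge is `M · n₂(x'/ε)` on the top and `-M · n₁(x'/ε)`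
on the bottom. The energy therefore expands into double integrals over `ω × ω` of these densities
against Coulomb kernels. Each kernel is written as its difference from `ker ε z = 1 / √(‖z‖² + ε²)`,
plus `ker ε` itself; this is the subtraction visible in the homogenized matrix.

The differences: in the variable `(y' - x')/ε` each is `ε⁻¹` times a function dominated by a
multiple of `1 / (‖z‖ (‖z‖² + 1))`, which is integrable over the plane. The corresponding energies
are of order `ε`. After division by `ε`, the oscillation in `x'/ε` averages over the cell while `M`
at `x'` and at `x' + εz` converge to the same limit. This is `tendsto_integral_homogenization`, and
it gives the three charge matrices in `tendsto_graphEnergyDiff`.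

The common part: the `ker ε` terms recombine into the self-energy of the net charge `M · (n₂ -
n₁)(x'/ε) = -∇h · M'`, where `h = ε (f₂ - f₁)(·/ε)`. Divided by `ε`, such an energy would be
unbounded for a general bounded density. Here the charge equals `-div (h M') + h div M'`, a dipole
layer of density `O(ε)` plus a small charge. Integrating by parts in both variables replaces `ker ε`
by minus its Hessian, and scaling yields the dipole matrix (`tendsto_dipole`). To avoid a boundary
term, `h` is cut off near `∂ω`, which costs a bounded charge on a tube of area `O(ε)`. All
remainders have mass `O(ε)` and meet potentials `O(√ε)` (`IsDipoleDecomposition.abs_energy_sub_le`,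
`exists_netCharge_estimates`).

The lateral face: its charge is measurable and bounded by `1`, and nothing more about the trace is
needed. The two graphs together produce a potential `O(√ε)` on it, by the dipole estimate. It
produces a potential `O(√ε)` on itself, because surface area grows at most quadratically in balls.
Its total contribution is `O(ε √ε)` (`exists_filmEnergy_estimate`).

Compactness is elementary. Since `|M| = |m₀| = 1`, weak `L²` convergence is strong, by `|M - m₀|² =
2 - 2 M · m₀`. The weak convergence of the derivatives serves only to bound them in `L²`, by
Banach–Steinhaus. -/

namespace RoughFilm

noncomputable section

open scoped NNReal ENNReal

/-! ### Coordinates -/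

/-- The point `(x', t)` of space. -/
def join (x : Plane) (t : ℝ) : Space := !₂[x 0, x 1, t]

@[simp] theorem join_zero (x : Plane) (t : ℝ) : join x t 0 = x 0 := rfl
@[simp] theorem join_one (x : Plane) (t : ℝ) : join x t 1 = x 1 := rfl
@[simp] theorem join_two (x : Plane) (t : ℝ) : join x t 2 = t := rfl
@[simp] theorem proj_zero (x : Space) : proj x 0 = x 0 := rfl
@[simp] theorem proj_one (x : Space) : proj x 1 = x 1 := rfl

@[simp] theorem proj_join (x : Plane) (t : ℝ) : proj (join x t) = x := by
  ext i; fin_cases i <;> rfl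

@[simp] theorem join_proj (x : Space) : join (proj x) (x 2) = x := by
  ext i; fin_cases i <;> rfl

theorem join_sub (x y : Plane) (s t : ℝ) : join x s - join y t = join (x - y) (s - t) := by
  ext i; fin_cases i <;> simp [join]

theorem join_add (x y : Plane) (s t : ℝ) : join x s + join y t = join (x + y) (s + t) := by
  ext i; fin_cases i <;> simp [join]

theorem smul_join (c : ℝ) (x : Plane) (t : ℝ) : c • join x t = join (c • x) (c * t) := by
  ext i; fin_cases i <;> simp [join]

theorem proj_sub (x y : Space) : proj (x - y) = proj x - proj y := by
  ext i; fin_cases i <;> simp [proj]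

theorem inner_plane (x y : Plane) : inner ℝ x y = x 0 * y 0 + x 1 * y 1 := by
  simp [PiLp.inner_apply, Fin.sum_univ_two, mul_comm]

theorem inner_space (x y : Space) : inner ℝ x y = x 0 * y 0 + x 1 * y 1 + x 2 * y 2 := by
  simp [PiLp.inner_apply, Fin.sum_univ_three, mul_comm]

theorem inner_join (x y : Plane) (s t : ℝ) :
    inner ℝ (join x s) (join y t) = inner ℝ x y + s * t := by
  rw [inner_space, inner_plane]; rfl

theorem norm_sq_plane (x : Plane) : ‖x‖ ^ 2 = x 0 ^ 2 + x 1 ^ 2 := by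
  rw [← real_inner_self_eq_norm_sq, inner_plane]; ring

theorem norm_sq_space (x : Space) : ‖x‖ ^ 2 = x 0 ^ 2 + x 1 ^ 2 + x 2 ^ 2 := by
  rw [← real_inner_self_eq_norm_sq, inner_space]; ring

theorem norm_sq_join (x : Plane) (t : ℝ) : ‖join x t‖ ^ 2 = ‖x‖ ^ 2 + t ^ 2 := by
  rw [norm_sq_space, norm_sq_plane]; rfl

theorem norm_join (x : Plane) (t : ℝ) : ‖join x t‖ = √(‖x‖ ^ 2 + t ^ 2) := by
  rw [← norm_sq_join, Real.sqrt_sq (norm_nonneg _)]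

theorem norm_le_norm_join (x : Plane) (t : ℝ) : ‖x‖ ≤ ‖join x t‖ := by
  rw [norm_join]; exact Real.le_sqrt_of_sq_le (by nlinarith [sq_nonneg t])

theorem abs_le_norm_join (x : Plane) (t : ℝ) : |t| ≤ ‖join x t‖ := by
  rw [norm_join]; exact Real.abs_le_sqrt (by nlinarith [sq_nonneg ‖x‖])

theorem norm_join_le (x : Plane) (t : ℝ) : ‖join x t‖ ≤ ‖x‖ + |t| := by
  rw [norm_join, Real.sqrt_le_left (by positivity)]
  nlinarith [sq_abs t, norm_nonneg x, abs_nonneg t, mul_nonneg (norm_nonneg x) (abs_nonneg t)]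

theorem norm_proj_le (x : Space) : ‖proj x‖ ≤ ‖x‖ := by
  conv_rhs => rw [← join_proj x]
  exact norm_le_norm_join _ _

@[fun_prop]
theorem continuous_proj : Continuous proj := by
  unfold proj; fun_prop

@[fun_prop]
theorem continuous_join : Continuous fun p : Plane × ℝ => join p.1 p.2 := by
  unfold join; fun_prop

theorem abs_apply_le_norm_plane (x : Plane) (i : Fin 2) : |x i| ≤ ‖x‖ := by
  simpa using PiLp.norm_apply_le x i

theorem abs_apply_le_norm_space (x : Space) (i : Fin 3) : |x i| ≤ ‖x‖ := by
  simpa using PiLp.norm_apply_le x i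

/-! ### The area of Lipschitz graphs -/

/-- The parametrization of the graph of `f`. -/
def graphMap (f : Plane → ℝ) (x : Plane) : Space := join x (f x)

theorem norm_sub_le_graphMap (f : Plane → ℝ) (x y : Plane) :
    ‖x - y‖ ≤ ‖graphMap f x - graphMap f y‖ := by
  rw [graphMap, graphMap, join_sub]; exact norm_le_norm_join _ _

theorem antilipschitz_graphMap (f : Plane → ℝ) : AntilipschitzWith 1 (graphMap f) :=
  AntilipschitzWith.of_le_mul_dist fun x y => by
    simpa [dist_eq_norm] using norm_sub_le_graphMap f x y

theorem lipschitz_graphMap {f : Plane → ℝ} {K : ℝ≥0} (hf : LipschitzWith K f) :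
    LipschitzWith (1 + K) (graphMap f) :=
  LipschitzWith.of_dist_le_mul fun x y => by
    have h := hf.dist_le_mul x y
    rw [Real.dist_eq] at h
    rw [dist_eq_norm, graphMap, graphMap, join_sub]
    refine (norm_join_le _ _).trans ?_
    push_cast
    rw [add_mul, one_mul, ← dist_eq_norm]
    gcongr

theorem measurableEmbedding_graphMap {f : Plane → ℝ} (hf : Continuous f) :
    MeasurableEmbedding (graphMap f) := by
  have hc : Continuous (graphMap f) := continuous_join.comp (continuous_id.prodMk hf)
  exact hc.measurableEmbedding (antilipschitz_graphMap f).injective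

/-- The linear parametrization of the plane through the origin with slope `p`. -/
def graphLin (p : Plane) : Plane →L[ℝ] Space :=
  LinearMap.toContinuousLinearMap
    { toFun := fun v => join v (inner ℝ p v)
      map_add' := fun v w => by rw [join_add, inner_add_right]
      map_smul' := fun c v => by simp [smul_join, inner_smul_right] }

@[simp] theorem graphLin_apply (p v : Plane) : graphLin p v = join v (inner ℝ p v) := rfl

/-- The Gram matrix in the standard basis is `I + p ⊗ p`, whose determinant is `1 + ‖p‖²`. -/
theorem normDet_graphLin (p : Plane) :
    (graphLin p : Plane →ₗ[ℝ] Space).normDet = √(1 + ‖p‖ ^ 2) := by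
  have h := LinearMap.normDet_sq_eq_det_gram (graphLin p : Plane →ₗ[ℝ] Space)
    (EuclideanSpace.basisFun (Fin 2) ℝ)
  rw [Matrix.det_fin_two] at h
  simp only [Matrix.gram_apply, ContinuousLinearMap.coe_coe, graphLin_apply, inner_join,
    inner_plane] at h
  simp at h
  rw [← Real.sqrt_sq (LinearMap.normDet_nonneg (graphLin p : Plane →ₗ[ℝ] Space)), h, norm_sq_plane]
  congr 1; ring

theorem hasFDerivAt_graphMap {f : Plane → ℝ} {x : Plane} (hf : DifferentiableAt ℝ f x) :
    HasFDerivAt (graphMap f) (graphLin (∇ f x)) x := by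
  have h1 := hf.hasGradientAt.hasFDerivAt
  rw [hasFDerivAt_iff_isLittleO] at h1 ⊢
  refine Asymptotics.IsLittleO.congr_left
    (f₁ := fun y => (f y - f x - (InnerProductSpace.toDual ℝ Plane (∇ f x)) (y - x)) •
      join 0 1) ?_ ?_
  · refine Asymptotics.IsBigO.trans_isLittleO
      (Asymptotics.IsBigO.of_bound ‖join 0 1‖ (Eventually.of_forall fun y => ?_)) h1
    rw [norm_smul, mul_comm]
  · intro y
    rw [smul_join, graphMap, graphMap, graphLin_apply, join_sub, join_sub,
      InnerProductSpace.toDual_apply_apply]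
    simp

/-- `F ∘ G⁻¹` is a well-defined `C`-Lipschitz map of `G '' s` onto `F '' s`, and the normalizing
factor of the two-dimensional measure is the same on both sides. This compares a graph with its
tangent plane, and a parametrized surface with its parameter domain. -/
theorem hausdorff_image_le_of_dist_le {X Y Z : Type*} [MetricSpace Y]
    [MeasurableSpace Y] [BorelSpace Y] [MetricSpace Z] [MeasurableSpace Z] [BorelSpace Z]
    (F : X → Y) (G : X → Z) (C : ℝ≥0) (s : Set X)
    (h : ∀ x ∈ s, ∀ y ∈ s, dist (F x) (F y) ≤ C * dist (G x) (G y)) :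
    Measure.euclideanHausdorffMeasure 2 (F '' s) ≤
      (C : ℝ≥0∞) ^ 2 * Measure.euclideanHausdorffMeasure 2 (G '' s) := by
  rcases isEmpty_or_nonempty X with hX | hX
  · simp [Set.eq_empty_of_isEmpty s]
  set I := Function.invFunOn G s
  have hI : ∀ z ∈ G '' s, I z ∈ s ∧ G (I z) = z := fun z hz =>
    ⟨Function.invFunOn_mem hz, Function.invFunOn_eq hz⟩
  have hL : LipschitzOnWith C (fun z => F (I z)) (G '' s) := by
    refine LipschitzOnWith.of_dist_le_mul fun z hz w hw => ?_
    have := h _ (hI z hz).1 _ (hI w hw).1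
    rwa [(hI z hz).2, (hI w hw).2] at this
  have himg : F '' s ⊆ (fun z => F (I z)) '' (G '' s) := by
    rintro _ ⟨x, hx, rfl⟩
    refine ⟨G x, ⟨x, hx, rfl⟩, ?_⟩
    have hm := hI (G x) ⟨x, hx, rfl⟩
    have := h _ hm.1 _ hx
    rw [hm.2, dist_self, mul_zero] at this
    exact dist_le_zero.mp this
  have h2 := hL.hausdorffMeasure_image_le (d := ((2 : ℕ) : ℝ)) (by norm_num)
  rw [ENNReal.rpow_natCast] at h2
  simp only [Measure.euclideanHausdorffMeasure_def, Measure.smul_apply, ENNReal.smul_def,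
    smul_eq_mul]
  calc _ ≤ _ * (_ * _) := by gcongr; exact (measure_mono himg).trans h2
    _ = _ := by ring

theorem hausdorff_image_le {X : Type*} [MetricSpace X] [MeasurableSpace X] [BorelSpace X]
    {F : Plane → X} {K : ℝ≥0} (hF : LipschitzWith K F) (s : Set Plane) :
    Measure.euclideanHausdorffMeasure 2 (F '' s) ≤ (K : ℝ≥0∞) ^ 2 * volume s := by
  have := hausdorff_image_le_of_dist_le F (id : Plane → Plane) K s
    (fun x _ y _ => hF.dist_le_mul x y)
  rwa [image_id, EuclideanSpace.euclideanHausdorffMeasure_eq_volume] at this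

theorem hausdorff_image_graphLin (p : Plane) (s : Set Plane) :
    Measure.euclideanHausdorffMeasure 2 (graphLin p '' s) =
      ENNReal.ofReal √(1 + ‖p‖ ^ 2) * volume s := by
  have h := (graphLin p : Plane →ₗ[ℝ] Space).euclideanHausdorffMeasure_image_eq_normDet_mul_volume s
  rw [normDet_graphLin] at h
  simpa using h

/-- The square root is the norm of `(p, 1)`, which is at least `1`, so an additive error `δ` is also
a relative one. -/
theorem sqrt_one_add_sq_le_mul {p q : Plane} {δ : ℝ} (h : ‖p - q‖ ≤ δ) :
    √(1 + ‖p‖ ^ 2) ≤ (1 + δ) * √(1 + ‖q‖ ^ 2) := by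
  have hδ : 0 ≤ δ := (norm_nonneg _).trans h
  have h1 : √(1 + ‖p‖ ^ 2) = ‖join p 1‖ := by rw [norm_join]; congr 1; ring
  have h2 : √(1 + ‖q‖ ^ 2) = ‖join q 1‖ := by rw [norm_join]; congr 1; ring
  have h3 : (1 : ℝ) ≤ ‖join q 1‖ := by simpa using abs_le_norm_join q 1
  have h4 : ‖join p 1 - join q 1‖ ≤ δ := by
    rw [join_sub]; refine (norm_join_le _ _).trans ?_; simpa using h
  rw [h1, h2]
  have h5 : ‖join p 1‖ ≤ ‖join q 1‖ + ‖join p 1 - join q 1‖ := by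
    have := norm_add_le (join q 1) (join p 1 - join q 1)
    simpa using this
  nlinarith

/-- The area element of the graph of `f`. -/
def areaElement (f : Plane → ℝ) (x : Plane) : ℝ := √(1 + ‖∇ f x‖ ^ 2)

theorem measurable_gradient (f : Plane → ℝ) : Measurable fun x => ∇ f x :=
  (InnerProductSpace.toDual ℝ Plane).symm.continuous.measurable.comp (measurable_fderiv ℝ f)

@[fun_prop]
theorem measurable_areaElement (f : Plane → ℝ) : Measurable (areaElement f) := by
  have := measurable_gradient f
  unfold areaElement; fun_prop

/-- Both comparisons between the area of a graph and the integral of the area element, on a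
piece on which the graph is nearly flat. -/
theorem hausdorff_graph_piece {f : Plane → ℝ} {s : Set Plane} (hs : MeasurableSet s) {p : Plane}
    {δ : ℝ≥0} (hδ : δ ≤ 1 / 2) (hA : ApproximatesLinearOn (graphMap f) (graphLin p) s δ)
    (hp : ∀ x ∈ s, ‖∇ f x - p‖ ≤ 2 * δ) :
    Measure.euclideanHausdorffMeasure 2 (graphMap f '' s) ≤
      (1 + 2 * δ : ℝ≥0∞) ^ 3 * ∫⁻ x in s, ENNReal.ofReal (areaElement f x) ∧
    ∫⁻ x in s, ENNReal.ofReal (areaElement f x) ≤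
      (1 + 2 * δ : ℝ≥0∞) ^ 3 * Measure.euclideanHausdorffMeasure 2 (graphMap f '' s) := by
  have hδ' : (δ : ℝ) ≤ 1 / 2 := by exact_mod_cast hδ
  have hc : ((1 + 2 * δ : ℝ≥0) : ℝ≥0∞) = 1 + 2 * δ := by push_cast; rfl
  have hlin : ∀ x y : Plane, ‖x - y‖ ≤ ‖graphLin p x - graphLin p y‖ := fun x y => by
    rw [← map_sub, graphLin_apply]; exact norm_le_norm_join _ _
  have happ : ∀ x ∈ s, ∀ y ∈ s,
      ‖graphMap f x - graphMap f y - (graphLin p x - graphLin p y)‖ ≤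
        δ * ‖graphLin p x - graphLin p y‖ := fun x hx y hy => by
    have := hA x hx y hy
    rw [map_sub] at this
    exact this.trans (by gcongr; exact hlin x y)
  have hJ : ∀ x ∈ s, ENNReal.ofReal (areaElement f x) ≤
      (1 + 2 * δ : ℝ≥0∞) * ENNReal.ofReal √(1 + ‖p‖ ^ 2) ∧
      ENNReal.ofReal √(1 + ‖p‖ ^ 2) ≤ (1 + 2 * δ : ℝ≥0∞) * ENNReal.ofReal (areaElement f x) := by
    intro x hx
    rw [← hc, ← ENNReal.ofReal_coe_nnreal, ← ENNReal.ofReal_mul (by positivity),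
      ← ENNReal.ofReal_mul (by positivity)]
    push_cast
    exact ⟨ENNReal.ofReal_le_ofReal (sqrt_one_add_sq_le_mul (hp x hx)),
      ENNReal.ofReal_le_ofReal (sqrt_one_add_sq_le_mul (by rw [norm_sub_rev]; exact hp x hx))⟩
  have hI1 : ∫⁻ x in s, ENNReal.ofReal (areaElement f x) ≤
      (1 + 2 * δ : ℝ≥0∞) * ENNReal.ofReal √(1 + ‖p‖ ^ 2) * volume s := by
    rw [← setLIntegral_const]
    exact setLIntegral_mono' hs fun x hx => (hJ x hx).1
  have hI2 : ENNReal.ofReal √(1 + ‖p‖ ^ 2) * volume s ≤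
      (1 + 2 * δ : ℝ≥0∞) * ∫⁻ x in s, ENNReal.ofReal (areaElement f x) := by
    rw [← setLIntegral_const, ← lintegral_const_mul _ (by fun_prop)]
    exact setLIntegral_mono' hs fun x hx => (hJ x hx).2
  -- Two of the three factors `1 + 2δ` come from the Lipschitz comparison of the graph with a plane;
  -- the third comes from the oscillation of the area element.
  have hH1 : Measure.euclideanHausdorffMeasure 2 (graphMap f '' s) ≤
      (1 + 2 * δ : ℝ≥0∞) ^ 2 * (ENNReal.ofReal √(1 + ‖p‖ ^ 2) * volume s) := by
    rw [← hausdorff_image_graphLin, ← hc]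
    refine hausdorff_image_le_of_dist_le _ _ _ _ fun x hx y hy => ?_
    rw [dist_eq_norm, dist_eq_norm]
    have h1 := happ x hx y hy
    have h2 := norm_sub_norm_le (graphMap f x - graphMap f y) (graphLin p x - graphLin p y)
    push_cast
    nlinarith [norm_nonneg (graphLin p x - graphLin p y), δ.2,
      mul_nonneg δ.2 (norm_nonneg (graphLin p x - graphLin p y))]
  have hH2 : ENNReal.ofReal √(1 + ‖p‖ ^ 2) * volume s ≤
      (1 + 2 * δ : ℝ≥0∞) ^ 2 * Measure.euclideanHausdorffMeasure 2 (graphMap f '' s) := by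
    rw [← hausdorff_image_graphLin, ← hc]
    refine hausdorff_image_le_of_dist_le _ _ _ _ fun x hx y hy => ?_
    rw [dist_eq_norm, dist_eq_norm]
    have h1 := happ x hx y hy
    have h2 := norm_sub_norm_le (graphLin p x - graphLin p y) (graphMap f x - graphMap f y)
    rw [norm_sub_rev (graphLin p x - graphLin p y) (graphMap f x - graphMap f y)] at h2
    push_cast
    have hd : (0 : ℝ) ≤ δ := δ.2
    set a := ‖graphLin p x - graphLin p y‖
    set b := ‖graphMap f x - graphMap f y‖
    have ha : 0 ≤ a := norm_nonneg _
    have h3 : (1 - δ) * a ≤ b := by linarith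
    -- `1 / (1 - δ) ≤ 1 + 2δ` because `δ ≤ 1/2`.
    have h4 : a ≤ (1 + 2 * δ) * ((1 - δ) * a) := by
      have : 0 ≤ (δ : ℝ) * (1 - 2 * δ) * a := by
        apply mul_nonneg (mul_nonneg hd (by linarith)) ha
      nlinarith
    exact h4.trans (by gcongr)
  constructor
  · calc _ ≤ _ := hH1
      _ ≤ (1 + 2 * δ : ℝ≥0∞) ^ 2 * ((1 + 2 * δ : ℝ≥0∞) *
          ∫⁻ x in s, ENNReal.ofReal (areaElement f x)) := by gcongr
      _ = _ := by ring
  · calc _ ≤ _ := hI1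
      _ = (1 + 2 * δ : ℝ≥0∞) * (ENNReal.ofReal √(1 + ‖p‖ ^ 2) * volume s) := by ring
      _ ≤ (1 + 2 * δ : ℝ≥0∞) * ((1 + 2 * δ : ℝ≥0∞) ^ 2 *
          Measure.euclideanHausdorffMeasure 2 (graphMap f '' s)) := by gcongr
      _ = _ := by ring

/-- The set is cut twice: by which point of a dense sequence the gradient is `δ`-close to, and then
by the quality of the linear approximation. The slope `p` is the gradient at some point of the same
gradient class, hence `2δ`. -/
theorem exists_graph_partition {f : Plane → ℝ} {s : Set Plane} (hs : MeasurableSet s)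
    (hd : ∀ x ∈ s, DifferentiableAt ℝ f x) {δ : ℝ≥0} (hδ : 0 < δ) :
    ∃ t : ℕ × ℕ → Set Plane, Pairwise (Function.onFun Disjoint t) ∧ (∀ n, MeasurableSet (t n)) ∧
      s = ⋃ n, t n ∧ ∀ n, ∃ p, ApproximatesLinearOn (graphMap f) (graphLin p) (t n) δ ∧
        ∀ x ∈ t n, ‖∇ f x - p‖ ≤ 2 * δ := by
  set q := TopologicalSpace.denseSeq Plane
  set c : ℕ → Set Plane := disjointed fun k => {x | ‖∇ f x - q k‖ ≤ δ}
  have hcm : ∀ k, MeasurableSet (c k) := fun k => by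
    refine MeasurableSet.disjointed (fun k => ?_) k
    have := measurable_gradient f
    exact measurableSet_le (by fun_prop) measurable_const
  have hcsub : ∀ k, ∀ x ∈ c k, ‖∇ f x - q k‖ ≤ δ := fun k x hx => disjointed_subset _ k hx
  have hcU : ⋃ k, c k = univ := by
    rw [iUnion_disjointed, eq_univ_iff_forall]
    intro x
    obtain ⟨k, hk⟩ := Metric.denseRange_iff.mp (TopologicalSpace.denseRange_denseSeq Plane) (∇ f x)
      δ hδ
    exact mem_iUnion.mpr ⟨k, by rw [dist_eq_norm] at hk; exact hk.le⟩
  have key : ∀ k, ∃ (t : ℕ → Set Plane) (A : ℕ → Plane →L[ℝ] Space),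
      Pairwise (Function.onFun Disjoint t) ∧ (∀ n, MeasurableSet (t n)) ∧ (s ∩ c k ⊆ ⋃ n, t n) ∧
      (∀ n, ApproximatesLinearOn (graphMap f) (A n) (s ∩ c k ∩ t n) δ) ∧
      ((s ∩ c k).Nonempty → ∀ n, ∃ y ∈ s ∩ c k, A n = graphLin (∇ f y)) := fun k =>
    exists_partition_approximatesLinearOn_of_hasFDerivWithinAt (graphMap f) (s ∩ c k)
      (fun x => graphLin (∇ f x))
      (fun x hx => (hasFDerivAt_graphMap (hd x hx.1)).hasFDerivWithinAt) (fun _ => δ)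
      (fun _ => hδ.ne')
  choose t A ht1 ht2 ht3 ht4 ht5 using key
  refine ⟨fun n => s ∩ c n.1 ∩ t n.1 n.2, ?_, fun n => (hs.inter (hcm _)).inter (ht2 _ _), ?_, ?_⟩
  · rintro ⟨a, b⟩ ⟨a', b'⟩ hne
    by_cases haa : a = a'
    · subst haa
      have hbb : b ≠ b' := fun h => hne (by rw [h])
      exact (ht1 a hbb).mono inter_subset_right inter_subset_right
    · exact ((disjoint_disjointed _) haa).mono (inter_subset_left.trans inter_subset_right)
        (inter_subset_left.trans inter_subset_right)
  · ext x
    constructor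
    · intro hx
      obtain ⟨k, hk⟩ := mem_iUnion.mp (hcU ▸ mem_univ x : x ∈ ⋃ k, c k)
      obtain ⟨n, hn⟩ := mem_iUnion.mp (ht3 k ⟨hx, hk⟩)
      exact mem_iUnion.mpr ⟨(k, n), ⟨hx, hk⟩, hn⟩
    · intro hx
      obtain ⟨n, hn⟩ := mem_iUnion.mp hx
      exact hn.1.1
  · rintro ⟨k, n⟩
    rcases (s ∩ c k).eq_empty_or_nonempty with he | hne
    · refine ⟨0, ?_, ?_⟩
      · intro x hx; simp [he] at hx
      · intro x hx; simp [he] at hx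
    · obtain ⟨y, hy, hAy⟩ := ht5 k hne n
      refine ⟨∇ f y, hAy ▸ ht4 k n, fun x hx => ?_⟩
      have h1 := hcsub k x hx.1.2
      have h2 := hcsub k y hy.2
      calc ‖∇ f x - ∇ f y‖ = ‖(∇ f x - q k) - (∇ f y - q k)‖ := by congr 1; abel
        _ ≤ δ + δ := (norm_sub_le _ _).trans (add_le_add h1 h2)
        _ = 2 * δ := by ring

theorem le_of_forall_le_one_add_cube {a b : ℝ≥0∞}
    (h : ∀ δ : ℝ≥0, 0 < δ → δ ≤ 1 / 2 → a ≤ (1 + 2 * δ : ℝ≥0∞) ^ 3 * b) : a ≤ b := by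
  have hc : Continuous fun δ : ℝ≥0 => (1 + 2 * δ) ^ 3 := by fun_prop
  have h1 : Tendsto (fun δ : ℝ≥0 => (1 + 2 * δ) ^ 3) (𝓝[>] 0) (𝓝 1) :=
    (hc.tendsto' 0 1 (by simp)).mono_left nhdsWithin_le_nhds
  have h2 := ENNReal.Tendsto.mul_const (b := b) (ENNReal.tendsto_coe.mpr h1) (Or.inl (by simp))
  rw [ENNReal.coe_one, one_mul] at h2
  refine ge_of_tendsto h2 ?_
  filter_upwards [Ioc_mem_nhdsGT (show (0 : ℝ≥0) < 1 / 2 by positivity)] with δ hδ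
  simpa using h δ hδ.1 hδ.2

/-- On nearly flat pieces the two sides agree up to the factor `(1 + 2δ)³`. Both are countably
additive, so the comparison survives summation, and then `δ → 0`. -/
theorem hausdorff_graph_of_differentiable {f : Plane → ℝ} (hf : Continuous f) {s : Set Plane}
    (hs : MeasurableSet s) (hd : ∀ x ∈ s, DifferentiableAt ℝ f x) :
    Measure.euclideanHausdorffMeasure 2 (graphMap f '' s) =
      ∫⁻ x in s, ENNReal.ofReal (areaElement f x) := by
  have hemb := measurableEmbedding_graphMap hf
  have key : ∀ δ : ℝ≥0, 0 < δ → δ ≤ 1 / 2 →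
      Measure.euclideanHausdorffMeasure 2 (graphMap f '' s) ≤
        (1 + 2 * δ : ℝ≥0∞) ^ 3 * ∫⁻ x in s, ENNReal.ofReal (areaElement f x) ∧
      ∫⁻ x in s, ENNReal.ofReal (areaElement f x) ≤
        (1 + 2 * δ : ℝ≥0∞) ^ 3 * Measure.euclideanHausdorffMeasure 2 (graphMap f '' s) := by
    intro δ hδ hδ2
    obtain ⟨t, ht1, ht2, hst, htp⟩ := exists_graph_partition hs hd hδ
    have hpiece : ∀ n, _ := fun n =>
      let ⟨p, h1, h2⟩ := htp n
      hausdorff_graph_piece (ht2 n) hδ2 h1 h2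
    have e1 : Measure.euclideanHausdorffMeasure 2 (graphMap f '' s) =
        ∑' n, Measure.euclideanHausdorffMeasure 2 (graphMap f '' (t n)) := by
      rw [hst, image_iUnion, measure_iUnion]
      · intro a b hab
        exact (ht1 hab).image (hemb.injective.injOn (s := univ)) (subset_univ _) (subset_univ _)
      · exact fun n => hemb.measurableSet_image.mpr (ht2 n)
    have e2 : ∫⁻ x in s, ENNReal.ofReal (areaElement f x) =
        ∑' n, ∫⁻ x in t n, ENNReal.ofReal (areaElement f x) := by
      rw [hst, lintegral_iUnion ht2 ht1]
    rw [e1, e2, ← ENNReal.tsum_mul_left, ← ENNReal.tsum_mul_left]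
    exact ⟨ENNReal.tsum_le_tsum fun n => (hpiece n).1, ENNReal.tsum_le_tsum fun n => (hpiece n).2⟩
  exact le_antisymm (le_of_forall_le_one_add_cube fun δ h h' => (key δ h h').1)
    (le_of_forall_le_one_add_cube fun δ hδ hδ1 => (key δ hδ hδ1).2)

/-- The area formula for Lipschitz graphs. -/
theorem hausdorff_graph {f : Plane → ℝ} {K : ℝ≥0} (hf : LipschitzWith K f) {s : Set Plane}
    (hs : MeasurableSet s) :
    Measure.euclideanHausdorffMeasure 2 (graphMap f '' s) =
      ∫⁻ x in s, ENNReal.ofReal (areaElement f x) := by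
  set D := {x | DifferentiableAt ℝ f x}
  have hD : MeasurableSet D := measurableSet_of_differentiableAt ℝ f
  have hnull : volume Dᶜ = 0 := hf.ae_differentiableAt
  have h1 := hausdorff_graph_of_differentiable hf.continuous (hs.inter hD) (fun x hx => hx.2)
  -- By Rademacher the points of non-differentiability form a null set, and a Lipschitz map sends it
  -- to a set of zero area.
  have h2 : Measure.euclideanHausdorffMeasure 2 (graphMap f '' (s \ D)) = 0 := by
    refine le_antisymm ((hausdorff_image_le (lipschitz_graphMap hf) _).trans ?_) (zero_le)
    rw [measure_mono_null (fun x hx => hx.2) hnull, mul_zero]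
  have h3 : ∫⁻ x in s, ENNReal.ofReal (areaElement f x) =
      ∫⁻ x in s ∩ D, ENNReal.ofReal (areaElement f x) := by
    refine (setLIntegral_congr ?_).symm
    exact inter_ae_eq_left_of_ae_eq_univ (ae_eq_univ.mpr hnull)
  rw [h3, ← h1]
  refine le_antisymm ?_ (measure_mono (image_mono inter_subset_left))
  rw [← inter_union_sdiff s D, image_union]
  refine (measure_union_le _ _).trans ?_
  rw [h2, add_zero, inter_union_sdiff]

theorem restrict_hausdorff_graph {f : Plane → ℝ} {K : ℝ≥0} (hf : LipschitzWith K f) {s : Set Plane}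
    (hs : MeasurableSet s) :
    (Measure.euclideanHausdorffMeasure 2).restrict (graphMap f '' s) =
      ((volume.restrict s).withDensity fun x => ENNReal.ofReal (areaElement f x)).map
        (graphMap f) := by
  have hemb := measurableEmbedding_graphMap hf.continuous
  ext t ht
  rw [hemb.map_apply, Measure.restrict_apply ht, withDensity_apply _ (hemb.measurable ht),
    Measure.restrict_restrict (hemb.measurable ht),
    ← hausdorff_graph hf ((hemb.measurable ht).inter hs)]
  congr 1
  rw [inter_comm, ← image_inter_preimage, inter_comm]

theorem integral_graph {f : Plane → ℝ} {K : ℝ≥0} (hf : LipschitzWith K f) {s : Set Plane}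
    (hs : MeasurableSet s) (F : Space → ℝ) :
    ∫ x, F x ∂(Measure.euclideanHausdorffMeasure 2).restrict (graphMap f '' s) =
      ∫ x in s, areaElement f x * F (graphMap f x) := by
  rw [restrict_hausdorff_graph hf hs, (measurableEmbedding_graphMap hf.continuous).integral_map,
    integral_withDensity_eq_integral_toReal_smul (by fun_prop) (by simp)]
  refine integral_congr_ae (Eventually.of_forall fun x => ?_)
  simp only [smul_eq_mul]
  rw [ENNReal.toReal_ofReal (show 0 ≤ areaElement f x from Real.sqrt_nonneg _)]

/-! ### Outer normals -/

/-- The direction `ν₂ - ν₁` makes an obtuse angle with `ν₁` and an acute one with `ν₂`. A short step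
along it would land inside `V` by the first normal and outside by the second. -/
theorem IsOuterNormalAt.unique {V : Set Space} {x ν₁ ν₂ : Space} (h₁ : IsOuterNormalAt V x ν₁)
    (h₂ : IsOuterNormalAt V x ν₂) : ν₁ = ν₂ := by
  by_contra hne
  have hw : 0 < ‖ν₂ - ν₁‖ := norm_pos_iff.mpr (sub_ne_zero.mpr (Ne.symm hne))
  set c : ℝ := inner ℝ ν₁ ν₂ with hc
  have hlt : c < 1 := by
    have h := norm_sub_sq_real ν₂ ν₁
    rw [h₁.1, h₂.1, real_inner_comm] at h
    nlinarith [sq_pos_of_pos hw]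
  have hi1 : inner ℝ (ν₂ - ν₁) ν₁ = c - 1 := by
    rw [inner_sub_left, real_inner_self_eq_norm_sq, h₁.1, real_inner_comm]; norm_num [hc]
  have hi2 : inner ℝ (ν₂ - ν₁) ν₂ = 1 - c := by
    rw [inner_sub_left, real_inner_self_eq_norm_sq, h₂.1]; norm_num [hc]
  -- With this aperture `δ ‖ν₂ - ν₁‖` is half of `1 - c`, so the direction is strictly inside both
  -- cones.
  set δ : ℝ := (1 - c) / (2 * ‖ν₂ - ν₁‖) with hδ
  have hδ0 : 0 < δ := by apply div_pos <;> linarith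
  have hδw : δ * ‖ν₂ - ν₁‖ = (1 - c) / 2 := by rw [hδ]; field_simp
  have ht : Tendsto (fun t : ℝ => x + t • (ν₂ - ν₁)) (𝓝[>] 0) (𝓝 x) := by
    have : Continuous fun t : ℝ => x + t • (ν₂ - ν₁) := by fun_prop
    exact (this.tendsto' 0 x (by simp)).mono_left nhdsWithin_le_nhds
  obtain ⟨t, ha, hb, ht0⟩ := ((ht.eventually (h₁.2 δ hδ0)).and ((ht.eventually (h₂.2 δ hδ0)).and
    self_mem_nhdsWithin)).exists
  replace ht0 : 0 < t := ht0
  simp only [add_sub_cancel_left, inner_smul_left, norm_smul, Real.norm_eq_abs, abs_of_pos ht0,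
    hi1, hi2] at ha hb
  refine hb.2 ?_ (ha.1 ?_)
  · simp only [conj_trivial]; nlinarith
  · simp only [conj_trivial]; nlinarith

theorem outerNormal_eq {V : Set Space} {x ν : Space} (h : IsOuterNormalAt V x ν) :
    outerNormal V x = ν := by
  have hex : ∃ ν, IsOuterNormalAt V x ν := ⟨ν, h⟩
  rw [outerNormal, dif_pos hex]
  exact hex.choose_spec.unique h

theorem norm_outerNormal_le (V : Set Space) (x : Space) : ‖outerNormal V x‖ ≤ 1 := by
  rw [outerNormal]
  split_ifs with h
  · exact h.choose_spec.1.le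
  · simp

theorem graphNormal_eq_join (f : Plane → ℝ) (x : Plane) : graphNormal f x = join (-∇ f x) 1 := rfl

theorem norm_graphNormal (f : Plane → ℝ) (x : Plane) : ‖graphNormal f x‖ = areaElement f x := by
  rw [graphNormal_eq_join, norm_join, areaElement, norm_neg]; congr 1; ring

theorem one_le_areaElement (f : Plane → ℝ) (x : Plane) : 1 ≤ areaElement f x := by
  rw [areaElement, Real.one_le_sqrt]; nlinarith [sq_nonneg ‖∇ f x‖]

/-- The outer normal at a point near which the set is the subgraph (`σ = 1`) or the epigraph
(`σ = -1`) of `h`. -/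
theorem isOuterNormalAt_graphMap {h : Plane → ℝ} {x : Plane} (hd : DifferentiableAt ℝ h x)
    {V : Set Space} {σ : ℝ} (hσ : |σ| = 1)
    (hV : ∀ᶠ y in 𝓝 (graphMap h x), y ∈ V ↔ σ * (y 2 - h (proj y)) < 0) :
    IsOuterNormalAt V (graphMap h x) ((σ / areaElement h x) • graphNormal h x) := by
  have hJ := one_le_areaElement h x
  have hJ0 : 0 < areaElement h x := by linarith
  refine ⟨?_, fun δ hδ => ?_⟩
  · rw [norm_smul, norm_graphNormal, norm_div, Real.norm_eq_abs, hσ, Real.norm_eq_abs,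
      abs_of_pos hJ0, one_div_mul_cancel hJ0.ne']
  have hlo := (hasFDerivAt_iff_isLittleO.mp hd.hasGradientAt.hasFDerivAt).def
    (show 0 < δ / 2 by linarith)
  have hpr : Tendsto proj (𝓝 (graphMap h x)) (𝓝 x) :=
    continuous_proj.tendsto' _ _ (by simp [graphMap])
  filter_upwards [hV, hpr.eventually hlo] with y hy hr
  rw [InnerProductSpace.toDual_apply_apply, Real.norm_eq_abs] at hr
  have hin : inner ℝ (y - graphMap h x) ((σ / areaElement h x) • graphNormal h x) =
      σ / areaElement h x * ((y 2 - h x) - inner ℝ (∇ h x) (proj y - x)) := by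
    rw [inner_smul_right, graphNormal_eq_join, graphMap]
    conv_lhs => rw [← join_proj y]
    rw [join_sub, inner_join, inner_neg_right, real_inner_comm]
    ring
  have hns : ‖proj y - x‖ ≤ ‖y - graphMap h x‖ := by
    have := norm_proj_le (y - graphMap h x)
    rwa [proj_sub, graphMap, proj_join] at this
  set s := ‖y - graphMap h x‖
  set a : ℝ := inner ℝ (∇ h x) (proj y - x)
  have hs0 : 0 ≤ s := norm_nonneg _
  have hr' : |σ * (h (proj y) - h x - a)| ≤ δ / 2 * s := by
    rw [abs_mul, hσ, one_mul]; exact hr.trans (by gcongr)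
  rw [abs_le] at hr'
  rw [hin]
  have hmul : σ / areaElement h x * (y 2 - h x - a) * areaElement h x = σ * (y 2 - h x - a) := by
    field_simp
  -- The area element is at least `1`, so multiplying by it keeps the threshold `δ * s` above the
  -- linearization error `δ / 2 * s`.
  have hJs : δ * s ≤ δ * s * areaElement h x := le_mul_of_one_le_right (by positivity) hJ
  have hds : 0 ≤ δ * s := by positivity
  constructor
  · intro hlt
    rw [hy]
    have := mul_lt_mul_of_pos_right hlt hJ0
    rw [hmul] at this
    nlinarith
  · intro hlt
    rw [hy, not_lt]
    have := mul_lt_mul_of_pos_right hlt hJ0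
    rw [hmul] at this
    nlinarith

/-- A function with a Borel graph, off which it is constant, is measurable. -/
theorem measurable_of_measurableSet_graph {X Y : Type*} [TopologicalSpace X] [PolishSpace X]
    [MeasurableSpace X] [BorelSpace X] [TopologicalSpace Y] [PolishSpace Y] [MeasurableSpace Y]
    [BorelSpace Y] {S : Set (X × Y)} (hS : MeasurableSet S)
    (hu : ∀ x y y', (x, y) ∈ S → (x, y') ∈ S → y = y') {F : X → Y} {c : Y}
    (h1 : ∀ x, (∃ y, (x, y) ∈ S) → (x, F x) ∈ S) (h0 : ∀ x, (¬∃ y, (x, y) ∈ S) → F x = c) :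
    Measurable F := by
  have himg : ∀ B : Set Y, MeasurableSet B → MeasurableSet (Prod.fst '' (S ∩ Prod.snd ⁻¹' B)) := by
    intro B hB
    -- Lusin–Souslin: the first projection is injective on the graph, so it sends Borel subsets of
    -- the graph to Borel sets.
    refine (hS.inter (measurable_snd hB)).image_of_continuousOn_injOn continuous_fst.continuousOn ?_
    rintro ⟨x, y⟩ hx ⟨x', y'⟩ hx' (rfl : x = x')
    rw [hu x y y' hx.1 hx'.1]
  have hA := himg univ MeasurableSet.univ
  simp only [preimage_univ, inter_univ] at hA
  intro B hB
  have : F ⁻¹' B = Prod.fst '' (S ∩ Prod.snd ⁻¹' B) ∪ ((Prod.fst '' S)ᶜ ∩ {_x | c ∈ B}) := by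
    ext x
    by_cases hx : ∃ y, (x, y) ∈ S
    · have hFx := h1 x hx
      have hx' : x ∈ Prod.fst '' S := ⟨(x, F x), hFx, rfl⟩
      simp only [mem_preimage, mem_union, mem_inter_iff, mem_compl_iff, hx', not_true, false_and,
        or_false]
      constructor
      · intro hB; exact ⟨(x, F x), ⟨hFx, hB⟩, rfl⟩
      · rintro ⟨⟨x', y⟩, ⟨hy, hyB⟩, rfl⟩
        rw [hu _ _ _ hFx hy]; exact hyB
    · have hx' : x ∉ Prod.fst '' S := by
        rintro ⟨⟨x', y⟩, hy, rfl⟩; exact hx ⟨y, hy⟩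
      have hx2 : x ∉ Prod.fst '' (S ∩ Prod.snd ⁻¹' B) := fun h => hx' (image_mono inter_subset_left h)
      simp [h0 x hx, hx', hx2]
  rw [this]
  exact (himg B hB).union (hA.compl.inter (MeasurableSet.const _))

/-- The graph of the normal field is Borel whatever `V` is. For aperture `1/(k+1)` and radius
`1/(m+1)` the cone condition on `(x, ν)` is closed, since its failure at a given `y` is an open
condition. -/
theorem measurable_outerNormal (V : Set Space) : Measurable (outerNormal V) := by
  set G : ℕ → ℕ → Set (Space × Space) := fun k m =>
    {q | ∀ y, ‖y - q.1‖ < 1 / ((m : ℝ) + 1) →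
      (inner ℝ (y - q.1) q.2 < -(1 / ((k : ℝ) + 1) * ‖y - q.1‖) → y ∈ V) ∧
      (1 / ((k : ℝ) + 1) * ‖y - q.1‖ < inner ℝ (y - q.1) q.2 → y ∉ V)} with hG
  have hGc : ∀ k m, IsClosed (G k m) := by
    intro k m
    have : (G k m)ᶜ = (⋃ y ∈ Vᶜ, {q : Space × Space | ‖y - q.1‖ < 1 / ((m : ℝ) + 1) ∧
        inner ℝ (y - q.1) q.2 < -(1 / ((k : ℝ) + 1) * ‖y - q.1‖)}) ∪
        (⋃ y ∈ V, {q : Space × Space | ‖y - q.1‖ < 1 / ((m : ℝ) + 1) ∧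
        1 / ((k : ℝ) + 1) * ‖y - q.1‖ < inner ℝ (y - q.1) q.2}) := by
      ext q
      simp only [hG, mem_compl_iff, mem_ofPred_eq, mem_union, mem_iUnion, exists_prop, not_forall]
      constructor
      · rintro ⟨y, hy, h⟩
        rw [not_and_or] at h
        rcases h with h | h
        · push Not at h; exact Or.inl ⟨y, h.2, hy, h.1⟩
        · push Not at h; exact Or.inr ⟨y, h.2, hy, h.1⟩
      · rintro (⟨y, hyV, hy, h⟩ | ⟨y, hyV, hy, h⟩)
        · exact ⟨y, hy, fun hh => hyV (hh.1 h)⟩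
        · exact ⟨y, hy, fun hh => hh.2 h hyV⟩
    rw [← isOpen_compl_iff, this]
    refine (isOpen_biUnion fun y _ => ?_).union (isOpen_biUnion fun y _ => ?_)
    · refine IsOpen.and (isOpen_lt ?_ ?_) (isOpen_lt ?_ ?_) <;> fun_prop
    · refine IsOpen.and (isOpen_lt ?_ ?_) (isOpen_lt ?_ ?_) <;> fun_prop
  have hSeq : {q : Space × Space | IsOuterNormalAt V q.1 q.2} =
      {q | ‖q.2‖ = 1} ∩ ⋂ k, ⋃ m, G k m := by
    ext ⟨x, ν⟩
    simp only [mem_ofPred_eq, IsOuterNormalAt, mem_inter_iff, mem_iInter, mem_iUnion, hG]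
    refine and_congr_right fun _ => ⟨fun h k => ?_, fun h δ hδ => ?_⟩
    · obtain ⟨r, hr, hrV⟩ := Metric.eventually_nhds_iff.mp (h (1 / ((k : ℝ) + 1)) (by positivity))
      obtain ⟨m, hm⟩ := exists_nat_one_div_lt hr
      exact ⟨m, fun y hy => hrV (by rw [dist_eq_norm]; exact hy.trans hm)⟩
    · obtain ⟨k, hk⟩ := exists_nat_one_div_lt hδ
      obtain ⟨m, hm⟩ := h k
      refine Metric.eventually_nhds_iff.mpr ⟨1 / ((m : ℝ) + 1), by positivity, fun y hy => ?_⟩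
      rw [dist_eq_norm] at hy
      have hle : 1 / ((k : ℝ) + 1) * ‖y - x‖ ≤ δ * ‖y - x‖ := by gcongr
      exact ⟨fun h' => (hm y hy).1 (by linarith), fun h' => (hm y hy).2 (by linarith)⟩
  have hS : MeasurableSet {q : Space × Space | IsOuterNormalAt V q.1 q.2} := by
    rw [hSeq]
    refine MeasurableSet.inter ?_ (MeasurableSet.iInter fun k => MeasurableSet.iUnion fun m =>
      (hGc k m).measurableSet)
    exact (isClosed_eq (by fun_prop) (by fun_prop)).measurableSet
  refine measurable_of_measurableSet_graph hS (fun x y y' h h' => IsOuterNormalAt.unique h h')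
    (c := 0) (fun x hx => ?_) (fun x hx => ?_)
  · have hx' : ∃ ν, IsOuterNormalAt V x ν := hx
    rw [outerNormal, dif_pos hx']; exact hx'.choose_spec
  · have hx' : ¬∃ ν, IsOuterNormalAt V x ν := hx
    rw [outerNormal, dif_neg hx']

/-! ### Boundary traces -/

theorem measure_ball_inter_pos {ω : Set Plane} (hω : IsOpen ω) {x : Plane} (hx : x ∈ closure ω)
    {r : ℝ} (hr : 0 < r) : 0 < volume (Metric.ball x r ∩ ω) := by
  obtain ⟨y, hy, hxy⟩ := Metric.mem_closure_iff.mp hx r hr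
  exact (Metric.isOpen_ball.inter hω).measure_pos _ ⟨y, by rwa [Metric.mem_ball, dist_comm], hy⟩

theorem measure_ball_inter_lt_top (ω : Set Plane) (x : Plane) (r : ℝ) :
    volume (Metric.ball x r ∩ ω) < ⊤ :=
  (measure_mono inter_subset_left).trans_lt Metric.isBounded_ball.measure_lt_top

theorem integrableOn_ball_inter {ω : Set Plane} {u : Plane → Space} (hu : ∀ᵐ x ∂(volume.restrict ω), ‖u x‖ ≤ 1)
    (hm : AEStronglyMeasurable u (volume.restrict ω)) (x : Plane) (r : ℝ) (a : Space) :
    IntegrableOn (fun y => ‖u y - a‖) (Metric.ball x r ∩ ω) := by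
  refine IntegrableOn.of_bound (measure_ball_inter_lt_top ω x r)
    ((hm.mono_set inter_subset_right).sub aestronglyMeasurable_const).norm (1 + ‖a‖) ?_
  filter_upwards [ae_mono (Measure.restrict_mono_set volume inter_subset_right) hu] with y hy
  rw [norm_norm]
  exact (norm_sub_le _ _).trans (by gcongr)

theorem IsTraceAt.nonpos_of_le_average {ω : Set Plane} {x : Plane}
    {u : Plane → Space} (hu : ∀ᵐ x ∂(volume.restrict ω), ‖u x‖ ≤ 1)
    (hm : AEStronglyMeasurable u (volume.restrict ω)) {a : Space} (ha : IsTraceAt ω u x a)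
    {c : ℝ} {b : Space} (h : ∀ r > 0, c ≤ ⨍ y in Metric.ball x r ∩ ω, (‖u y - a‖ + ‖u y - b‖))
    (hb : IsTraceAt ω u x b) : c ≤ 0 := by
  have hab := ha.add hb
  rw [add_zero] at hab
  refine ge_of_tendsto hab ?_
  filter_upwards [self_mem_nhdsWithin] with r hr
  refine (h r hr).trans_eq ?_
  rw [setAverage_eq, setAverage_eq, setAverage_eq, integral_add
    (integrableOn_ball_inter hu hm x r a) (integrableOn_ball_inter hu hm x r b), smul_add]

theorem le_setAverage {s : Set Plane} (h0 : volume s ≠ 0) (ht : volume s ≠ ⊤) {c : ℝ}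
    {f : Plane → ℝ} (hf : IntegrableOn f s) (h : ∀ᵐ y ∂(volume.restrict s), c ≤ f y) :
    c ≤ ⨍ y in s, f y := by
  have hfin : IsFiniteMeasure (volume.restrict s) := ⟨by simpa using ht.lt_top⟩
  have hne : NeZero (volume.restrict s) := ⟨by simpa using h0⟩
  have := integral_mono_ae (integrable_const c) hf h
  rw [setAverage_eq, smul_eq_mul]
  rw [integral_const, measureReal_restrict_apply_univ, smul_eq_mul] at this
  have hpos : 0 < volume.real s := ENNReal.toReal_pos h0 ht
  rw [inv_mul_eq_div, le_div_iff₀ hpos]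
  linarith

theorem IsTraceAt.unique {ω : Set Plane} (hω : IsOpen ω) {x : Plane} (hx : x ∈ closure ω)
    {u : Plane → Space} (hu : ∀ᵐ x ∂(volume.restrict ω), ‖u x‖ ≤ 1)
    (hm : AEStronglyMeasurable u (volume.restrict ω)) {a b : Space} (ha : IsTraceAt ω u x a)
    (hb : IsTraceAt ω u x b) : a = b := by
  have : ‖a - b‖ ≤ 0 := by
    refine ha.nonpos_of_le_average hu hm (fun r hr => ?_) hb
    refine le_setAverage (measure_ball_inter_pos hω hx hr).ne'
      (measure_ball_inter_lt_top ω x r).ne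
      ((integrableOn_ball_inter hu hm x r a).add (integrableOn_ball_inter hu hm x r b))
      (Eventually.of_forall fun y => ?_)
    have := norm_sub_le (u y - b) (u y - a)
    rw [sub_sub_sub_cancel_left] at this
    linarith
  exact sub_eq_zero.mp (norm_le_zero_iff.mp this)

theorem IsTraceAt.norm_le_one {ω : Set Plane} (hω : IsOpen ω) {x : Plane} (hx : x ∈ closure ω)
    {u : Plane → Space} (hu : ∀ᵐ x ∂(volume.restrict ω), ‖u x‖ ≤ 1)
    (hm : AEStronglyMeasurable u (volume.restrict ω)) {a : Space} (ha : IsTraceAt ω u x a) :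
    ‖a‖ ≤ 1 := by
  -- The previous criterion is used with `b = a`, which doubles the integrand.
  have : 2 * (‖a‖ - 1) ≤ 0 := by
    refine ha.nonpos_of_le_average hu hm (fun r hr => ?_) ha
    refine le_setAverage (measure_ball_inter_pos hω hx hr).ne'
      (measure_ball_inter_lt_top ω x r).ne
      ((integrableOn_ball_inter hu hm x r a).add (integrableOn_ball_inter hu hm x r a)) ?_
    filter_upwards [ae_mono (Measure.restrict_mono_set volume inter_subset_right) hu] with y hy
    have := norm_sub_norm_le a (u y)
    rw [norm_sub_rev] at this
    linarith
  linarith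

theorem norm_boundaryTrace_le {ω : Set Plane} (hω : IsOpen ω) {x : Plane} (hx : x ∈ closure ω)
    {u : Plane → Space} (hu : ∀ᵐ x ∂(volume.restrict ω), ‖u x‖ ≤ 1)
    (hm : AEStronglyMeasurable u (volume.restrict ω)) : ‖boundaryTrace ω u x‖ ≤ 1 := by
  rw [boundaryTrace]
  split_ifs with h
  · exact h.choose_spec.norm_le_one hω hx hu hm
  · simp

/-- The mean oscillation of `u` around `a` may be tested on rational radii. -/
theorem isTraceAt_iff_rat {ω : Set Plane} (hω : IsOpen ω) {x : Plane} (hx : x ∈ closure ω)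
    {u : Plane → Space} (hu : ∀ᵐ x ∂(volume.restrict ω), ‖u x‖ ≤ 1)
    (hm : AEStronglyMeasurable u (volume.restrict ω)) (a : Space) :
    IsTraceAt ω u x a ↔ ∀ k : ℕ, ∃ n : ℕ, ∀ q : ℚ, 0 < q → (q : ℝ) < 1 / ((n : ℝ) + 1) →
      ∫ y in Metric.ball x q ∩ ω, ‖u y - a‖ ≤
        1 / ((k : ℝ) + 1) * volume.real (Metric.ball x q ∩ ω) := by
  have hpos : ∀ r : ℝ, 0 < r → 0 < volume.real (Metric.ball x r ∩ ω) := fun r hr =>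
    ENNReal.toReal_pos (measure_ball_inter_pos hω hx hr).ne' (measure_ball_inter_lt_top ω x r).ne
  have havg : ∀ r : ℝ, 0 < r → ∀ c : ℝ, (⨍ y in Metric.ball x r ∩ ω, ‖u y - a‖) ≤ c ↔
      ∫ y in Metric.ball x r ∩ ω, ‖u y - a‖ ≤ c * volume.real (Metric.ball x r ∩ ω) := by
    intro r hr c
    rw [setAverage_eq, smul_eq_mul, inv_mul_eq_div, div_le_iff₀ (hpos r hr)]
  have hnn : ∀ r : ℝ, 0 ≤ ⨍ y in Metric.ball x r ∩ ω, ‖u y - a‖ := fun r => by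
    rw [setAverage_eq, smul_eq_mul]
    exact mul_nonneg (by positivity) (integral_nonneg fun y => norm_nonneg _)
  constructor
  · intro h k
    have h1 := (tendsto_order.mp h).2 (1 / ((k : ℝ) + 1)) (by positivity)
    obtain ⟨r, hr, hrs⟩ := mem_nhdsGT_iff_exists_Ioo_subset.mp h1
    obtain ⟨n, hn⟩ := exists_nat_one_div_lt (show (0 : ℝ) < r from hr)
    refine ⟨n, fun q hq hqn => ?_⟩
    have hq' : (0 : ℝ) < q := by exact_mod_cast hq
    exact (havg q hq' _).mp (le_of_lt (hrs ⟨hq', hqn.trans hn⟩))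
  · intro h
    refine tendsto_order.mpr ⟨fun c hc => Eventually.of_forall fun r => hc.trans_le (hnn r),
      fun c hc => ?_⟩
    obtain ⟨k, hk⟩ := exists_nat_one_div_lt hc
    obtain ⟨n, hn⟩ := h k
    filter_upwards [Ioo_mem_nhdsGT (show (0 : ℝ) < 1 / ((n : ℝ) + 1) by positivity)] with r hr
    refine lt_of_le_of_lt ((havg r hr.1 _).mpr ?_) hk
    -- Rational radii interlaced with a sequence increasing to `r` exhaust the ball of radius `r`,
    -- and the bound passes to the limit by monotone exhaustion.
    obtain ⟨s, hs1, hs2, hs3⟩ := exists_seq_strictMono_tendsto' (show (0 : ℝ) < r from hr.1)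
    have hq : ∀ j, ∃ q : ℚ, s j < q ∧ (q : ℝ) < s (j + 1) := fun j =>
      exists_rat_btwn (hs1 (Nat.lt_succ_self j))
    choose q hq1 hq2 using hq
    have hqm : Monotone fun j => ((q j : ℚ) : ℝ) := monotone_nat_of_le_succ fun j =>
      (hq2 j).le.trans (hq1 (j + 1)).le
    have hqr : ∀ j, (q j : ℝ) < r := fun j => (hq2 j).trans (hs2 _).2
    have hU : ⋃ j, Metric.ball x (q j) ∩ ω = Metric.ball x r ∩ ω := by
      rw [← iUnion_inter]
      congr 1
      ext y
      simp only [mem_iUnion, Metric.mem_ball]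
      constructor
      · rintro ⟨j, hj⟩; exact hj.trans (hqr j)
      · intro hy
        obtain ⟨j, hj⟩ := ((tendsto_order.mp hs3).1 _ hy).exists
        exact ⟨j, hj.trans (hq1 j)⟩
    have hlim := tendsto_setIntegral_of_monotone (μ := volume) (f := fun y => ‖u y - a‖)
      (s := fun j => Metric.ball x (q j) ∩ ω)
      (fun j => Metric.isOpen_ball.measurableSet.inter hω.measurableSet)
      (fun i j hij => inter_subset_inter_left _ (Metric.ball_subset_ball (hqm hij)))
      (by rw [hU]; exact integrableOn_ball_inter hu hm x r a)
    rw [hU] at hlim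
    refine le_of_tendsto' hlim fun j => ?_
    have hqj : (0 : ℝ) < q j := (hs2 j).1.trans (hq1 j)
    refine (hn (q j) (by exact_mod_cast hqj) ((hqr j).trans hr.2)).trans ?_
    gcongr
    · exact (measure_ball_inter_lt_top ω x r).ne
    · exact (hqr j).le

/-- With rational radii the trace condition is a countable combination of inequalities between
quantities measurable in `(x, a)`. Under the integral sign `u` may be replaced by a Borel
representative. -/
theorem measurableSet_isTraceAt {ω : Set Plane} (hω : IsOpen ω)
    {u : Plane → Space} (hu : ∀ᵐ x ∂(volume.restrict ω), ‖u x‖ ≤ 1)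
    (hm : AEStronglyMeasurable u (volume.restrict ω)) :
    MeasurableSet {p : Plane × Space | p.1 ∈ closure ω ∧ IsTraceAt ω u p.1 p.2} := by
  set v := hm.mk u
  have hv : StronglyMeasurable v := hm.stronglyMeasurable_mk
  have hball : ∀ q : ℚ, MeasurableSet {z : (Plane × Space) × Plane |
      z.2 ∈ Metric.ball z.1.1 q ∩ ω} := fun q => by
    have h : {z : (Plane × Space) × Plane | z.2 ∈ Metric.ball z.1.1 q ∩ ω} =
        {z | dist z.2 z.1.1 < q} ∩ Prod.snd ⁻¹' ω := by ext z; simp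
    rw [h]
    refine (measurableSet_lt ?_ ?_).inter (hω.measurableSet.preimage measurable_snd) <;> fun_prop
  have hI : ∀ q : ℚ, Measurable fun p : Plane × Space =>
      ∫ y in Metric.ball p.1 q ∩ ω, ‖u y - p.2‖ := by
    intro q
    have heq : (fun p : Plane × Space => ∫ y in Metric.ball p.1 q ∩ ω, ‖u y - p.2‖) =
        fun p => ∫ y, ({z : (Plane × Space) × Plane | z.2 ∈ Metric.ball z.1.1 q ∩ ω}.indicator
          fun z => ‖v z.2 - z.1.2‖) (p, y) := by
      funext p
      have hms : MeasurableSet (Metric.ball p.1 (q : ℝ) ∩ ω) :=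
        Metric.isOpen_ball.measurableSet.inter hω.measurableSet
      rw [show (fun y => ({z : (Plane × Space) × Plane | z.2 ∈ Metric.ball z.1.1 q ∩ ω}.indicator
          fun z => ‖v z.2 - z.1.2‖) (p, y)) =
          (Metric.ball p.1 (q : ℝ) ∩ ω).indicator fun y => ‖v y - p.2‖ from ?_,
        integral_indicator hms]
      · refine integral_congr_ae ?_
        filter_upwards [ae_mono (Measure.restrict_mono_set volume inter_subset_right) hm.ae_eq_mk]
          with y hy
        rw [hy]
      · funext y
        by_cases hy : y ∈ Metric.ball p.1 (q : ℝ) ∩ ω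
        · rw [indicator_of_mem hy, indicator_of_mem (show (p, y) ∈ _ from hy)]
        · rw [indicator_of_notMem hy, indicator_of_notMem (show (p, y) ∉ _ from hy)]
    rw [heq]
    refine (StronglyMeasurable.integral_prod_right (f := fun p y =>
      ({z : (Plane × Space) × Plane | z.2 ∈ Metric.ball z.1.1 q ∩ ω}.indicator
          fun z => ‖v z.2 - z.1.2‖) (p, y)) ?_).measurable
    refine StronglyMeasurable.indicator ?_ (hball q)
    exact ((hv.comp_measurable measurable_snd).sub
      (by fun_prop : Measurable fun z : (Plane × Space) × Plane => z.1.2).stronglyMeasurable).norm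
  have hVol : ∀ q : ℚ, Measurable fun p : Plane × Space =>
      volume.real (Metric.ball p.1 q ∩ ω) := by
    intro q
    have h := measurable_measure_prodMk_left (ν := (volume : Measure Plane)) (hball q)
    exact h.ennreal_toReal
  have hset : {p : Plane × Space | p.1 ∈ closure ω ∧ IsTraceAt ω u p.1 p.2} =
      {p | p.1 ∈ closure ω} ∩ ⋂ k : ℕ, ⋃ n : ℕ, ⋂ q : ℚ, {p | 0 < q → (q : ℝ) < 1 / ((n : ℝ) + 1) →
        ∫ y in Metric.ball p.1 q ∩ ω, ‖u y - p.2‖ ≤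
          1 / ((k : ℝ) + 1) * volume.real (Metric.ball p.1 q ∩ ω)} := by
    ext p
    simp only [mem_ofPred_eq, mem_inter_iff, mem_iInter, mem_iUnion]
    exact and_congr_right fun hp => isTraceAt_iff_rat hω hp hu hm p.2
  rw [hset]
  refine (isClosed_closure.measurableSet.preimage measurable_fst).inter ?_
  refine MeasurableSet.iInter fun k => MeasurableSet.iUnion fun n => MeasurableSet.iInter fun q => ?_
  by_cases h1 : 0 < q
  · by_cases h2 : (q : ℝ) < 1 / ((n : ℝ) + 1)
    · simp only [h1, h2, true_imp_iff]
      exact measurableSet_le (hI q) ((hVol q).const_mul _)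
    · simp only [h2, false_imp_iff, imp_true_iff, ofPred_true, MeasurableSet.univ]
  · simp only [h1, false_imp_iff, ofPred_true, MeasurableSet.univ]

-- The graph criterion already used for the normal applies again. The indicator is needed because
-- off the closure of `ω` small balls miss `ω`, so that every vector is a trace there.
open Classical in
theorem measurable_boundaryTrace {ω : Set Plane} (hω : IsOpen ω)
    {u : Plane → Space} (hu : ∀ᵐ x ∂(volume.restrict ω), ‖u x‖ ≤ 1)
    (hm : AEStronglyMeasurable u (volume.restrict ω)) :
    Measurable ((closure ω).indicator (boundaryTrace ω u)) := by
  refine measurable_of_measurableSet_graph (measurableSet_isTraceAt hω hu hm)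
    (fun x a b ha hb => ha.2.unique hω ha.1 hu hm hb.2) (c := 0) ?_ ?_
  · rintro x ⟨a, hx, ha⟩
    have hex : ∃ a, IsTraceAt ω u x a := ⟨a, ha⟩
    refine ⟨hx, ?_⟩
    rw [indicator_of_mem hx, boundaryTrace, dif_pos hex]
    exact hex.choose_spec
  · intro x hx
    by_cases hxc : x ∈ closure ω
    · rw [indicator_of_mem hxc, boundaryTrace, dif_neg]
      rintro ⟨a, ha⟩; exact hx ⟨a, hxc, ha⟩
    · rw [indicator_of_notMem hxc]

/-! ### Measures of quadratic growth -/

/-- `μ` of every closed ball of radius `r` is at most `C r²`. -/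
def QuadraticGrowth {E : Type*} [NormedAddCommGroup E] [MeasurableSpace E] (μ : Measure E)
    (C : ℝ) : Prop :=
  ∀ (y : E) (r : ℝ), 0 < r → μ (Metric.closedBall y r) ≤ ENNReal.ofReal (C * r ^ 2)

section QuadraticGrowth

variable {E : Type*} [NormedAddCommGroup E] [MeasurableSpace E]

theorem QuadraticGrowth.mono {μ ν : Measure E} {C : ℝ} (h : QuadraticGrowth μ C) (hν : ν ≤ μ) :
    QuadraticGrowth ν C :=
  fun y r hr => (hν _).trans (h y r hr)

theorem QuadraticGrowth.add {μ ν : Measure E} {C D : ℝ} (hC : 0 ≤ C) (hD : 0 ≤ D)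
    (h : QuadraticGrowth μ C) (h' : QuadraticGrowth ν D) : QuadraticGrowth (μ + ν) (C + D) := by
  intro y r hr
  rw [Measure.add_apply, add_mul, ENNReal.ofReal_add (by positivity) (by positivity)]
  exact add_le_add (h y r hr) (h' y r hr)

variable [BorelSpace E]

theorem lintegral_Ioi_inv_sq {C T : ℝ} (hC : 0 ≤ C) (hT : 0 < T) :
    ∫⁻ t in Ioi T, ENNReal.ofReal (C * (1 / t) ^ 2) = ENNReal.ofReal (C / T) := by
  have h1 : ∀ t ∈ Ioi T, C * (1 / t) ^ 2 = C * t ^ (-2 : ℝ) := fun t ht => by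
    have : 0 < t := hT.trans ht
    rw [Real.rpow_neg this.le, Real.rpow_two]; field_simp
  rw [setLIntegral_congr_fun measurableSet_Ioi (fun t ht => by rw [h1 t ht]),
    ← ofReal_integral_eq_lintegral_ofReal, integral_const_mul,
    integral_Ioi_rpow_of_lt (by norm_num) hT]
  · congr 1
    norm_num [Real.rpow_neg_one]
    rw [div_eq_mul_inv]
  · exact (integrableOn_Ioi_rpow_of_lt (by norm_num) hT).const_mul C
  · filter_upwards [ae_restrict_mem measurableSet_Ioi] with t ht
    have : 0 < t := hT.trans ht
    positivity

/-- Layer-cake formula: `{1 / ‖x - y‖ > t}` lies in the ball of radius `1/t`. Levels below `T` are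
bounded by the total mass, and the levels above by the integral of `C / t²`. The free parameter `T`
allows a small mass to be exploited. -/
theorem QuadraticGrowth.lintegral_inv_dist_le {μ : Measure E} {C : ℝ} (hC : 0 ≤ C)
    (h : QuadraticGrowth μ C) (y : E) {T : ℝ} (hT : 0 < T) :
    ∫⁻ x, ENNReal.ofReal (1 / ‖x - y‖) ∂μ ≤ ENNReal.ofReal T * μ univ + ENNReal.ofReal (C / T) := by
  have hm : Measurable fun x : E => 1 / ‖x - y‖ := by
    have : Measurable fun x : E => ‖x - y‖ := (by fun_prop : Continuous fun x : E => ‖x - y‖).measurable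
    fun_prop
  rw [lintegral_eq_lintegral_meas_lt μ (Eventually.of_forall fun x => by positivity)
    hm.aemeasurable]
  rw [← Ioc_union_Ioi_eq_Ioi hT.le, lintegral_union measurableSet_Ioi (by
    exact Ioc_disjoint_Ioi le_rfl)]
  gcongr
  · calc _ ≤ ∫⁻ _ in Ioc 0 T, μ univ := lintegral_mono fun t => measure_mono (subset_univ _)
      _ = _ := by rw [setLIntegral_const, Real.volume_Ioc, sub_zero, mul_comm]
  · rw [← lintegral_Ioi_inv_sq hC hT]
    refine setLIntegral_mono' measurableSet_Ioi fun t ht => ?_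
    have ht0 : 0 < t := hT.trans ht
    refine (measure_mono fun x hx => ?_).trans (h y (1 / t) (by positivity))
    rw [mem_closedBall_iff_norm]
    have hx' : t < 1 / ‖x - y‖ := hx
    rcases (norm_nonneg (x - y)).eq_or_lt with h0 | h0
    · rw [← h0]; positivity
    · rw [lt_div_iff₀ h0] at hx'
      rw [le_div_iff₀ ht0]; linarith

theorem QuadraticGrowth.integrable_inv_dist {μ : Measure E} [IsFiniteMeasure μ] {C : ℝ}
    (hC : 0 ≤ C) (h : QuadraticGrowth μ C) (y : E) : Integrable (fun x => 1 / ‖x - y‖) μ := by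
  have hm : Measurable fun x : E => 1 / ‖x - y‖ := by
    have : Measurable fun x : E => ‖x - y‖ := (by fun_prop : Continuous fun x : E => ‖x - y‖).measurable
    fun_prop
  refine ⟨hm.aestronglyMeasurable, ?_⟩
  rw [hasFiniteIntegral_iff_ofReal (Eventually.of_forall fun x => by positivity)]
  refine (h.lintegral_inv_dist_le hC y one_pos).trans_lt ?_
  simp [measure_lt_top]

theorem QuadraticGrowth.integral_inv_dist_le {μ : Measure E} [IsFiniteMeasure μ] {C : ℝ}
    (hC : 0 ≤ C) (h : QuadraticGrowth μ C) (y : E) {T : ℝ} (hT : 0 < T) :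
    ∫ x, 1 / ‖x - y‖ ∂μ ≤ T * μ.real univ + C / T := by
  rw [integral_eq_lintegral_of_nonneg_ae (Eventually.of_forall fun x => by positivity)
    (h.integrable_inv_dist hC y).aestronglyMeasurable]
  refine ENNReal.toReal_le_of_le_ofReal (by positivity) ?_
  refine (h.lintegral_inv_dist_le hC y hT).trans_eq ?_
  rw [ENNReal.ofReal_add (by positivity) (by positivity), ENNReal.ofReal_mul hT.le,
    Measure.real, ENNReal.ofReal_toReal (measure_ne_top _ _)]

end QuadraticGrowth

/-- The area of the unit disc. -/
def discArea : ℝ := volume.real (Metric.ball (0 : Plane) 1)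

theorem discArea_nonneg : 0 ≤ discArea := ENNReal.toReal_nonneg

theorem volume_closedBall_plane (x : Plane) {r : ℝ} (hr : 0 ≤ r) :
    volume (Metric.closedBall x r) = ENNReal.ofReal (discArea * r ^ 2) := by
  rw [Measure.addHaar_closedBall _ x hr, mul_comm discArea, ENNReal.ofReal_mul (by positivity),
    discArea, Measure.real, ENNReal.ofReal_toReal Metric.isBounded_ball.measure_lt_top.ne]
  simp

theorem quadraticGrowth_volume : QuadraticGrowth (volume : Measure Plane) discArea :=
  fun y _ hr => (volume_closedBall_plane y hr.le).le

/-- Since `Ψ` does not contract distances, the preimage of a ball of radius `r` lies in a disc of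
radius `2r` about any of its points; applying `Ψ` multiplies areas by at most `L²`. -/
theorem quadraticGrowth_of_param {Ψ : Plane → Space} {L : ℝ≥0} (hL : LipschitzWith L Ψ)
    (he : ∀ p q, ‖p - q‖ ≤ ‖Ψ p - Ψ q‖) {s : Set Space} (hs : s ⊆ range Ψ) :
    QuadraticGrowth ((Measure.euclideanHausdorffMeasure 2).restrict s)
      (4 * (L : ℝ) ^ 2 * discArea) := by
  intro y r hr
  rw [Measure.restrict_apply Metric.isClosed_closedBall.measurableSet]
  have hsub : Metric.closedBall y r ∩ s ⊆ Ψ '' (Ψ ⁻¹' Metric.closedBall y r) := by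
    rintro x ⟨hx, hxs⟩
    obtain ⟨p, rfl⟩ := hs hxs
    exact ⟨p, hx, rfl⟩
  have hvol : volume (Ψ ⁻¹' Metric.closedBall y r) ≤ ENNReal.ofReal (discArea * (2 * r) ^ 2) := by
    rcases (Ψ ⁻¹' Metric.closedBall y r).eq_empty_or_nonempty with h | ⟨p₀, hp₀⟩
    · simp [h]
    · rw [← volume_closedBall_plane p₀ (by positivity)]
      refine measure_mono fun p hp => ?_
      rw [mem_preimage, Metric.mem_closedBall] at hp hp₀
      rw [mem_closedBall_iff_norm]
      refine (he p p₀).trans ?_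
      rw [← dist_eq_norm]
      refine (dist_triangle_right _ _ y).trans (by linarith)
  calc _ ≤ _ := measure_mono hsub
    _ ≤ _ := hausdorff_image_le hL _
    _ ≤ (L : ℝ≥0∞) ^ 2 * ENNReal.ofReal (discArea * (2 * r) ^ 2) := by gcongr
    _ = _ := by
      rw [← ENNReal.ofReal_coe_nnreal, ← ENNReal.ofReal_pow (by positivity),
        ← ENNReal.ofReal_mul (by positivity)]
      congr 1; ring

/-! ### Lipschitz boundaries -/

/-- A cover of `Γ` by finitely many compact Lipschitz graphs. -/
structure CurveCover (Γ : Set Plane) where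
  /-- the index set -/
  ι : Finset Plane
  /-- the curves -/
  c : Plane → ℝ → Plane
  /-- the Lipschitz constants -/
  L : Plane → ℝ≥0
  /-- the half-length of the parameter interval -/
  ρ : ℝ
  ρ_pos : 0 < ρ
  lip : ∀ k ∈ ι, LipschitzWith (L k) (c k)
  expand : ∀ k ∈ ι, ∀ s t, |s - t| ≤ ‖c k s - c k t‖
  cover : Γ ⊆ ⋃ k ∈ ι, c k '' Icc (-ρ) ρ

theorem lipschitz_of_coord {R : Plane ≃ₗᵢ[ℝ] Plane} {γ : ℝ → ℝ} {K : ℝ≥0} (hγ : LipschitzWith K γ) :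
    LipschitzWith (1 + K) fun t => R.symm !₂[t, γ t] := by
  refine LipschitzWith.of_dist_le_mul fun s t => ?_
  rw [R.symm.dist_map, dist_eq_norm]
  have h := hγ.dist_le_mul s t
  rw [Real.dist_eq] at h ⊢
  have h2 : ‖(!₂[s, γ s] - !₂[t, γ t] : Plane)‖ ^ 2 = (s - t) ^ 2 + (γ s - γ t) ^ 2 := by
    rw [norm_sq_plane]; simp
  rw [Real.dist_eq] at h
  refine (sq_le_sq₀ (norm_nonneg _) (by positivity)).mp ?_
  rw [h2]
  push_cast
  have h3 := pow_le_pow_left₀ (abs_nonneg (γ s - γ t)) h 2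
  rw [sq_abs] at h3
  have h4 : 0 ≤ (K : ℝ) * |s - t| ^ 2 := by positivity
  rw [← sq_abs (s - t)]
  nlinarith

/-- A boundary point in a chart cannot lie strictly above or strictly below the Lipschitz graph,
since it would then be interior to `ω` or to its complement. Compactness leaves finitely many
charts, and a norm bound `ρ` on the boundary bounds the parameters. -/
theorem exists_curveCover {ω : Set Plane} (hb : Bornology.IsBounded ω)
    (hl : HasLipschitzBoundary ω) : Nonempty (CurveCover (frontier ω)) := by
  classical
  have hcpt : IsCompact (frontier ω) := (Metric.isCompact_of_isClosed_isBounded isClosed_closure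
    hb.closure).of_isClosed_subset isClosed_frontier frontier_subset_closure
  obtain ⟨ρ, hρ, hρb⟩ := hcpt.isBounded.exists_pos_norm_le
  have hex : ∀ x : Plane, ∃ (U : Set Plane) (c : ℝ → Plane) (L : ℝ≥0), x ∈ frontier ω →
      U ∈ 𝓝 x ∧ LipschitzWith L c ∧ (∀ s t, |s - t| ≤ ‖c s - c t‖) ∧
        frontier ω ∩ U ⊆ c '' Icc (-ρ) ρ := by
    intro x
    by_cases hx : x ∈ frontier ω
    swap
    · exact ⟨∅, 0, 0, fun h => (hx h).elim⟩
    obtain ⟨U, hU, R, γ, ⟨K, hγ⟩, hUγ⟩ := hl x hx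
    refine ⟨interior U, fun t => R.symm !₂[t, γ t], 1 + K, fun _ => ⟨interior_mem_nhds.mpr hU,
      lipschitz_of_coord hγ, fun s t => ?_, ?_⟩⟩
    · rw [← map_sub, R.symm.norm_map]
      simpa using abs_apply_le_norm_plane (!₂[s, γ s] - !₂[t, γ t]) 0
    · rintro y ⟨hyω, hyU⟩
      have hcont : Continuous fun z : Plane => R z 1 - γ (R z 0) := by
        have := hγ.continuous; fun_prop
      have hev : ∀ᶠ z in 𝓝 y, z ∈ U := mem_interior_iff_mem_nhds.mp hyU
      have heq : R y 1 = γ (R y 0) := by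
        rcases lt_trichotomy (R y 1 - γ (R y 0)) 0 with h | h | h
        · exfalso
          have h1 := hcont.continuousAt.eventually_lt continuousAt_const h
          have : ∀ᶠ z in 𝓝 y, z ∉ ω := by
            filter_upwards [hev, h1] with z hz hz1 hzω
            have := (hUγ z hz).mp hzω
            linarith
          exact mem_closure_iff_frequently.mp (frontier_subset_closure hyω) this
        · linarith
        · exfalso
          have h1 := continuousAt_const.eventually_lt hcont.continuousAt h
          have : ∀ᶠ z in 𝓝 y, z ∈ ω := by
            filter_upwards [hev, h1] with z hz hz1
            exact (hUγ z hz).mpr (by linarith)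
          exact hyω.2 (mem_interior_iff_mem_nhds.mpr this)
      refine ⟨R y 0, ?_, ?_⟩
      · have h1 := abs_apply_le_norm_plane (R y) 0
        rw [R.norm_map] at h1
        exact abs_le.mp (h1.trans (hρb y hyω))
      · have : !₂[R y 0, γ (R y 0)] = R y := by
          ext i; fin_cases i
          · rfl
          · exact heq.symm
        simp [this]
  choose U c L hUc using hex
  obtain ⟨ι, hι, hcov⟩ := hcpt.elim_nhds_subcover U fun x hx => (hUc x hx).1
  refine ⟨⟨ι, c, L, ρ, hρ, fun k hk => (hUc k (hι k hk)).2.1, fun k hk => (hUc k (hι k hk)).2.2.1,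
    fun y hy => ?_⟩⟩
  obtain ⟨k, hk, hyk⟩ := mem_iUnion₂.mp (hcov hy)
  exact mem_iUnion₂.mpr ⟨k, hk, (hUc k (hι k hk)).2.2.2 ⟨hy, hyk⟩⟩

/-- The volume of a tube around a compact Lipschitz curve. -/
theorem volume_tube_curve_le {c : ℝ → Plane} {L : ℝ≥0} (hL : LipschitzWith L c) {ρ : ℝ}
    (hρ : 0 < ρ) {ε : ℝ} (hε : 0 < ε) (hε1 : ε ≤ 1) :
    volume {x | ∃ y ∈ c '' Icc (-ρ) ρ, dist x y ≤ 2 * ε} ≤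
      ENNReal.ofReal ((2 * ρ + 2) * discArea * (L + 2) ^ 2 * ε) := by
  -- Parameters are rounded down to the grid `-ρ + kε`. This moves the point on the curve by at most
  -- `Lε`, which explains the radius `(L + 2) ε`; the `+ 1` accounts for both endpoints.
  set N := ⌈2 * ρ / ε⌉₊ + 1 with hN
  have hsub : {x | ∃ y ∈ c '' Icc (-ρ) ρ, dist x y ≤ 2 * ε} ⊆
      ⋃ k ∈ Finset.range N, Metric.closedBall (c (-ρ + k * ε)) ((L + 2) * ε) := by
    rintro x ⟨_, ⟨t, ht, rfl⟩, hx⟩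
    set k := ⌊(t + ρ) / ε⌋₊ with hk
    have h0 : 0 ≤ (t + ρ) / ε := by have := ht.1; apply div_nonneg <;> linarith
    have h1 : (k : ℝ) ≤ (t + ρ) / ε := Nat.floor_le h0
    have h2 : (t + ρ) / ε < k + 1 := Nat.lt_floor_add_one _
    rw [le_div_iff₀ hε] at h1
    rw [div_lt_iff₀ hε] at h2
    refine mem_iUnion₂.mpr ⟨k, ?_, ?_⟩
    · rw [Finset.mem_range, hN, Nat.lt_succ_iff]
      have : (t + ρ) / ε ≤ 2 * ρ / ε := by have := ht.2; gcongr; linarith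
      exact (Nat.floor_le_floor this).trans (Nat.floor_le_ceil _)
    · rw [Metric.mem_closedBall]
      have h3 := hL.dist_le_mul t (-ρ + k * ε)
      have h4 : dist t (-ρ + k * ε) ≤ ε := by
        rw [Real.dist_eq, abs_le]; constructor <;> linarith
      calc _ ≤ dist x (c t) + dist (c t) (c (-ρ + k * ε)) := dist_triangle _ _ _
        _ ≤ 2 * ε + L * ε := add_le_add hx (h3.trans (by gcongr))
        _ = _ := by ring
  refine (measure_mono hsub).trans ((measure_biUnion_finset_le _ _).trans ?_)
  rw [Finset.sum_congr rfl fun k _ => volume_closedBall_plane _ (by positivity), Finset.sum_const,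
    Finset.card_range, nsmul_eq_mul, ← ENNReal.ofReal_natCast, ← ENNReal.ofReal_mul (by positivity)]
  refine ENNReal.ofReal_le_ofReal ?_
  have hNle : (N : ℝ) * ε ≤ 2 * ρ + 2 := by
    have : (⌈2 * ρ / ε⌉₊ : ℝ) < 2 * ρ / ε + 1 := Nat.ceil_lt_add_one (by positivity)
    have h2 : (2 * ρ / ε + 1 + 1) * ε = 2 * ρ + 2 * ε := by field_simp; ring
    rw [hN]; push_cast
    nlinarith
  calc (N : ℝ) * (discArea * ((L + 2) * ε) ^ 2) = (N * ε) * (discArea * (L + 2) ^ 2 * ε) := by ring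
    _ ≤ (2 * ρ + 2) * (discArea * (L + 2) ^ 2 * ε) := by
      have := discArea_nonneg
      gcongr
    _ = _ := by ring

theorem exists_volume_tube_le {Γ : Set Plane} (h : CurveCover Γ) :
    ∃ C : ℝ, 0 ≤ C ∧ ∀ ε, 0 < ε → ε ≤ 1 →
      volume {x | ∃ y ∈ Γ, dist x y ≤ 2 * ε} ≤ ENNReal.ofReal (C * ε) := by
  have hd := discArea_nonneg
  have hρ := h.ρ_pos
  refine ⟨∑ k ∈ h.ι, (2 * h.ρ + 2) * discArea * (h.L k + 2) ^ 2,
    Finset.sum_nonneg fun k _ => by positivity, fun ε hε hε1 => ?_⟩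
  have hsub : {x | ∃ y ∈ Γ, dist x y ≤ 2 * ε} ⊆
      ⋃ k ∈ h.ι, {x | ∃ y ∈ h.c k '' Icc (-h.ρ) h.ρ, dist x y ≤ 2 * ε} := by
    rintro x ⟨y, hy, hxy⟩
    obtain ⟨k, hk, hyk⟩ := mem_iUnion₂.mp (h.cover hy)
    exact mem_iUnion₂.mpr ⟨k, hk, y, hyk, hxy⟩
  refine (measure_mono hsub).trans ((measure_biUnion_finset_le _ _).trans ?_)
  rw [Finset.sum_mul, ENNReal.ofReal_sum_of_nonneg fun k _ => by positivity]
  exact Finset.sum_le_sum fun k hk => volume_tube_curve_le (h.lip k hk) hρ hε hε1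

/-- The cylinder over a curve. -/
def cylinderMap (c : ℝ → Plane) (p : Plane) : Space := join (c (p 0)) (p 1)

theorem lipschitz_cylinderMap {c : ℝ → Plane} {L : ℝ≥0} (hL : LipschitzWith L c) :
    LipschitzWith (1 + L) (cylinderMap c) := by
  refine LipschitzWith.of_dist_le_mul fun p q => ?_
  rw [dist_eq_norm, dist_eq_norm, cylinderMap, cylinderMap, join_sub]
  refine (norm_join_le _ _).trans ?_
  have h1 := hL.dist_le_mul (p 0) (q 0)
  rw [dist_eq_norm, Real.dist_eq] at h1
  have h2 := abs_apply_le_norm_plane (p - q) 0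
  have h3 := abs_apply_le_norm_plane (p - q) 1
  simp only [PiLp.sub_apply] at h2 h3
  push_cast
  have : (L : ℝ) * |p 0 - q 0| ≤ L * ‖p - q‖ := by gcongr
  linarith

theorem norm_sub_le_cylinderMap {c : ℝ → Plane} (h : ∀ s t, |s - t| ≤ ‖c s - c t‖) (p q : Plane) :
    ‖p - q‖ ≤ ‖cylinderMap c p - cylinderMap c q‖ := by
  rw [cylinderMap, cylinderMap, join_sub]
  refine (sq_le_sq₀ (norm_nonneg _) (norm_nonneg _)).mp ?_
  rw [norm_sq_join, norm_sq_plane]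
  simp only [PiLp.sub_apply]
  have := pow_le_pow_left₀ (abs_nonneg _) (h (p 0) (q 0)) 2
  rw [sq_abs] at this
  linarith

theorem volume_box_plane {a b c d : ℝ} :
    volume {p : Plane | p 0 ∈ Icc a b ∧ p 1 ∈ Icc c d} =
      ENNReal.ofReal (b - a) * ENNReal.ofReal (d - c) := by
  have h := PiLp.volume_preserving_ofLp (Fin 2)
  have hs : {p : Plane | p 0 ∈ Icc a b ∧ p 1 ∈ Icc c d} =
      WithLp.ofLp ⁻¹' (Set.pi univ ![Icc a b, Icc c d]) := by
    ext p; simp [Set.mem_pi, Fin.forall_fin_two]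
  rw [hs, h.measure_preimage, volume_pi, Measure.pi_pi]
  · simp [Fin.prod_univ_two]
  · refine (MeasurableSet.univ_pi fun i => ?_).nullMeasurableSet
    fin_cases i <;> exact measurableSet_Icc

theorem exists_quadraticGrowth_cylinder {Γ : Set Plane} (h : CurveCover Γ) :
    ∃ C : ℝ, 0 ≤ C ∧ QuadraticGrowth
      ((Measure.euclideanHausdorffMeasure 2).restrict {x : Space | proj x ∈ Γ}) C := by
  have hd := discArea_nonneg
  refine ⟨∑ k ∈ h.ι, 4 * ((1 + h.L k : ℝ≥0) : ℝ) ^ 2 * discArea,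
    Finset.sum_nonneg fun k _ => by positivity, fun y r hr => ?_⟩
  have hsub : {x : Space | proj x ∈ Γ} ⊆ ⋃ k ∈ h.ι, range (cylinderMap (h.c k)) := by
    intro x hx
    obtain ⟨k, hk, t, -, ht⟩ := mem_iUnion₂.mp (h.cover hx)
    refine mem_iUnion₂.mpr ⟨k, hk, !₂[t, x 2], ?_⟩
    change join (h.c k t) (x 2) = x
    rw [ht, join_proj]
  rw [Measure.restrict_apply Metric.isClosed_closedBall.measurableSet]
  calc _ ≤ Measure.euclideanHausdorffMeasure 2
        (⋃ k ∈ h.ι, Metric.closedBall y r ∩ range (cylinderMap (h.c k))) := by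
        refine measure_mono ?_
        rw [← inter_iUnion₂]
        exact inter_subset_inter_right _ hsub
    _ ≤ ∑ k ∈ h.ι, Measure.euclideanHausdorffMeasure 2
        (Metric.closedBall y r ∩ range (cylinderMap (h.c k))) := measure_biUnion_finset_le _ _
    _ ≤ ∑ k ∈ h.ι, ENNReal.ofReal (4 * ((1 + h.L k : ℝ≥0) : ℝ) ^ 2 * discArea * r ^ 2) := by
        refine Finset.sum_le_sum fun k hk => ?_
        have := quadraticGrowth_of_param (lipschitz_cylinderMap (h.lip k hk))
          (norm_sub_le_cylinderMap (h.expand k hk)) (subset_refl _) y r hr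
        rwa [Measure.restrict_apply Metric.isClosed_closedBall.measurableSet] at this
    _ = _ := by rw [Finset.sum_mul, ENNReal.ofReal_sum_of_nonneg fun k _ => by positivity]

/-- With `T` of order `ε`, this makes the lateral face of the film a set of area `O(ε)`. -/
theorem exists_hausdorff_cylinder_le {Γ : Set Plane} (h : CurveCover Γ) :
    ∃ C : ℝ, 0 ≤ C ∧ ∀ T, 0 ≤ T →
      Measure.euclideanHausdorffMeasure 2 {x : Space | proj x ∈ Γ ∧ x 2 ∈ Icc 0 T} ≤
        ENNReal.ofReal (C * T) := by
  have hρ := h.ρ_pos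
  refine ⟨∑ k ∈ h.ι, ((1 + h.L k : ℝ≥0) : ℝ) ^ 2 * (2 * h.ρ),
    Finset.sum_nonneg fun k _ => by positivity, fun T hT => ?_⟩
  have hsub : {x : Space | proj x ∈ Γ ∧ x 2 ∈ Icc 0 T} ⊆ ⋃ k ∈ h.ι, cylinderMap (h.c k) ''
      {p : Plane | p 0 ∈ Icc (-h.ρ) h.ρ ∧ p 1 ∈ Icc 0 T} := by
    rintro x ⟨hx, hxT⟩
    obtain ⟨k, hk, t, ht1, ht⟩ := mem_iUnion₂.mp (h.cover hx)
    refine mem_iUnion₂.mpr ⟨k, hk, !₂[t, x 2], ⟨ht1, hxT⟩, ?_⟩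
    change join (h.c k t) (x 2) = x
    rw [ht, join_proj]
  refine (measure_mono hsub).trans ((measure_biUnion_finset_le _ _).trans ?_)
  rw [Finset.sum_mul, ENNReal.ofReal_sum_of_nonneg fun k _ => by positivity]
  refine Finset.sum_le_sum fun k hk => ?_
  refine (hausdorff_image_le (lipschitz_cylinderMap (h.lip k hk)) _).trans_eq ?_
  rw [volume_box_plane, ← ENNReal.ofReal_coe_nnreal, ← ENNReal.ofReal_pow (by positivity),
    ← ENNReal.ofReal_mul (by linarith), ← ENNReal.ofReal_mul (by positivity)]
  congr 1; ring

/-! ### Rescaled profiles -/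

/-- The profile `x' ↦ ε f(x'/ε)`. -/
def rescale (ε : ℝ) (f : Plane → ℝ) (x : Plane) : ℝ := ε * f (ε⁻¹ • x)

theorem lipschitz_rescale {ε : ℝ} (hε : 0 < ε) {f : Plane → ℝ} {K : ℝ≥0} (hf : LipschitzWith K f) :
    LipschitzWith K (rescale ε f) := by
  refine LipschitzWith.of_dist_le_mul fun x y => ?_
  have h := hf.dist_le_mul (ε⁻¹ • x) (ε⁻¹ • y)
  rw [Real.dist_eq] at h ⊢
  rw [dist_smul₀, Real.norm_eq_abs, abs_of_pos (inv_pos.mpr hε)] at h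
  rw [rescale, rescale, ← mul_sub, abs_mul, abs_of_pos hε]
  calc ε * |f (ε⁻¹ • x) - f (ε⁻¹ • y)| ≤ ε * (K * (ε⁻¹ * dist x y)) := by gcongr
    _ = K * dist x y := by field_simp

theorem gradient_rescale {ε : ℝ} (hε : ε ≠ 0) (f : Plane → ℝ) (x : Plane) :
    ∇ (rescale ε f) x = ∇ f (ε⁻¹ • x) := by
  have h : fderiv ℝ (rescale ε f) x = fderiv ℝ f (ε⁻¹ • x) := by
    have h1 : rescale ε f = ε • fun x => f (ε⁻¹ • x) := rfl
    rw [h1, fderiv_const_smul_field, Pi.smul_apply, fderiv_comp_smul, smul_inv_smul₀ hε]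
  rw [gradient, gradient, h]

theorem graphNormal_rescale {ε : ℝ} (hε : ε ≠ 0) (f : Plane → ℝ) (x : Plane) :
    graphNormal (rescale ε f) x = graphNormal f (ε⁻¹ • x) := by
  rw [graphNormal_eq_join, graphNormal_eq_join, gradient_rescale hε]

theorem IsCellPeriodic.add_intCast {f : Plane → ℝ} (hf : IsCellPeriodic f) (x : Plane) (i : Fin 2)
    (n : ℤ) : f (x + (n : ℝ) • EuclideanSpace.single i 1) = f x := by
  induction n using Int.induction_on with
  | zero => simp
  | succ n ih =>
    rw [← ih, ← hf (x + ((n : ℤ) : ℝ) • EuclideanSpace.single i 1) i]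
    congr 1; push_cast; rw [add_smul, one_smul]; abel
  | pred n ih =>
    rw [← ih, ← hf (x + ((-(n : ℤ) - 1 : ℤ) : ℝ) • EuclideanSpace.single i 1) i]
    congr 1; push_cast; rw [sub_smul, one_smul]; abel

theorem IsCellPeriodic.exists_bound {f : Plane → ℝ} (hf : IsCellPeriodic f) (hc : Continuous f) :
    ∃ C : ℝ, 0 ≤ C ∧ ∀ x, |f x| ≤ C := by
  obtain ⟨C, hC⟩ := (isCompact_closedBall (0 : Plane) 2).exists_bound_of_continuousOn
    hc.continuousOn
  refine ⟨|C|, abs_nonneg _, fun x => ?_⟩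
  set y : Plane := x + ((-⌊x 0⌋ : ℤ) : ℝ) • EuclideanSpace.single 0 1 +
    ((-⌊x 1⌋ : ℤ) : ℝ) • EuclideanSpace.single 1 1 with hy
  have h1 : f y = f x := by rw [hy, hf.add_intCast, hf.add_intCast]
  have h2 : y ∈ Metric.closedBall (0 : Plane) 2 := by
    rw [mem_closedBall_zero_iff]
    refine (sq_le_sq₀ (norm_nonneg _) (by norm_num)).mp ?_
    have e0 : y 0 = Int.fract (x 0) := by simp [hy, Int.fract, sub_eq_add_neg]
    have e1 : y 1 = Int.fract (x 1) := by simp [hy, Int.fract, sub_eq_add_neg]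
    rw [norm_sq_plane, e0, e1]
    nlinarith [Int.fract_nonneg (x 0), Int.fract_lt_one (x 0), Int.fract_nonneg (x 1),
      Int.fract_lt_one (x 1)]
  rw [← h1]
  exact (hC y h2).trans (le_abs_self C)

/-! ### The boundary of the film -/

section Film

variable {ω : Set Plane} {f₁ f₂ : Plane → ℝ} {ε : ℝ}

theorem mem_film {x : Space} : x ∈ film ω f₁ f₂ ε ↔
    proj x ∈ ω ∧ rescale ε f₁ (proj x) < x 2 ∧ x 2 < rescale ε f₂ (proj x) := Iff.rfl

theorem continuous_rescale {f : Plane → ℝ} (hf : Continuous f) : Continuous (rescale ε f) := by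
  unfold rescale; fun_prop

theorem isOpen_film (hω : IsOpen ω) (h₁ : Continuous f₁) (h₂ : Continuous f₂) :
    IsOpen (film ω f₁ f₂ ε) := by
  have c1 := continuous_rescale (ε := ε) h₁
  have c2 := continuous_rescale (ε := ε) h₂
  have : film ω f₁ f₂ ε = proj ⁻¹' ω ∩ ({x | rescale ε f₁ (proj x) < x 2} ∩
      {x | x 2 < rescale ε f₂ (proj x)}) := by ext x; exact mem_film
  rw [this]
  refine (hω.preimage continuous_proj).inter (IsOpen.inter (isOpen_lt ?_ ?_) (isOpen_lt ?_ ?_)) <;>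
  fun_prop

theorem closure_film_subset (h₁ : Continuous f₁) (h₂ : Continuous f₂) {x : Space}
    (hx : x ∈ closure (film ω f₁ f₂ ε)) :
    proj x ∈ closure ω ∧ rescale ε f₁ (proj x) ≤ x 2 ∧ x 2 ≤ rescale ε f₂ (proj x) := by
  have c1 := continuous_rescale (ε := ε) h₁
  have c2 := continuous_rescale (ε := ε) h₂
  refine ⟨map_mem_closure continuous_proj hx fun y hy => hy.1, ?_, ?_⟩
  · have : IsClosed {x : Space | rescale ε f₁ (proj x) ≤ x 2} := isClosed_le (by fun_prop) (by fun_prop)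
    exact closure_minimal (fun y hy => le_of_lt (mem_film.mp hy).2.1) this hx
  · have : IsClosed {x : Space | x 2 ≤ rescale ε f₂ (proj x)} := isClosed_le (by fun_prop) (by fun_prop)
    exact closure_minimal (fun y hy => le_of_lt (mem_film.mp hy).2.2) this hx

/-- The lateral part of the boundary of the film. -/
def lateral (ω : Set Plane) (f₁ f₂ : Plane → ℝ) (ε : ℝ) : Set Space :=
  frontier (film ω f₁ f₂ ε) ∩ {x | proj x ∈ frontier ω}

theorem frontier_film (hω : IsOpen ω) (h₁ : Continuous f₁) (h₂ : Continuous f₂) (hε : 0 < ε)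
    (hlt : ∀ x, f₁ x < f₂ x) :
    frontier (film ω f₁ f₂ ε) = graphMap (rescale ε f₁) '' ω ∪ graphMap (rescale ε f₂) '' ω ∪
      lateral ω f₁ f₂ ε := by
  have hr : ∀ x, rescale ε f₁ x < rescale ε f₂ x := fun x => mul_lt_mul_of_pos_left (hlt _) hε
  have hopen := isOpen_film (ε := ε) hω h₁ h₂
  have hcl : ∀ x ∈ ω, ∀ t : ℝ → ℝ, Continuous t → (∀ s ∈ Ioo (0 : ℝ) 1,
      rescale ε f₁ x < t s ∧ t s < rescale ε f₂ x) →
      join x (t 0) ∈ closure (film ω f₁ f₂ ε) := by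
    intro x hx t ht hts
    have hc : Continuous fun s => join x (t s) := continuous_join.comp (continuous_const.prodMk ht)
    have hlim : Tendsto (fun s => join x (t s)) (𝓝[>] 0) (𝓝 (join x (t 0))) :=
      hc.continuousAt.tendsto.mono_left nhdsWithin_le_nhds
    refine mem_closure_of_tendsto hlim ?_
    filter_upwards [Ioo_mem_nhdsGT (zero_lt_one (α := ℝ))] with s hs
    rw [mem_film, proj_join]
    exact ⟨hx, hts s hs⟩
  ext x
  constructor
  · intro hx
    have h := closure_film_subset h₁ h₂ (frontier_subset_closure hx)
    have hnot : x ∉ film ω f₁ f₂ ε := fun hm => hx.2 (by rwa [hopen.interior_eq])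
    by_cases hxω : proj x ∈ ω
    · left
      rcases h.2.1.eq_or_lt with h1 | h1
      · left; exact ⟨proj x, hxω, by rw [graphMap, h1, join_proj]⟩
      rcases h.2.2.eq_or_lt with h2 | h2
      · right; exact ⟨proj x, hxω, by rw [graphMap, ← h2, join_proj]⟩
      · exact (hnot ⟨hxω, h1, h2⟩).elim
    · right
      exact ⟨hx, h.1, by rwa [hω.interior_eq]⟩
  · rintro ((⟨y, hy, rfl⟩ | ⟨y, hy, rfl⟩) | hx)
    · refine ⟨?_, fun h => ?_⟩
      · have := hcl y hy (fun s => rescale ε f₁ y + s * (rescale ε f₂ y - rescale ε f₁ y))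
          (by fun_prop) fun s hs => ⟨by nlinarith [hr y, hs.1], by nlinarith [hr y, hs.2]⟩
        simpa [graphMap] using this
      · rw [hopen.interior_eq, mem_film, graphMap, proj_join] at h
        exact lt_irrefl _ h.2.1
    · refine ⟨?_, fun h => ?_⟩
      · have := hcl y hy (fun s => rescale ε f₂ y - s * (rescale ε f₂ y - rescale ε f₁ y))
          (by fun_prop) fun s hs => ⟨by nlinarith [hr y, hs.2], by nlinarith [hr y, hs.1]⟩
        simpa [graphMap] using this
      · rw [hopen.interior_eq, mem_film, graphMap, proj_join] at h
        exact lt_irrefl _ h.2.2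
    · exact hx.1

theorem lateral_subset (h₁ : Continuous f₁) (h₂ : Continuous f₂) (hε : 0 < ε)
    (h₁0 : ∀ x, 0 < f₁ x) {C : ℝ} (hC : ∀ x, |f₂ x| ≤ C) :
    lateral ω f₁ f₂ ε ⊆ {x | proj x ∈ frontier ω ∧ x 2 ∈ Icc 0 (ε * C)} := by
  intro x hx
  have h := closure_film_subset h₁ h₂ (frontier_subset_closure hx.1)
  refine ⟨hx.2, (mul_pos hε (h₁0 _)).le.trans h.2.1, h.2.2.trans ?_⟩
  exact mul_le_mul_of_nonneg_left ((le_abs_self _).trans (hC _)) hε.le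

theorem measurableSet_lateral : MeasurableSet (lateral ω f₁ f₂ ε) :=
  isClosed_frontier.measurableSet.inter
    (isClosed_frontier.measurableSet.preimage continuous_proj.measurable)

theorem surfaceMeasure_eq (hω : IsOpen ω) (h₁ : Continuous f₁) (h₂ : Continuous f₂) (hε : 0 < ε)
    (hlt : ∀ x, f₁ x < f₂ x) :
    surfaceMeasure ω f₁ f₂ ε =
      (Measure.euclideanHausdorffMeasure 2).restrict (graphMap (rescale ε f₁) '' ω) +
      (Measure.euclideanHausdorffMeasure 2).restrict (graphMap (rescale ε f₂) '' ω) +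
      (Measure.euclideanHausdorffMeasure 2).restrict (lateral ω f₁ f₂ ε) := by
  have hr : ∀ x, rescale ε f₁ x < rescale ε f₂ x := fun x => mul_lt_mul_of_pos_left (hlt _) hε
  have c2 := continuous_rescale (ε := ε) h₂
  rw [surfaceMeasure, frontier_film hω h₁ h₂ hε hlt, Measure.restrict_union _ measurableSet_lateral,
    Measure.restrict_union]
  · rw [disjoint_left]
    rintro _ ⟨y, hy, rfl⟩ ⟨z, hz, hzy⟩
    have e1 := congrArg proj hzy
    have e2 := congrArg (fun v : Space => v 2) hzy
    simp only [graphMap, proj_join, join_two] at e1 e2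
    subst e1
    exact (hr z).ne' e2
  · exact (measurableEmbedding_graphMap c2).measurableSet_image.mpr hω.measurableSet
  · rw [disjoint_left]
    rintro _ (⟨y, hy, rfl⟩ | ⟨y, hy, rfl⟩) hl
    · have := hl.2.2
      rw [hω.interior_eq, graphMap, proj_join] at this
      exact this hy
    · have := hl.2.2
      rw [hω.interior_eq, graphMap, proj_join] at this
      exact this hy

theorem outerNormal_film_top (hω : IsOpen ω) (h₁ : Continuous f₁) (hε : 0 < ε)
    (hlt : ∀ x, f₁ x < f₂ x) {x : Plane} (hx : x ∈ ω)
    (hd : DifferentiableAt ℝ (rescale ε f₂) x) :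
    outerNormal (film ω f₁ f₂ ε) (graphMap (rescale ε f₂) x) =
      (1 / areaElement (rescale ε f₂) x) • graphNormal (rescale ε f₂) x := by
  have hr : ∀ x, rescale ε f₁ x < rescale ε f₂ x := fun x => mul_lt_mul_of_pos_left (hlt _) hε
  have c1 := continuous_rescale (ε := ε) h₁
  refine outerNormal_eq (isOuterNormalAt_graphMap hd (by simp) ?_)
  have e1 : ∀ᶠ y in 𝓝 (graphMap (rescale ε f₂) x), proj y ∈ ω :=
    continuous_proj.continuousAt.eventually_mem (hω.mem_nhds (by simpa [graphMap] using hx))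
  have e2 : ∀ᶠ y in 𝓝 (graphMap (rescale ε f₂) x), rescale ε f₁ (proj y) < y 2 :=
    ContinuousAt.eventually_lt (by fun_prop) (by fun_prop) (by simpa [graphMap] using hr x)
  filter_upwards [e1, e2] with y hy1 hy2
  rw [mem_film]
  constructor
  · rintro ⟨-, -, h⟩; linarith
  · intro h; exact ⟨hy1, hy2, by linarith⟩

theorem outerNormal_film_bottom (hω : IsOpen ω) (h₂ : Continuous f₂)
    (hε : 0 < ε) (hlt : ∀ x, f₁ x < f₂ x) {x : Plane} (hx : x ∈ ω)
    (hd : DifferentiableAt ℝ (rescale ε f₁) x) :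
    outerNormal (film ω f₁ f₂ ε) (graphMap (rescale ε f₁) x) =
      (-1 / areaElement (rescale ε f₁) x) • graphNormal (rescale ε f₁) x := by
  have hr : ∀ x, rescale ε f₁ x < rescale ε f₂ x := fun x => mul_lt_mul_of_pos_left (hlt _) hε
  have c2 := continuous_rescale (ε := ε) h₂
  refine outerNormal_eq (isOuterNormalAt_graphMap hd (by simp) ?_)
  have e1 : ∀ᶠ y in 𝓝 (graphMap (rescale ε f₁) x), proj y ∈ ω :=
    continuous_proj.continuousAt.eventually_mem (hω.mem_nhds (by simpa [graphMap] using hx))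
  have e2 : ∀ᶠ y in 𝓝 (graphMap (rescale ε f₁) x), y 2 < rescale ε f₂ (proj y) :=
    ContinuousAt.eventually_lt (by fun_prop) (by fun_prop) (by simpa [graphMap] using hr x)
  filter_upwards [e1, e2] with y hy1 hy2
  rw [mem_film]
  constructor
  · rintro ⟨-, h, -⟩; linarith
  · intro h; exact ⟨hy1, by linarith, hy2⟩

/-- The density of the graph measure is at least `1`, so null sets on the graph and in the plane
correspond. -/
theorem ae_graph_iff {f : Plane → ℝ} {K : ℝ≥0} (hf : LipschitzWith K f) {s : Set Plane}
    (hs : MeasurableSet s) {p : Space → Prop} :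
    (∀ᵐ y ∂(Measure.euclideanHausdorffMeasure 2).restrict (graphMap f '' s), p y) ↔
      ∀ᵐ x ∂(volume.restrict s), p (graphMap f x) := by
  rw [restrict_hausdorff_graph hf hs, (measurableEmbedding_graphMap hf.continuous).ae_map_iff,
    ae_withDensity_iff (by fun_prop)]
  refine eventually_congr (Eventually.of_forall fun x => ?_)
  have := one_le_areaElement f x
  have h0 : ENNReal.ofReal (areaElement f x) ≠ 0 := by
    rw [Ne, ENNReal.ofReal_eq_zero]; linarith
  simp [h0]

theorem aestronglyMeasurable_graph {f : Plane → ℝ} {K : ℝ≥0} (hf : LipschitzWith K f) {s : Set Plane}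
    (hs : MeasurableSet s) {F : Space → ℝ}
    (hF : AEStronglyMeasurable (fun x => F (graphMap f x)) (volume.restrict s)) :
    AEStronglyMeasurable F ((Measure.euclideanHausdorffMeasure 2).restrict (graphMap f '' s)) := by
  rw [restrict_hausdorff_graph hf hs,
    (measurableEmbedding_graphMap hf.continuous).aestronglyMeasurable_map_iff]
  exact hF.mono_ac (withDensity_absolutelyContinuous _ _)

/-- A bounded Borel version of the surface charge. -/
theorem exists_measurable_charge (hω : IsOpen ω) {K₁ K₂ : ℝ≥0} (h₁ : LipschitzWith K₁ f₁)
    (h₂ : LipschitzWith K₂ f₂) (hε : 0 < ε) (hlt : ∀ x, f₁ x < f₂ x) {M : Plane → Space}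
    (hm : AEStronglyMeasurable M (volume.restrict ω))
    (hM : ∀ᵐ x ∂(volume.restrict ω), ‖M x‖ ≤ 1) :
    ∃ q : Space → ℝ, Measurable q ∧ (∀ x, |q x| ≤ 1) ∧
      surfaceCharge ω f₁ f₂ ε M =ᵐ[surfaceMeasure ω f₁ f₂ ε] q ∧
      (∀ᵐ x ∂(volume.restrict ω), areaElement (rescale ε f₁) x * q (graphMap (rescale ε f₁) x) =
        -inner ℝ (M x) (graphNormal f₁ (ε⁻¹ • x))) ∧
      ∀ᵐ x ∂(volume.restrict ω), areaElement (rescale ε f₂) x * q (graphMap (rescale ε f₂) x) =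
        inner ℝ (M x) (graphNormal f₂ (ε⁻¹ • x)) := by
  have r1 := lipschitz_rescale hε h₁
  have r2 := lipschitz_rescale hε h₂
  have hval : ∀ x ∈ ω, valueOnClosure ω M x = M x := fun x hx => by
    rw [valueOnClosure, if_pos hx]
  have hq : ∀ f : Plane → ℝ, ∀ x ∈ ω, surfaceCharge ω f₁ f₂ ε M (graphMap f x) =
      inner ℝ (M x) (outerNormal (film ω f₁ f₂ ε) (graphMap f x)) := fun f x hx => by
    rw [surfaceCharge, graphMap, proj_join, hval x hx]
  have hlat : ∀ x ∈ lateral ω f₁ f₂ ε, surfaceCharge ω f₁ f₂ ε M x =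
      inner ℝ ((closure ω).indicator (boundaryTrace ω M) (proj x))
        (outerNormal (film ω f₁ f₂ ε) x) := fun x hx => by
    have hx2 : proj x ∉ ω := fun h => hx.2.2 (by rwa [hω.interior_eq])
    rw [surfaceCharge, valueOnClosure, if_neg hx2, indicator_of_mem (frontier_subset_closure hx.2)]
  have hmν := measurable_outerNormal (film ω f₁ f₂ ε)
  have hmeas_graph : ∀ f : Plane → ℝ, ∀ K : ℝ≥0, LipschitzWith K f →
      AEStronglyMeasurable (surfaceCharge ω f₁ f₂ ε M)
        ((Measure.euclideanHausdorffMeasure 2).restrict (graphMap f '' ω)) := by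
    intro f K hf
    refine aestronglyMeasurable_graph hf hω.measurableSet ?_
    have : AEStronglyMeasurable (fun x => inner ℝ (M x) (outerNormal (film ω f₁ f₂ ε) (graphMap f x)))
        (volume.restrict ω) :=
      hm.inner (hmν.comp (measurableEmbedding_graphMap hf.continuous).measurable).aestronglyMeasurable
    refine this.congr ?_
    filter_upwards [ae_restrict_mem hω.measurableSet] with x hx
    rw [hq f x hx]
  have hbound_graph : ∀ f : Plane → ℝ, ∀ K : ℝ≥0, LipschitzWith K f →
      ∀ᵐ x ∂((Measure.euclideanHausdorffMeasure 2).restrict (graphMap f '' ω)),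
        |surfaceCharge ω f₁ f₂ ε M x| ≤ 1 := by
    intro f K hf
    rw [ae_graph_iff hf hω.measurableSet]
    filter_upwards [hM, ae_restrict_mem hω.measurableSet] with x hx hxω
    rw [hq f x hxω]
    exact (abs_real_inner_le_norm _ _).trans (mul_le_one₀ hx (norm_nonneg _) (norm_outerNormal_le _ _))
  have hmeas : AEStronglyMeasurable (surfaceCharge ω f₁ f₂ ε M) (surfaceMeasure ω f₁ f₂ ε) := by
    rw [surfaceMeasure_eq hω h₁.continuous h₂.continuous hε hlt]
    refine ((hmeas_graph _ _ r1).add_measure (hmeas_graph _ _ r2)).add_measure ?_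
    have : Measurable fun x => inner ℝ ((closure ω).indicator (boundaryTrace ω M) (proj x))
        (outerNormal (film ω f₁ f₂ ε) x) :=
      ((measurable_boundaryTrace hω hM hm).comp continuous_proj.measurable).inner hmν
    refine this.aestronglyMeasurable.congr ?_
    filter_upwards [ae_restrict_mem measurableSet_lateral] with x hx
    rw [hlat x hx]
  have hbound : ∀ᵐ x ∂(surfaceMeasure ω f₁ f₂ ε), |surfaceCharge ω f₁ f₂ ε M x| ≤ 1 := by
    rw [surfaceMeasure_eq hω h₁.continuous h₂.continuous hε hlt, ae_add_measure_iff,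
      ae_add_measure_iff]
    refine ⟨⟨hbound_graph _ _ r1, hbound_graph _ _ r2⟩, ?_⟩
    filter_upwards [ae_restrict_mem measurableSet_lateral] with x hx
    rw [hlat x hx, indicator_of_mem (frontier_subset_closure hx.2)]
    exact (abs_real_inner_le_norm _ _).trans (mul_le_one₀
      (norm_boundaryTrace_le hω (frontier_subset_closure hx.2) hM hm) (norm_nonneg _)
      (norm_outerNormal_le _ _))
  -- Clamping a measurable version to `[-1, 1]` turns the almost everywhere bound into one valid at
  -- every point, at no cost almost everywhere.
  set q : Space → ℝ := fun x => max (-1) (min 1 (hmeas.mk _ x)) with hqdef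
  have hqe : surfaceCharge ω f₁ f₂ ε M =ᵐ[surfaceMeasure ω f₁ f₂ ε] q := by
    filter_upwards [hmeas.ae_eq_mk, hbound] with x hx hb
    rw [abs_le] at hb
    rw [hqdef]
    simp only
    rw [← hx, min_eq_right hb.2, max_eq_right hb.1]
  have hqe' := hqe
  rw [surfaceMeasure_eq hω h₁.continuous h₂.continuous hε hlt, EventuallyEq, ae_add_measure_iff,
    ae_add_measure_iff, ae_graph_iff r1 hω.measurableSet,
    ae_graph_iff r2 hω.measurableSet] at hqe'
  refine ⟨q, ?_, fun x => ?_, hqe, ?_, ?_⟩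
  · have := hmeas.stronglyMeasurable_mk.measurable
    rw [hqdef]; fun_prop
  · rw [abs_le, hqdef]
    exact ⟨le_max_left _ _, max_le (by norm_num) (min_le_left _ _)⟩
  -- The area element cancels the normalization of `graphNormal`. The sign is negative because the
  -- outer normal points downwards on the bottom face.
  · filter_upwards [hqe'.1.1, ae_restrict_mem hω.measurableSet,
      ae_restrict_of_ae r1.ae_differentiableAt] with x hx hxω hd
    rw [← hx, hq _ x hxω, outerNormal_film_bottom hω h₂.continuous hε hlt hxω hd,
      inner_smul_right, ← graphNormal_rescale hε.ne']
    have := one_le_areaElement (rescale ε f₁) x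
    field_simp
  · filter_upwards [hqe'.1.2, ae_restrict_mem hω.measurableSet,
      ae_restrict_of_ae r2.ae_differentiableAt] with x hx hxω hd
    rw [← hx, hq _ x hxω, outerNormal_film_top hω h₁.continuous hε hlt hxω hd,
      inner_smul_right, ← graphNormal_rescale hε.ne']
    have := one_le_areaElement (rescale ε f₂) x
    field_simp

end Film

/-! ### Weak derivatives against Lipschitz test functions -/

/-- The partial derivative of a scalar function. -/
def pderiv (i : Fin 2) (φ : Plane → ℝ) (x : Plane) : ℝ := fderiv ℝ φ x (EuclideanSpace.single i 1)

theorem measurable_pderiv (i : Fin 2) (φ : Plane → ℝ) : Measurable (pderiv i φ) :=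
  measurable_fderiv_apply_const ℝ φ _

theorem abs_pderiv_le {φ : Plane → ℝ} {K : ℝ≥0} (hφ : LipschitzWith K φ) (i : Fin 2) (x : Plane) :
    |pderiv i φ x| ≤ K := by
  have h1 := (fderiv ℝ φ x).le_opNorm (EuclideanSpace.single i 1)
  have h2 := norm_fderiv_le_of_lipschitz ℝ hφ (x₀ := x)
  rw [PiLp.norm_single, norm_one, mul_one] at h1
  exact h1.trans h2

/-! ### Mollification of Lipschitz functions -/

section Mollify

open Convolution

/-- A normalized bump of radius `1/(n+1)`. -/
def bump (n : ℕ) : ContDiffBump (0 : Plane) where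
  rIn := 1 / (2 * ((n : ℝ) + 1))
  rOut := 1 / ((n : ℝ) + 1)
  rIn_pos := by positivity
  rIn_lt_rOut := by
    apply one_div_lt_one_div_of_lt <;> linarith [show (0 : ℝ) ≤ n from Nat.cast_nonneg n]

/-- The mollification of `φ` at scale `1/(n+1)`. -/
def mollify (n : ℕ) (φ : Plane → ℝ) : Plane → ℝ :=
  (bump n).normed volume ⋆[ContinuousLinearMap.lsmul ℝ ℝ, volume] φ

theorem mollify_apply (n : ℕ) (φ : Plane → ℝ) (x : Plane) :
    mollify n φ x = ∫ t, (bump n).normed volume t * φ (x - t) := rfl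

theorem tendsto_bump_rOut : Tendsto (fun n => (bump n).rOut) atTop (𝓝 0) :=
  tendsto_one_div_add_atTop_nhds_zero_nat

theorem abs_mollify_le (n : ℕ) {φ : Plane → ℝ} {C : ℝ} (hφ : ∀ x, |φ x| ≤ C) (x : Plane) :
    |mollify n φ x| ≤ C := by
  rw [mollify_apply, ← Real.norm_eq_abs]
  refine (norm_integral_le_of_norm_le ((bump n).integrable_normed.mul_const C)
    (Eventually.of_forall fun t => ?_)).trans_eq ?_
  · rw [norm_mul, Real.norm_eq_abs, abs_of_nonneg ((bump n).nonneg_normed t)]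
    exact mul_le_mul_of_nonneg_left (hφ _) ((bump n).nonneg_normed t)
  · rw [integral_mul_const, (bump n).integral_normed, one_mul]

/-- The derivative falls on `φ` rather than on the bump, so the Lipschitz bound survives
mollification. Differentiability of `φ` almost everywhere suffices, the difference quotients being
dominated. -/
theorem pderiv_mollify (n : ℕ) {φ : Plane → ℝ} {K : ℝ≥0} (hφ : LipschitzWith K φ) {C : ℝ}
    (hb : ∀ x, |φ x| ≤ C) (i : Fin 2) (x : Plane) :
    pderiv i (mollify n φ) x = mollify n (pderiv i φ) x := by
  set ρ := (bump n).normed (volume : Measure Plane)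
  have hρc : Continuous ρ := (bump n).continuous_normed
  have hρi : Integrable ρ := (bump n).integrable_normed
  have hmp : MeasurePreserving (fun t : Plane => x - t) volume volume :=
    Measure.measurePreserving_sub_left volume x
  have hdm : Measurable fun t : Plane => fderiv ℝ φ (x - t) :=
    (measurable_fderiv ℝ φ).comp (by fun_prop)
  have key := hasFDerivAt_integral_of_dominated_loc_of_lip (𝕜 := ℝ) (μ := volume)
    (F := fun (x : Plane) (t : Plane) => ρ t * φ (x - t)) (x₀ := x) (s := univ)
    (F' := fun t => ρ t • fderiv ℝ φ (x - t)) (bound := fun t => ρ t * K) univ_mem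
    (Eventually.of_forall fun y => by
      have := hφ.continuous
      exact (by fun_prop : Continuous fun t => ρ t * φ (y - t)).aestronglyMeasurable)
    (by
      refine (hρi.mul_const C).mono ?_ (Eventually.of_forall fun t => ?_)
      · have := hφ.continuous
        exact (by fun_prop : Continuous fun t => ρ t * φ (x - t)).aestronglyMeasurable
      · rw [norm_mul, norm_mul]
        gcongr
        exact (hb _).trans (le_abs_self C))
    (hρc.measurable.smul hdm).aestronglyMeasurable
    (Eventually.of_forall fun t => by
      have hρt : 0 ≤ ρ t := (bump n).nonneg_normed t
      refine LipschitzOnWith.of_dist_le_mul fun y _ z _ => ?_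
      have := hφ.dist_le_mul (y - t) (z - t)
      rw [dist_sub_right] at this
      rw [Real.dist_eq] at this ⊢
      rw [← mul_sub, abs_mul, Real.coe_nnabs, abs_mul, NNReal.abs_eq, mul_assoc]
      gcongr)
    (hρi.mul_const _)
    (by
      have := hmp.quasiMeasurePreserving.ae hφ.ae_differentiableAt
      filter_upwards [this] with t ht
      have h1 : HasFDerivAt (fun y => φ (y - t)) (fderiv ℝ φ (x - t)) x := by
        have := ht.hasFDerivAt.comp x ((hasFDerivAt_id x).sub_const t)
        rw [ContinuousLinearMap.comp_id] at this
        exact this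
      exact h1.const_mul (ρ t))
  have h2 : fderiv ℝ (mollify n φ) x = ∫ t, ρ t • fderiv ℝ φ (x - t) := key.2.fderiv
  rw [pderiv, h2, ContinuousLinearMap.integral_apply key.1, mollify_apply]
  rfl

theorem contDiff_mollify (n : ℕ) {φ : Plane → ℝ} (hφ : Continuous φ) :
    ContDiff ℝ ((⊤ : ℕ∞) : WithTop ℕ∞) (mollify n φ) :=
  (bump n).hasCompactSupport_normed.contDiff_convolution_left _ (bump n).contDiff_normed
    hφ.locallyIntegrable

theorem tsupport_mollify_subset (n : ℕ) (φ : Plane → ℝ) :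
    tsupport (mollify n φ) ⊆ Metric.cthickening (bump n).rOut (tsupport φ) := by
  refine closure_minimal ?_ Metric.isClosed_cthickening
  refine (support_convolution_subset _).trans ?_
  rintro _ ⟨a, ha, b, hb, rfl⟩
  rw [(bump n).support_normed_eq, mem_ball_zero_iff] at ha
  refine Metric.mem_cthickening_of_dist_le _ b _ _ (subset_tsupport _ hb) ?_
  simpa [dist_eq_norm] using ha.le

/-- The mollified functions are smooth and eventually supported in `ω`. Their partial derivatives
are bounded by `K` and converge almost everywhere, so dominated convergence applies on both sides.
-/
theorem HasWeakPartial.of_lipschitz {ω : Set Plane} (hω : IsOpen ω) {u v : Plane → Space}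
    {i : Fin 2} (h : HasWeakPartial ω u i v) (hu : IntegrableOn u ω) (hv : IntegrableOn v ω)
    {φ : Plane → ℝ} {K : ℝ≥0} (hφ : LipschitzWith K φ) (hc : HasCompactSupport φ)
    (hs : tsupport φ ⊆ ω) :
    ∫ x in ω, pderiv i φ x • u x = -∫ x in ω, φ x • v x := by
  obtain ⟨C, hC⟩ := hφ.continuous.bounded_above_of_compact_support hc
  obtain ⟨δ, hδ, hδω⟩ := hc.isCompact.exists_cthickening_subset_open hω hs
  have hli : LocallyIntegrable (pderiv i φ) :=
    (memLp_top_of_bound (measurable_pderiv i φ).aestronglyMeasurable (K : ℝ)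
      (Eventually.of_forall fun x => abs_pderiv_le hφ i x)).locallyIntegrable le_top
  have h1 : Tendsto (fun n => ∫ x in ω, pderiv i (mollify n φ) x • u x) atTop
      (𝓝 (∫ x in ω, pderiv i φ x • u x)) := by
    refine tendsto_integral_of_dominated_convergence (fun x => K * ‖u x‖) (fun n => ?_)
      (hu.norm.const_mul _) (fun n => Eventually.of_forall fun x => ?_) ?_
    · exact (measurable_pderiv i _).aestronglyMeasurable.smul hu.aestronglyMeasurable
    · rw [norm_smul]
      gcongr
      rw [pderiv_mollify n hφ hC]
      exact abs_mollify_le n (abs_pderiv_le hφ i) x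
    · refine ae_restrict_of_ae ?_
      filter_upwards [ContDiffBump.ae_convolution_tendsto_right_of_locallyIntegrable (K := 2)
        tendsto_bump_rOut (Eventually.of_forall fun n => by
          simp only [bump]; field_simp; exact le_rfl) hli] with x hx
      refine Tendsto.smul_const ?_ _
      refine hx.congr fun n => ?_
      rw [pderiv_mollify n hφ hC]
      rfl
  have h2 : Tendsto (fun n => -∫ x in ω, mollify n φ x • v x) atTop
      (𝓝 (-∫ x in ω, φ x • v x)) := by
    refine (tendsto_integral_of_dominated_convergence (fun x => C * ‖v x‖) (fun n => ?_)
      (hv.norm.const_mul _) (fun n => Eventually.of_forall fun x => ?_)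
      (Eventually.of_forall fun x => ?_)).neg
    · exact (contDiff_mollify n hφ.continuous).continuous.aestronglyMeasurable.smul
        hv.aestronglyMeasurable
    · rw [norm_smul]
      gcongr
      exact abs_mollify_le n hC x
    · refine Tendsto.smul_const ?_ _
      exact ContDiffBump.convolution_tendsto_right_of_continuous tendsto_bump_rOut hφ.continuous x
  refine tendsto_nhds_unique h1 (h2.congr' ?_)
  filter_upwards [(tendsto_order.mp tendsto_bump_rOut).2 δ hδ] with n hn
  have hsub : tsupport (mollify n φ) ⊆ Metric.cthickening δ (tsupport φ) :=
    (tsupport_mollify_subset n φ).trans (Metric.cthickening_mono hn.le _)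
  refine (h (mollify n φ) (contDiff_mollify n hφ.continuous) ?_ (hsub.trans hδω)).symm
  exact hc.isCompact.cthickening.of_isClosed_subset (isClosed_tsupport _) hsub

end Mollify

theorem lipschitz_mul_of_bounded {φ ψ : Plane → ℝ} {K L : ℝ≥0} {A B : ℝ≥0} (hφ : LipschitzWith K φ)
    (hψ : LipschitzWith L ψ) (hA : ∀ x, |φ x| ≤ A) (hB : ∀ x, |ψ x| ≤ B) :
    LipschitzWith (A * L + B * K) fun x => φ x * ψ x := by
  refine LipschitzWith.of_dist_le_mul fun x y => ?_
  have h1 := hφ.dist_le_mul x y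
  have h2 := hψ.dist_le_mul x y
  rw [Real.dist_eq] at h1 h2 ⊢
  have : φ x * ψ x - φ y * ψ y = φ x * (ψ x - ψ y) + ψ y * (φ x - φ y) := by ring
  rw [this]
  push_cast
  calc _ ≤ |φ x * (ψ x - ψ y)| + |ψ y * (φ x - φ y)| := abs_add_le _ _
    _ = |φ x| * |ψ x - ψ y| + |ψ y| * |φ x - φ y| := by rw [abs_mul, abs_mul]
    _ ≤ A * (L * dist x y) + B * (K * dist x y) := by gcongr <;> [exact hA x; exact hB y]
    _ = _ := by ring

/-- Integration by parts against a product of a Lipschitz cutoff and a smooth function. -/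
theorem HasWeakPartial.integral_pderiv_mul {ω : Set Plane} (hω : IsOpen ω) {u v : Plane → Space}
    {i : Fin 2} (h : HasWeakPartial ω u i v) (hu : IntegrableOn u ω) (hv : IntegrableOn v ω)
    {w ψ : Plane → ℝ} {K L : ℝ≥0} {A B : ℝ≥0} (hw : LipschitzWith K w) (hψ : LipschitzWith L ψ)
    (hA : ∀ x, |w x| ≤ A) (hB : ∀ x, |ψ x| ≤ B) (hc : HasCompactSupport w) (hs : tsupport w ⊆ ω)
    (hd : Differentiable ℝ ψ) (j : Fin 3) :
    ∫ x in ω, pderiv i w x * ψ x * u x j =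
      -(∫ x in ω, w x * pderiv i ψ x * u x j) - ∫ x in ω, w x * ψ x * v x j := by
  have hL := lipschitz_mul_of_bounded hw hψ hA hB
  have hss : tsupport (fun x => w x * ψ x) ⊆ tsupport w :=
    closure_mono fun x hx => left_ne_zero_of_mul hx
  have key := h.of_lipschitz hω hu hv hL (hc.mul_right) (hss.trans hs)
  have huj : IntegrableOn (fun x => u x j) ω := (EuclideanSpace.proj (𝕜 := ℝ) j).integrable_comp hu
  have hvj : IntegrableOn (fun x => v x j) ω := (EuclideanSpace.proj (𝕜 := ℝ) j).integrable_comp hv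
  have i1 : Integrable (fun x => pderiv i (fun x => w x * ψ x) x • u x) (volume.restrict ω) :=
    hu.bdd_smul ((A * L + B * K : ℝ≥0) : ℝ) (measurable_pderiv i _).aestronglyMeasurable
      (Eventually.of_forall fun x => abs_pderiv_le hL i x)
  have i2 : Integrable (fun x => (w x * ψ x) • v x) (volume.restrict ω) :=
    hv.bdd_smul ((A : ℝ) * B) (hw.continuous.mul hψ.continuous).aestronglyMeasurable
      (Eventually.of_forall fun x => by
        rw [Pi.mul_apply, norm_mul]; exact mul_le_mul (hA x) (hB x) (norm_nonneg _) A.2)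
  have key2 := congrArg (EuclideanSpace.proj (𝕜 := ℝ) j) key
  rw [map_neg, ← ContinuousLinearMap.integral_comp_comm _ i1,
    ← ContinuousLinearMap.integral_comp_comm _ i2] at key2
  replace key2 : ∫ x in ω, pderiv i (fun x => w x * ψ x) x * u x j =
      -∫ x in ω, w x * ψ x * v x j := key2
  have hsplit : ∫ x in ω, pderiv i (fun x => w x * ψ x) x * u x j =
      (∫ x in ω, pderiv i w x * ψ x * u x j) + ∫ x in ω, w x * pderiv i ψ x * u x j := by
    rw [← integral_add]
    · refine integral_congr_ae (ae_restrict_of_ae ?_)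
      filter_upwards [hw.ae_differentiableAt] with x hx
      have : pderiv i (fun x => w x * ψ x) x = w x * pderiv i ψ x + ψ x * pderiv i w x := by
        simp only [pderiv]
        rw [fderiv_fun_mul hx (hd x)]
        simp
      rw [this]; ring
    · refine huj.bdd_mul (c := (K : ℝ) * B) ?_ (Eventually.of_forall fun x => ?_)
      · exact ((measurable_pderiv i w).mul hψ.continuous.measurable).aestronglyMeasurable
      · rw [norm_mul]; exact mul_le_mul (abs_pderiv_le hw i x) (hB x) (norm_nonneg _) K.2
    · refine huj.bdd_mul (c := (A : ℝ) * L) ?_ (Eventually.of_forall fun x => ?_)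
      · exact (hw.continuous.measurable.mul (measurable_pderiv i ψ)).aestronglyMeasurable
      · rw [norm_mul]; exact mul_le_mul (hA x) (abs_pderiv_le hψ i x) (norm_nonneg _) A.2
  linarith

/-! ### Periodic homogenization of double integrals -/

theorem unitCell_eq_preimage :
    unitCell = WithLp.ofLp ⁻¹' (Set.pi univ fun _ : Fin 2 => Ioo (0 : ℝ) 1) := by
  ext x; simp [unitCell, Set.mem_pi]

theorem volume_unitCell : volume unitCell = 1 := by
  rw [unitCell_eq_preimage, (PiLp.volume_preserving_ofLp (Fin 2)).measure_preimage
    (MeasurableSet.univ_pi fun i => measurableSet_Ioo).nullMeasurableSet, volume_pi,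
    Measure.pi_pi]
  simp

theorem unitCell_ae_eq_fundamentalDomain :
    unitCell =ᵐ[volume] ZSpan.fundamentalDomain (EuclideanSpace.basisFun (Fin 2) ℝ).toBasis := by
  have h1 : ZSpan.fundamentalDomain (EuclideanSpace.basisFun (Fin 2) ℝ).toBasis =
      WithLp.ofLp ⁻¹' (Set.pi univ fun _ : Fin 2 => Ico (0 : ℝ) 1) := by
    ext x; simp [Set.mem_pi]
  rw [h1, unitCell_eq_preimage]
  refine (PiLp.volume_preserving_ofLp (Fin 2)).quasiMeasurePreserving.preimage_ae_eq ?_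
  have ha := Measure.pi_Ioo_ae_eq_pi_Icc (μ := fun _ : Fin 2 => (volume : Measure ℝ))
    (s := univ) (f := fun _ => 0) (g := fun _ => 1)
  have hb := Measure.pi_Ico_ae_eq_pi_Icc (μ := fun _ : Fin 2 => (volume : Measure ℝ))
    (s := univ) (f := fun _ => 0) (g := fun _ => 1)
  exact ha.trans hb.symm

/-- Up to a null set the cell is a fundamental domain of the integer lattice, and so is every
translate of it. -/
theorem setIntegral_unitCell_add {H : Plane → ℝ} (hH : IsCellPeriodic H) (s : Plane) :
    ∫ t in unitCell, H (s + t) = ∫ t in unitCell, H t := by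
  set b := (EuclideanSpace.basisFun (Fin 2) ℝ).toBasis with hb
  have hD := ZSpan.isAddFundamentalDomain' b (volume : Measure Plane)
  have hinv : ∀ (g : (Submodule.span ℤ (Set.range b)).toAddSubgroup) (x : Plane),
      H (g +ᵥ x) = H x := by
    rintro ⟨g, hg⟩ x
    change H (g + x) = H x
    have hg' : g ∈ Submodule.span ℤ (Set.range b) := hg
    clear hg
    induction hg' using Submodule.span_induction generalizing x with
    | mem y hy =>
      obtain ⟨i, rfl⟩ := hy
      rw [add_comm, hb, OrthonormalBasis.coe_toBasis, EuclideanSpace.basisFun_apply]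
      exact hH x i
    | zero => rw [zero_add]
    | add y z _ _ hy hz => rw [add_assoc, hy, hz]
    | smul n y _ hy =>
      induction n using Int.induction_on generalizing x with
      | zero => simp
      | succ n ih => rw [add_smul, one_smul, add_assoc, ih, hy]
      | pred n ih =>
        rw [sub_smul, one_smul, ← hy ((-(n : ℤ)) • y - y + x), ← ih x]
        congr 1; abel
  have hs := hD.vadd_of_comm s
  have hcount : Countable (Submodule.span ℤ (Set.range b)).toAddSubgroup :=
    inferInstanceAs (Countable (Submodule.span ℤ (Set.range b)))
  have hcong : ∀ F : Plane → ℝ, ∫ t in unitCell, F t = ∫ t in ZSpan.fundamentalDomain b, F t :=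
    fun F => setIntegral_congr_set unitCell_ae_eq_fundamentalDomain
  rw [hcong, hcong, hD.setIntegral_eq hs hinv]
  have hmp : MeasurePreserving (fun t : Plane => s + t) volume volume :=
    measurePreserving_add_left volume s
  open Pointwise in
  have himg : s +ᵥ ZSpan.fundamentalDomain b = (fun t => s + t) '' ZSpan.fundamentalDomain b := rfl
  rw [himg, hmp.setIntegral_image_emb (measurableEmbedding_addLeft s)]

theorem integral_translate_sub_le {F : Plane → ℝ} (hF : Integrable F) (h : Plane) :
    ∫ x, |F (x + h) - F x| ≤ 2 * ∫ x, |F x| := by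
  have h1 : Integrable fun x => F (x + h) := hF.comp_add_right h
  calc _ ≤ ∫ x, (|F (x + h)| + |F x|) :=
        integral_mono (h1.sub hF).abs (h1.abs.add hF.abs) fun x => abs_sub _ _
    _ = _ := by
        rw [integral_add h1.abs hF.abs, integral_add_right_eq_self (fun x => |F x|)]; ring

/-- This is the strong continuity of translations on `L¹`. -/
theorem tendsto_integral_translate {F : Plane → ℝ} (hF : Integrable F) :
    Tendsto (fun h : Plane => ∫ x, |F (x + h) - F x|) (𝓝 0) (𝓝 0) := by
  set f : Lp ℝ 1 (volume : Measure Plane) := hF.toL1 F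
  set g : C(Plane, C(Plane, Plane)) :=
    (ContinuousMap.mk (fun a : Plane × Plane => a.2 + a.1) (by fun_prop)).curry with hg
  have hgm : ∀ h, MeasurePreserving (g h) volume volume := fun h =>
    measurePreserving_add_right volume h
  have hcont : Continuous fun h => Lp.compMeasurePreserving (g h) (hgm h) f :=
    continuous_const.compMeasurePreservingLp g.continuous hgm ENNReal.one_ne_top
  have hn : Continuous fun h => ‖Lp.compMeasurePreserving (g h) (hgm h) f - f‖ := by fun_prop
  have heq : ∀ h, ‖Lp.compMeasurePreserving (g h) (hgm h) f - f‖ = ∫ x, |F (x + h) - F x| := by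
    intro h
    rw [L1.norm_eq_integral_norm]
    refine integral_congr_ae ?_
    have e1 := Lp.coeFn_sub (Lp.compMeasurePreserving (g h) (hgm h) f) f
    have e2 := Lp.coeFn_compMeasurePreserving f (hgm h)
    have e3 : f =ᵐ[volume] F := hF.coeFn_toL1
    have e4 := (hgm h).quasiMeasurePreserving.ae e3
    filter_upwards [e1, e2, e3, e4] with x h1 h2 h3 h4
    rw [h1, Pi.sub_apply, h2, Function.comp_apply, h4, h3]
    rfl
  have := hn.tendsto 0
  simp only [heq] at this
  simpa using this

/-- Substituting `x + εt` for `x` changes nothing, so the integral may be averaged over `t` in the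
cell. Replacing `F (x + εt)` by `F x` costs an error that vanishes by continuity of translations.
What is left is the average of `H (x/ε + t)` over `t`, which is the mean of `H` by periodicity. -/
theorem tendsto_integral_periodic {H F : Plane → ℝ} (hH : IsCellPeriodic H) (hHm : Measurable H)
    {C : ℝ} (hHb : ∀ x, |H x| ≤ C) (hF : Integrable F) :
    Tendsto (fun ε : ℝ => ∫ x, H (ε⁻¹ • x) * F x) (𝓝[>] 0)
      (𝓝 ((∫ t in unitCell, H t) * ∫ x, F x)) := by
  have hfin : IsFiniteMeasure (volume.restrict unitCell) := ⟨by simp [volume_unitCell]⟩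
  have hC : 0 ≤ C := (abs_nonneg _).trans (hHb 0)
  have hHi : ∀ (G : Plane → ℝ), Integrable G → ∀ ε : ℝ, ∀ t,
      Integrable fun x => H (ε⁻¹ • x + t) * G x := fun G hG ε t =>
    hG.bdd_mul (c := C) (hHm.comp (by fun_prop)).aestronglyMeasurable
      (Eventually.of_forall fun x => hHb _)
  have htr : ∀ ε : ℝ, 0 < ε → ∀ t, ∫ x, H (ε⁻¹ • x + t) * F (x + ε • t) =
      ∫ x, H (ε⁻¹ • x) * F x := fun ε hε t => by
    rw [← integral_add_right_eq_self (fun x => H (ε⁻¹ • x) * F x) (ε • t)]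
    refine integral_congr_ae (Eventually.of_forall fun x => ?_)
    simp only [smul_add, inv_smul_smul₀ hε.ne']
  have hmean : ∀ ε : ℝ, ∫ t in unitCell, ∫ x, H (ε⁻¹ • x + t) * F x =
      (∫ t in unitCell, H t) * ∫ x, F x := fun ε => by
    rw [integral_integral_swap]
    · rw [← integral_const_mul]
      refine integral_congr_ae (Eventually.of_forall fun x => ?_)
      simp only
      rw [integral_mul_const, setIntegral_unitCell_add hH]
    · have : Integrable (fun p : Plane × Plane => (1 : ℝ) * F p.2)
          ((volume.restrict unitCell).prod volume) :=
        (integrable_const (1 : ℝ)).mul_prod hF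
      simp only [one_mul] at this
      refine this.bdd_mul (c := C) ?_ (Eventually.of_forall fun p => hHb _)
      exact (hHm.comp (by fun_prop)).aestronglyMeasurable
  have hdiff : Tendsto (fun ε : ℝ => ∫ t in unitCell, ∫ x, H (ε⁻¹ • x + t) * (F (x + ε • t) - F x))
      (𝓝[>] 0) (𝓝 (∫ t in unitCell, (0 : ℝ))) := by
    have hle : ∀ ε : ℝ, ∀ t, ‖∫ x, H (ε⁻¹ • x + t) * (F (x + ε • t) - F x)‖ ≤
        C * ∫ x, |F (x + ε • t) - F x| := fun ε t => by
      rw [← integral_const_mul]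
      refine norm_integral_le_of_norm_le (((hF.comp_add_right (ε • t)).sub hF).abs.const_mul C)
        (Eventually.of_forall fun x => ?_)
      rw [norm_mul]
      exact mul_le_mul_of_nonneg_right (hHb _) (norm_nonneg _)
    refine tendsto_integral_filter_of_dominated_convergence (fun _ => C * (2 * ∫ x, |F x|)) ?_ ?_
      (integrable_const _) ?_
    · obtain ⟨F', hF'm, hF'e⟩ := hF.aestronglyMeasurable
      refine Eventually.of_forall fun ε => ?_
      have hm : StronglyMeasurable fun t => ∫ x, H (ε⁻¹ • x + t) * (F' (x + ε • t) - F' x) := by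
        refine StronglyMeasurable.integral_prod_right
          (f := fun t x => H (ε⁻¹ • x + t) * (F' (x + ε • t) - F' x)) ?_
        have := hF'm.measurable
        exact (by fun_prop : Measurable fun p : Plane × Plane =>
          H (ε⁻¹ • p.2 + p.1) * (F' (p.2 + ε • p.1) - F' p.2)).stronglyMeasurable
      refine hm.aestronglyMeasurable.congr (Eventually.of_forall fun t => ?_)
      refine integral_congr_ae ?_
      have e2 := (measurePreserving_add_right volume (ε • t)).quasiMeasurePreserving.ae hF'e
      filter_upwards [hF'e, e2] with x h1 h2
      rw [h1, h2]
    · refine Eventually.of_forall fun ε => Eventually.of_forall fun t => (hle ε t).trans ?_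
      exact mul_le_mul_of_nonneg_left (integral_translate_sub_le hF _) hC
    · refine Eventually.of_forall fun t => ?_
      have h1 : Tendsto (fun ε : ℝ => ε • t) (𝓝[>] 0) (𝓝 0) := by
        have : Continuous fun ε : ℝ => ε • t := by fun_prop
        exact (this.tendsto' 0 0 (by simp)).mono_left nhdsWithin_le_nhds
      have h2 := ((tendsto_integral_translate hF).comp h1).const_mul C
      rw [mul_zero] at h2
      exact squeeze_zero_norm (hle · t) h2
  rw [integral_zero] at hdiff
  rw [← zero_add ((∫ t in unitCell, H t) * ∫ x, F x)]
  refine (hdiff.add_const _).congr' ?_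
  filter_upwards [self_mem_nhdsWithin] with ε hε
  have hε' : 0 < ε := hε
  have hsplit : ∀ t, ∫ x, H (ε⁻¹ • x + t) * (F (x + ε • t) - F x) =
      (∫ x, H (ε⁻¹ • x) * F x) - ∫ x, H (ε⁻¹ • x + t) * F x := fun t => by
    rw [← htr ε hε' t, ← integral_sub (hHi _ (hF.comp_add_right _) ε t) (hHi F hF ε t)]
    refine integral_congr_ae (Eventually.of_forall fun x => ?_)
    simp only; ring
  simp only [hsplit]
  rw [integral_sub (integrable_const _), hmean ε, integral_const, measureReal_restrict_apply_univ,
    Measure.real, volume_unitCell]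
  · simp
  · have : Integrable (fun p : Plane × Plane => (1 : ℝ) * F p.2)
        ((volume.restrict unitCell).prod volume) :=
      (integrable_const (1 : ℝ)).mul_prod hF
    simp only [one_mul] at this
    refine (this.bdd_mul (f := fun p : Plane × Plane => H (ε⁻¹ • p.2 + p.1)) (c := C) ?_
      (Eventually.of_forall fun p => hHb _)).integral_prod_left
    exact (hHm.comp (by fun_prop)).aestronglyMeasurable

/-- Homogenization of a double integral whose kernel oscillates periodically at the scale at which
it is concentrated near the diagonal. -/
theorem tendsto_integral_homogenization {a : Plane → Plane → ℝ}
    (ham : Measurable (Function.uncurry a)) (hap : ∀ z, IsCellPeriodic fun x => a x z)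
    {Φ : Plane → ℝ} (hΦ : Integrable Φ) (haΦ : ∀ x z, |a x z| ≤ Φ z)
    {u v : ℝ → Plane → ℝ} {u₀ v₀ : Plane → ℝ}
    (hu : ∀ᶠ ε in 𝓝[>] 0, Integrable (u ε)) (hv : ∀ᶠ ε in 𝓝[>] 0, Integrable (v ε))
    (hu₀ : Integrable u₀) (hv₀ : Integrable v₀)
    (hvb : ∀ᶠ ε in 𝓝[>] 0, ∀ᵐ x, |v ε x| ≤ 1) (hu₀b : ∀ᵐ x, |u₀ x| ≤ 1)
    (hut : Tendsto (fun ε => ∫ x, |u ε x - u₀ x|) (𝓝[>] 0) (𝓝 0))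
    (hvt : Tendsto (fun ε => ∫ x, |v ε x - v₀ x|) (𝓝[>] 0) (𝓝 0)) :
    Tendsto (fun ε : ℝ => ∫ x, ∫ z, a (ε⁻¹ • x) z * (u ε x * v ε (x + ε • z))) (𝓝[>] 0)
      (𝓝 ((∫ x in unitCell, ∫ z, a x z) * ∫ x, u₀ x * v₀ x)) := by
  have hfin : IsFiniteMeasure (volume.restrict unitCell) := ⟨by simp [volume_unitCell]⟩
  have hΦ0 : ∀ z, 0 ≤ Φ z := fun z => (abs_nonneg _).trans (haΦ 0 z)
  have hF : Integrable fun x => u₀ x * v₀ x :=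
    hv₀.bdd_mul (c := 1) hu₀.aestronglyMeasurable hu₀b
  have hshift : ∀ ε : ℝ, Measure.QuasiMeasurePreserving (fun p : Plane × Plane => p.1 + ε • p.2)
      (volume.prod volume) volume := fun ε => by
    -- A shear preserves the product measure, so composing with it is harmless for null sets and for
    -- measurability.
    have h1 : MeasurePreserving (fun p : Plane × Plane => (p.1 + ε • p.2, p.2))
        (volume.prod volume) (volume.prod volume) := by
      have := MeasurePreserving.skew_product (μa := (volume : Measure Plane))
        (μb := volume) (μc := (volume : Measure Plane)) (μd := volume)
        (f := id) (g := fun z x => x + ε • z) (MeasurePreserving.id volume) (by fun_prop)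
        (Eventually.of_forall fun z => (measurePreserving_add_right volume (ε • z)).map_eq)
      have hs := (Measure.measurePreserving_swap (μ := (volume : Measure Plane))
        (ν := (volume : Measure Plane)))
      exact hs.comp (this.comp hs)
    exact Measure.quasiMeasurePreserving_fst.comp h1.quasiMeasurePreserving
  -- integrability on the product
  have hGi : ∀ᶠ ε in 𝓝[>] 0, Integrable (fun p : Plane × Plane =>
      a (ε⁻¹ • p.1) p.2 * (u ε p.1 * v ε (p.1 + ε • p.2))) (volume.prod volume) := by
    filter_upwards [hu, hv, hvb] with ε hu hv hvb
    have hb := (hshift ε).ae hvb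
    refine (hu.mul_prod hΦ).mono ?_ ?_
    · refine AEStronglyMeasurable.mul ?_ (AEStronglyMeasurable.mul ?_ ?_)
      · exact (ham.comp (g := Function.uncurry a) (f := fun p : Plane × Plane => (ε⁻¹ • p.1, p.2))
          (by fun_prop)).aestronglyMeasurable
      · exact hu.aestronglyMeasurable.comp_fst
      · exact hv.aestronglyMeasurable.comp_quasiMeasurePreserving (hshift ε)
    · filter_upwards [hb] with p hp
      rw [norm_mul, norm_mul, norm_mul, mul_comm ‖u ε p.1‖ ‖Φ p.2‖, Real.norm_of_nonneg (hΦ0 p.2)]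
      refine mul_le_mul (haΦ _ _) ?_ (by positivity) (hΦ0 _)
      exact mul_le_of_le_one_right (norm_nonneg _) hp
  have hswap : ∀ᶠ ε in 𝓝[>] 0, ∫ x, ∫ z, a (ε⁻¹ • x) z * (u ε x * v ε (x + ε • z)) =
      ∫ z, ∫ x, a (ε⁻¹ • x) z * (u ε x * v ε (x + ε • z)) := by
    filter_upwards [hGi] with ε h
    exact integral_integral_swap h
  have hlim : (∫ x in unitCell, ∫ z, a x z) * (∫ x, u₀ x * v₀ x) =
      ∫ z, (∫ x in unitCell, a x z) * ∫ x, u₀ x * v₀ x := by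
    rw [integral_mul_const, integral_integral_swap]
    have : Integrable (fun p : Plane × Plane => (1 : ℝ) * Φ p.2)
        ((volume.restrict unitCell).prod volume) := (integrable_const (1 : ℝ)).mul_prod hΦ
    refine this.mono ham.aestronglyMeasurable (Eventually.of_forall fun p => ?_)
    rw [one_mul, Real.norm_of_nonneg (hΦ0 _)]
    exact haΦ _ _
  rw [hlim]
  refine Tendsto.congr' (hswap.mono fun ε h => h.symm) ?_
  have hut1 : ∀ᶠ ε in 𝓝[>] 0, ∫ x, |u ε x - u₀ x| ≤ 1 :=
    ((tendsto_order.mp hut).2 1 one_pos).mono fun ε h => h.le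
  have hbound : ∀ᶠ ε in 𝓝[>] 0, ∀ z, ‖∫ x, a (ε⁻¹ • x) z * (u ε x * v ε (x + ε • z))‖ ≤
      Φ z * (1 + ∫ x, |u₀ x|) := by
    filter_upwards [hu, hvb, hut1] with ε hu hvb h1 z
    have hi : ∫ x, |u ε x| ≤ 1 + ∫ x, |u₀ x| := by
      calc ∫ x, |u ε x| ≤ ∫ x, (|u ε x - u₀ x| + |u₀ x|) :=
            integral_mono hu.abs ((hu.sub hu₀).abs.add hu₀.abs) fun x => by
              have := abs_add_le (u ε x - u₀ x) (u₀ x)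
              simpa using this
        _ = (∫ x, |u ε x - u₀ x|) + ∫ x, |u₀ x| := integral_add (hu.sub hu₀).abs hu₀.abs
        _ ≤ _ := by gcongr
    refine (norm_integral_le_of_norm_le (hu.abs.const_mul (Φ z)) ?_).trans ?_
    · filter_upwards [(measurePreserving_add_right volume (ε • z)).quasiMeasurePreserving.ae hvb]
        with x hx
      rw [norm_mul, norm_mul]
      exact mul_le_mul (haΦ _ _) (mul_le_of_le_one_right (norm_nonneg _) hx) (by positivity) (hΦ0 _)
    · rw [integral_const_mul]
      exact mul_le_mul_of_nonneg_left hi (hΦ0 z)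
  -- Dominated convergence in `z`. For fixed `z` the sequences may be replaced by their limits and
  -- the shift `εz` dropped, both in `L¹`, after which the periodic mean-value theorem gives the
  -- limit.
  refine tendsto_integral_filter_of_dominated_convergence
    (fun z => Φ z * (1 + ∫ x, |u₀ x|)) ?_ ?_ (hΦ.mul_const _) ?_
  · filter_upwards [hGi] with ε h
    exact h.integral_prod_right.aestronglyMeasurable
  · filter_upwards [hbound] with ε h
    exact Eventually.of_forall h
  · refine Eventually.of_forall fun z => ?_
    have hper := tendsto_integral_periodic (hap z) (ham.comp (by fun_prop : Measurable fun x => (x, z)))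
      (fun x => haΦ x z) hF
    have hz : Tendsto (fun ε : ℝ => ε • z) (𝓝[>] 0) (𝓝 0) := by
      have : Continuous fun ε : ℝ => ε • z := by fun_prop
      exact (this.tendsto' 0 0 (by simp)).mono_left nhdsWithin_le_nhds
    have htr := (tendsto_integral_translate hv₀).comp hz
    have hsum : Tendsto (fun ε => Φ z * ((∫ x, |u ε x - u₀ x|) + (∫ x, |v ε x - v₀ x|) +
        ∫ x, |v₀ (x + ε • z) - v₀ x|)) (𝓝[>] 0) (𝓝 0) := by
      have := ((hut.add hvt).add htr).const_mul (Φ z)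
      simpa using this
    have hdiff : Tendsto (fun ε => (∫ x, a (ε⁻¹ • x) z * (u ε x * v ε (x + ε • z))) -
        ∫ x, a (ε⁻¹ • x) z * (u₀ x * v₀ x)) (𝓝[>] 0) (𝓝 0) := by
      refine squeeze_zero_norm' ?_ hsum
      filter_upwards [hu, hv, hvb] with ε hu hv hvb
      have hvs := hv.comp_add_right (ε • z)
      have hv₀s := hv₀.comp_add_right (ε • z)
      have hvbs := (measurePreserving_add_right volume (ε • z)).quasiMeasurePreserving.ae hvb
      have hma : Measurable fun x => a (ε⁻¹ • x) z :=
        ham.comp (g := Function.uncurry a) (f := fun x : Plane => (ε⁻¹ • x, z)) (by fun_prop)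
      have iuv : Integrable fun x => u ε x * v ε (x + ε • z) :=
        hu.mul_bdd (c := 1) hvs.aestronglyMeasurable hvbs
      have i1 : Integrable fun x => a (ε⁻¹ • x) z * (u ε x * v ε (x + ε • z)) :=
        iuv.bdd_mul (c := Φ z) hma.aestronglyMeasurable (Eventually.of_forall fun x => haΦ _ _)
      have i2 : Integrable fun x => a (ε⁻¹ • x) z * (u₀ x * v₀ x) :=
        hF.bdd_mul (c := Φ z) hma.aestronglyMeasurable (Eventually.of_forall fun x => haΦ _ _)
      have j1 : Integrable fun x => |u ε x - u₀ x| := (hu.sub hu₀).abs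
      have j2 : Integrable fun x => |v ε (x + ε • z) - v₀ (x + ε • z)| := (hvs.sub hv₀s).abs
      have j3 : Integrable fun x => |v₀ (x + ε • z) - v₀ x| := (hv₀s.sub hv₀).abs
      have j12 : Integrable fun x => |u ε x - u₀ x| + |v ε (x + ε • z) - v₀ (x + ε • z)| :=
        j1.add j2
      have e2 : ∫ x, |v ε x - v₀ x| = ∫ x, |v ε (x + ε • z) - v₀ (x + ε • z)| :=
        (integral_add_right_eq_self (fun x => |v ε x - v₀ x|) (ε • z)).symm
      rw [← integral_sub i1 i2, e2, ← integral_add j1 j2, ← integral_add j12 j3,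
        ← integral_const_mul]
      refine norm_integral_le_of_norm_le ((j12.add j3).const_mul _) ?_
      filter_upwards [hvbs, hu₀b] with x h1 h2
      rw [← mul_sub, norm_mul]
      refine mul_le_mul (haΦ _ _) ?_ (norm_nonneg _) (hΦ0 z)
      -- In each of the three terms one factor is bounded by `1` and the other tends to zero in
      -- `L¹`.
      have : u ε x * v ε (x + ε • z) - u₀ x * v₀ x = (u ε x - u₀ x) * v ε (x + ε • z) +
          u₀ x * (v ε (x + ε • z) - v₀ (x + ε • z)) + u₀ x * (v₀ (x + ε • z) - v₀ x) := by ring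
      rw [this, Real.norm_eq_abs]
      refine (abs_add_three _ _ _).trans ?_
      rw [abs_mul, abs_mul, abs_mul]
      gcongr
      · exact mul_le_of_le_one_right (abs_nonneg _) h1
      · exact mul_le_of_le_one_left (abs_nonneg _) h2
      · exact mul_le_of_le_one_left (abs_nonneg _) h2
    have := hdiff.add hper
    simpa using this

/-! ### The regularized Coulomb kernel -/

/-- The distance `√(|z'|² + ε²)`. -/
def rad (ε : ℝ) (z : Plane) : ℝ := √(‖z‖ ^ 2 + ε ^ 2)

/-- The kernel `1 / √(|z'|² + ε²)`. -/
def ker (ε : ℝ) (z : Plane) : ℝ := 1 / rad ε z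

/-- The partial derivatives of `ker`. -/
def dker (ε : ℝ) (i : Fin 2) (z : Plane) : ℝ := -(z i / rad ε z ^ 3)

/-- The negative second partial derivatives of `ker`. -/
def ddker (ε : ℝ) (i j : Fin 2) (z : Plane) : ℝ :=
  (if i = j then 1 else 0) / rad ε z ^ 3 - 3 * (z i * z j) / rad ε z ^ 5

theorem rad_sq (ε : ℝ) (z : Plane) : rad ε z ^ 2 = ‖z‖ ^ 2 + ε ^ 2 :=
  Real.sq_sqrt (by positivity)

theorem rad_nonneg (ε : ℝ) (z : Plane) : 0 ≤ rad ε z := Real.sqrt_nonneg _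

theorem le_rad (ε : ℝ) (z : Plane) : ε ≤ rad ε z :=
  Real.le_sqrt_of_sq_le (by nlinarith [sq_nonneg ‖z‖])

theorem rad_pos {ε : ℝ} (hε : 0 < ε) (z : Plane) : 0 < rad ε z := hε.trans_le (le_rad ε z)

theorem norm_le_rad (ε : ℝ) (z : Plane) : ‖z‖ ≤ rad ε z :=
  Real.le_sqrt_of_sq_le (by nlinarith [sq_nonneg ε])

theorem rad_smul {ε : ℝ} (hε : 0 < ε) (z : Plane) : rad ε (ε • z) = ε * rad 1 z := by
  rw [rad, rad, norm_smul, Real.norm_eq_abs, abs_of_pos hε]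
  rw [show (ε * ‖z‖) ^ 2 + ε ^ 2 = ε ^ 2 * (‖z‖ ^ 2 + 1 ^ 2) by ring, Real.sqrt_mul (sq_nonneg ε),
    Real.sqrt_sq hε.le]

theorem rad_neg (ε : ℝ) (z : Plane) : rad ε (-z) = rad ε z := by rw [rad, rad, norm_neg]

theorem ker_neg (ε : ℝ) (z : Plane) : ker ε (-z) = ker ε z := by rw [ker, ker, rad_neg]

theorem dker_neg (ε : ℝ) (i : Fin 2) (z : Plane) : dker ε i (-z) = -dker ε i z := by
  rw [dker, dker, rad_neg, PiLp.neg_apply]; ring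

theorem ddker_smul {ε : ℝ} (hε : 0 < ε) (i j : Fin 2) (z : Plane) :
    ddker ε i j (ε • z) = ε⁻¹ ^ 3 * ddker 1 i j z := by
  have := rad_pos one_pos z
  rw [ddker, ddker, rad_smul hε, PiLp.smul_apply, PiLp.smul_apply, smul_eq_mul, smul_eq_mul]
  field_simp

theorem continuous_rad (ε : ℝ) : Continuous (rad ε) := by unfold rad; fun_prop

theorem continuous_ker {ε : ℝ} (hε : 0 < ε) : Continuous (ker ε) :=
  continuous_const.div (continuous_rad ε) fun z => (rad_pos hε z).ne'

theorem continuous_dker {ε : ℝ} (hε : 0 < ε) (i : Fin 2) : Continuous (dker ε i) := by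
  have h := continuous_rad ε
  refine (Continuous.div (by fun_prop) (by fun_prop) fun z => ?_).neg
  exact (pow_pos (rad_pos hε z) 3).ne'

theorem continuous_ddker {ε : ℝ} (hε : 0 < ε) (i j : Fin 2) : Continuous (ddker ε i j) := by
  have h := continuous_rad ε
  refine (Continuous.div (by fun_prop) (by fun_prop) fun z => ?_).sub
    (Continuous.div (by fun_prop) (by fun_prop) fun z => ?_)
  · exact (pow_pos (rad_pos hε z) 3).ne'
  · exact (pow_pos (rad_pos hε z) 5).ne'

theorem hasFDerivAt_rad {ε : ℝ} (hε : 0 < ε) (z : Plane) :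
    HasFDerivAt (rad ε) ((1 / rad ε z) • innerSL ℝ z) z := by
  have h1 : HasFDerivAt (fun z : Plane => ‖z‖ ^ 2 + ε ^ 2) (2 • innerSL ℝ z) z :=
    ((hasStrictFDerivAt_norm_sq z).hasFDerivAt).add_const _
  have h2 := h1.sqrt (by positivity)
  refine HasFDerivAt.congr_fderiv (f := rad ε) h2 ?_
  rw [rad, ← Nat.cast_smul_eq_nsmul ℝ, smul_smul]
  congr 1
  push_cast
  field_simp

theorem hasFDerivAt_rad_pow {ε : ℝ} (hε : 0 < ε) (n : ℕ) (z : Plane) :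
    HasFDerivAt (fun z => (rad ε z ^ n)⁻¹) (-(n / rad ε z ^ (n + 2)) • innerSL ℝ z) z := by
  have hr := rad_pos hε z
  have h1 : HasDerivAt (fun r : ℝ => (r ^ n)⁻¹) (-(n / rad ε z ^ (n + 1))) (rad ε z) := by
    have := (hasDerivAt_pow n (rad ε z)).inv (pow_pos hr n).ne'
    refine HasDerivAt.congr_deriv (f := fun r : ℝ => (r ^ n)⁻¹) this ?_
    rcases n with _ | n
    · simp
    · rw [Nat.add_sub_cancel]; field_simp; ring
  have h2 := h1.comp_hasFDerivAt z (hasFDerivAt_rad hε z)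
  refine HasFDerivAt.congr_fderiv (f := fun z => (rad ε z ^ n)⁻¹) h2 ?_
  rw [smul_smul]
  congr 1
  rw [neg_mul]; congr 1
  field_simp
  ring

theorem hasFDerivAt_ker {ε : ℝ} (hε : 0 < ε) (z : Plane) :
    HasFDerivAt (ker ε) (-(1 / rad ε z ^ 3) • innerSL ℝ z) z := by
  have h := hasFDerivAt_rad_pow hε 1 z
  simp only [pow_one, Nat.cast_one] at h
  have e : ker ε = fun z => (rad ε z)⁻¹ := by funext z; rw [ker, one_div]
  rw [e]; exact h

theorem inner_single (z : Plane) (i : Fin 2) :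
    inner ℝ z (EuclideanSpace.single i (1 : ℝ)) = z i := by
  rw [EuclideanSpace.inner_single_right]; simp

theorem pderiv_ker {ε : ℝ} (hε : 0 < ε) (i : Fin 2) (z : Plane) :
    pderiv i (ker ε) z = dker ε i z := by
  rw [pderiv, (hasFDerivAt_ker hε z).fderiv]
  simp only [_root_.smul_apply, innerSL_apply_apply, inner_single, smul_eq_mul, dker]
  ring

theorem hasFDerivAt_dker {ε : ℝ} (hε : 0 < ε) (i : Fin 2) (z : Plane) :
    HasFDerivAt (dker ε i) ((3 * z i / rad ε z ^ 5) • innerSL ℝ z -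
      (rad ε z ^ 3)⁻¹ • (EuclideanSpace.proj i : Plane →L[ℝ] ℝ)) z := by
  have h1 := hasFDerivAt_rad_pow hε 3 z
  have h2 : HasFDerivAt (fun z : Plane => z i) (EuclideanSpace.proj i : Plane →L[ℝ] ℝ) z :=
    (EuclideanSpace.proj i : Plane →L[ℝ] ℝ).hasFDerivAt
  have h3 := (h2.mul h1).neg
  have e : dker ε i = fun z => -(z i * (rad ε z ^ 3)⁻¹) := by
    funext z; rw [dker, div_eq_mul_inv]
  rw [e]
  refine h3.congr_fderiv ?_
  ext v
  simp
  ring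

theorem pderiv_dker {ε : ℝ} (hε : 0 < ε) (i j : Fin 2) (z : Plane) :
    pderiv j (dker ε i) z = -ddker ε i j z := by
  rw [pderiv, (hasFDerivAt_dker hε i z).fderiv]
  have h : (EuclideanSpace.single j (1 : ℝ) : Plane) i = if i = j then 1 else 0 := by
    simp
  change (3 * z i / rad ε z ^ 5) * inner ℝ z (EuclideanSpace.single j (1 : ℝ)) -
    (rad ε z ^ 3)⁻¹ * (EuclideanSpace.single j (1 : ℝ) : Plane) i = _
  rw [inner_single, h, ddker]
  ring

theorem abs_dker_le {ε : ℝ} (hε : 0 < ε) (i : Fin 2) (z : Plane) :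
    |dker ε i z| ≤ 1 / (‖z‖ ^ 2 + ε ^ 2) := by
  have hr := rad_pos hε z
  rw [← rad_sq, dker, abs_neg, abs_div, abs_of_pos (pow_pos hr 3), div_le_div_iff₀ (by positivity)
    (by positivity)]
  have : |z i| ≤ rad ε z := (abs_apply_le_norm_plane z i).trans (norm_le_rad ε z)
  nlinarith [mul_le_mul_of_nonneg_right this (sq_nonneg (rad ε z))]

/-- The cubic decay makes the Hessian at unit scale absolutely integrable over the plane, as the
homogenization of the dipole term requires. -/
theorem abs_ddker_le {ε : ℝ} (hε : 0 < ε) (i j : Fin 2) (z : Plane) :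
    |ddker ε i j z| ≤ 4 / rad ε z ^ 3 := by
  have hr := rad_pos hε z
  have h1 : |(if i = j then 1 else 0 : ℝ) / rad ε z ^ 3| ≤ 1 / rad ε z ^ 3 := by
    rw [abs_div, abs_of_pos (pow_pos hr 3)]
    gcongr
    split_ifs <;> simp
  have h2 : |3 * (z i * z j) / rad ε z ^ 5| ≤ 3 / rad ε z ^ 3 := by
    rw [abs_div, abs_of_pos (pow_pos hr 5), abs_mul, abs_mul, div_le_div_iff₀ (by positivity)
      (by positivity), abs_of_pos (show (0 : ℝ) < 3 by norm_num)]
    have ha : |z i| ≤ rad ε z := (abs_apply_le_norm_plane z i).trans (norm_le_rad ε z)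
    have hb : |z j| ≤ rad ε z := (abs_apply_le_norm_plane z j).trans (norm_le_rad ε z)
    have : |z i| * |z j| ≤ rad ε z * rad ε z := mul_le_mul ha hb (abs_nonneg _) hr.le
    have h5 : rad ε z ^ 5 = rad ε z * rad ε z * rad ε z ^ 3 := by ring
    rw [h5]
    nlinarith [mul_le_mul_of_nonneg_right this (pow_pos hr 3).le]
  calc _ ≤ _ := abs_sub _ _
    _ ≤ 1 / rad ε z ^ 3 + 3 / rad ε z ^ 3 := add_le_add h1 h2
    _ = _ := by ring

theorem ker_le {ε : ℝ} (hε : 0 < ε) (z : Plane) : ker ε z ≤ 1 / ε :=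
  one_div_le_one_div_of_le hε (le_rad ε z)

theorem ker_nonneg (ε : ℝ) (z : Plane) : 0 ≤ ker ε z := by
  have := rad_nonneg ε z
  unfold ker; positivity

theorem ker_sq (ε : ℝ) (z : Plane) : ker ε z ^ 2 = 1 / (‖z‖ ^ 2 + ε ^ 2) := by
  rw [ker, div_pow, rad_sq, one_pow]

theorem ker_le_inv_norm (ε : ℝ) {z : Plane} (hz : z ≠ 0) : ker ε z ≤ 1 / ‖z‖ :=
  one_div_le_one_div_of_le (norm_pos_iff.mpr hz) (norm_le_rad ε z)

theorem exists_lipschitz_ker {ε : ℝ} (hε : 0 < ε) : ∃ L, LipschitzWith L (ker ε) := by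
  refine ⟨(1 / ε ^ 2).toNNReal, lipschitzWith_of_nnnorm_fderiv_le
    (fun z => (hasFDerivAt_ker hε z).differentiableAt) fun z => ?_⟩
  rw [(hasFDerivAt_ker hε z).fderiv, ← NNReal.coe_le_coe, Real.coe_toNNReal _ (by positivity),
    coe_nnnorm, norm_smul, innerSL_apply_norm, norm_neg, Real.norm_eq_abs]
  have hr := rad_pos hε z
  rw [abs_of_pos (by positivity)]
  calc 1 / rad ε z ^ 3 * ‖z‖ ≤ 1 / rad ε z ^ 3 * rad ε z := by gcongr; exact norm_le_rad ε z
    _ = 1 / rad ε z ^ 2 := by field_simp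
    _ ≤ 1 / ε ^ 2 := by gcongr; exact le_rad ε z

theorem exists_lipschitz_dker {ε : ℝ} (hε : 0 < ε) (i : Fin 2) :
    ∃ L, LipschitzWith L (dker ε i) := by
  refine ⟨(4 / ε ^ 3).toNNReal, lipschitzWith_of_nnnorm_fderiv_le
    (fun z => (hasFDerivAt_dker hε i z).differentiableAt) fun z => ?_⟩
  rw [(hasFDerivAt_dker hε i z).fderiv, ← NNReal.coe_le_coe, Real.coe_toNNReal _ (by positivity),
    coe_nnnorm]
  have hr := rad_pos hε z
  have hp : ‖(EuclideanSpace.proj i : Plane →L[ℝ] ℝ)‖ ≤ 1 :=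
    ContinuousLinearMap.opNorm_le_bound _ zero_le_one fun v => by
      rw [one_mul]; exact abs_apply_le_norm_plane v i
  refine (norm_sub_le _ _).trans ?_
  rw [norm_smul, norm_smul, innerSL_apply_norm, norm_inv, norm_pow, Real.norm_of_nonneg hr.le,
    norm_div, norm_mul, norm_pow, Real.norm_of_nonneg hr.le, Real.norm_of_nonneg
    (show (0 : ℝ) ≤ 3 by norm_num)]
  have hz := norm_le_rad ε z
  have hzi : ‖z i‖ ≤ rad ε z := (abs_apply_le_norm_plane z i).trans hz
  calc 3 * ‖z i‖ / rad ε z ^ 5 * ‖z‖ + (rad ε z ^ 3)⁻¹ * ‖(EuclideanSpace.proj i : Plane →L[ℝ] ℝ)‖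
      ≤ 3 * rad ε z / rad ε z ^ 5 * rad ε z + (rad ε z ^ 3)⁻¹ * 1 := by gcongr
    _ = 4 / rad ε z ^ 3 := by field_simp; norm_num
    _ ≤ 4 / ε ^ 3 := by gcongr; exact le_rad ε z

/-! ### Integral bounds -/

theorem finrank_plane : Module.finrank ℝ Plane = 2 := by simp

theorem integrable_bracket {r : ℝ} (hr : 2 < r) :
    Integrable fun z : Plane => (1 + ‖z‖ ^ 2) ^ (-r / 2) :=
  integrable_rpow_neg_one_add_norm_sq (by rw [finrank_plane]; exact_mod_cast hr)

theorem integral_comp_scale {ε : ℝ} (hε : 0 < ε) (G : Plane → ℝ) (y : Plane) :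
    ∫ x, G (ε⁻¹ • (x - y)) = ε ^ 2 * ∫ z, G z := by
  rw [integral_sub_right_eq_self (fun x => G (ε⁻¹ • x)) y, Measure.integral_comp_inv_smul_of_nonneg
    volume G hε.le, finrank_plane, smul_eq_mul]

theorem integrable_comp_scale {ε : ℝ} (hε : 0 < ε) {G : Plane → ℝ} (hG : Integrable G) (y : Plane) :
    Integrable fun x => G (ε⁻¹ • (x - y)) :=
  ((integrable_comp_smul_iff volume G (inv_ne_zero hε.ne')).mpr hG).comp_sub_right y

/-- Inverse square decay is the borderline of integrability in the plane. On the bounded range `s ≤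
D` a quarter power of `t = 1 + (s/ε)²` can be traded for `1/√ε`, and the remaining power `t^(-5/4)`
is integrable. -/
theorem inv_sq_le {ε D s : ℝ} (hε : 0 < ε) (hε1 : ε ≤ 1) (hs : 0 ≤ s) (hsD : s ≤ D) :
    1 / (s ^ 2 + ε ^ 2) ≤
      (1 + D ^ 2) ^ (1 / 4 : ℝ) / √ε * (ε⁻¹ ^ 2 * (1 + (ε⁻¹ * s) ^ 2) ^ (-(5 / 2) / 2 : ℝ)) := by
  set t := 1 + (ε⁻¹ * s) ^ 2 with ht
  have ht0 : 0 < t := by positivity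
  have h1 : s ^ 2 + ε ^ 2 = ε ^ 2 * t := by rw [ht]; field_simp; ring
  have h2 : t ≤ (1 + D ^ 2) / ε ^ 2 := by
    rw [le_div_iff₀ (by positivity), mul_comm, ← h1]; nlinarith
  have h3 : t ^ (1 / 4 : ℝ) ≤ (1 + D ^ 2) ^ (1 / 4 : ℝ) / √ε := by
    calc t ^ (1 / 4 : ℝ) ≤ ((1 + D ^ 2) / ε ^ 2) ^ (1 / 4 : ℝ) := by gcongr
      _ = _ := by
        have h : (ε ^ 2) ^ (1 / 4 : ℝ) = √ε := by
          rw [Real.sqrt_eq_rpow, ← Real.rpow_natCast ε 2, ← Real.rpow_mul hε.le]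
          norm_num
        rw [Real.div_rpow (by positivity) (by positivity), h]
  have h4 : t ^ (-(5 / 2) / 2 : ℝ) * t ^ (1 / 4 : ℝ) = t⁻¹ := by
    rw [← Real.rpow_add ht0, ← Real.rpow_neg_one]; norm_num
  calc 1 / (s ^ 2 + ε ^ 2) = ε⁻¹ ^ 2 * (t ^ (-(5 / 2) / 2 : ℝ) * t ^ (1 / 4 : ℝ)) := by
        rw [h1, h4]; field_simp
    _ ≤ ε⁻¹ ^ 2 * (t ^ (-(5 / 2) / 2 : ℝ) * ((1 + D ^ 2) ^ (1 / 4 : ℝ) / √ε)) := by gcongr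
    _ = _ := by ring

/-- The true growth is logarithmic, but any bound `o(1/ε)` is enough: multiplied by the film
thickness it yields potentials `O(√ε)`. -/
theorem exists_integral_inv_sq_le (D : ℝ) : ∃ C : ℝ, 0 ≤ C ∧ ∀ ε, 0 < ε → ε ≤ 1 → ∀ y : Plane,
    ∀ S : Set Plane, MeasurableSet S → S ⊆ Metric.closedBall y D →
      IntegrableOn (fun x => 1 / (‖x - y‖ ^ 2 + ε ^ 2)) S ∧
      ∫ x in S, 1 / (‖x - y‖ ^ 2 + ε ^ 2) ≤ C / √ε := by
  set G : Plane → ℝ := fun z => (1 + ‖z‖ ^ 2) ^ (-(5 / 2) / 2 : ℝ) with hG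
  have hGi : Integrable G := integrable_bracket (by norm_num)
  have hG0 : ∀ z, 0 ≤ G z := fun z => by rw [hG]; positivity
  refine ⟨(1 + D ^ 2) ^ (1 / 4 : ℝ) * ∫ z, G z, mul_nonneg (by positivity)
    (integral_nonneg hG0), fun ε hε hε1 y S hS hSD => ?_⟩
  have hle : ∀ x ∈ S, 1 / (‖x - y‖ ^ 2 + ε ^ 2) ≤
      (1 + D ^ 2) ^ (1 / 4 : ℝ) / √ε * (ε⁻¹ ^ 2 * G (ε⁻¹ • (x - y))) := fun x hx => by
    have := inv_sq_le hε hε1 (norm_nonneg (x - y)) (mem_closedBall_iff_norm.mp (hSD hx))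
    rw [hG]; simp only [norm_smul, norm_inv, Real.norm_of_nonneg hε.le]
    exact this
  have hInt : Integrable fun x => (1 + D ^ 2) ^ (1 / 4 : ℝ) / √ε *
      (ε⁻¹ ^ 2 * G (ε⁻¹ • (x - y))) := ((integrable_comp_scale hε hGi y).const_mul _).const_mul _
  have hm : Continuous fun x : Plane => 1 / (‖x - y‖ ^ 2 + ε ^ 2) :=
    Continuous.div (by fun_prop) (by fun_prop) fun x => by positivity
  have hi : IntegrableOn (fun x => 1 / (‖x - y‖ ^ 2 + ε ^ 2)) S := by
    refine hInt.integrableOn.mono' hm.aestronglyMeasurable ?_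
    filter_upwards [ae_restrict_mem hS] with x hx
    rw [Real.norm_of_nonneg (by positivity)]
    exact hle x hx
  refine ⟨hi, ?_⟩
  calc _ ≤ ∫ x in S, (1 + D ^ 2) ^ (1 / 4 : ℝ) / √ε * (ε⁻¹ ^ 2 * G (ε⁻¹ • (x - y))) :=
        setIntegral_mono_on hi hInt.integrableOn hS hle
    _ ≤ ∫ x, (1 + D ^ 2) ^ (1 / 4 : ℝ) / √ε * (ε⁻¹ ^ 2 * G (ε⁻¹ • (x - y))) :=
        setIntegral_le_integral hInt (Eventually.of_forall fun x => by
          have := hG0 (ε⁻¹ • (x - y))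
          simp only [Pi.zero_apply]
          positivity)
    _ = _ := by
        rw [integral_const_mul, integral_const_mul, integral_comp_scale hε]
        field_simp

/-- The majorant of the difference of two Coulomb kernels. -/
def kerMajorant (z : Plane) : ℝ := 1 / (‖z‖ * (‖z‖ ^ 2 + 1))

theorem kerMajorant_nonneg (z : Plane) : 0 ≤ kerMajorant z := by unfold kerMajorant; positivity

/-- The singularity `1/‖z‖` at the origin is controlled by the quadratic growth of area. At infinity
the decay is cubic, comparable with `(1 + ‖z‖²)^(-3/2)`. -/
theorem integrable_kerMajorant : Integrable kerMajorant := by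
  have hm : Measurable kerMajorant := by unfold kerMajorant; fun_prop
  have hq : QuadraticGrowth (volume.restrict (Metric.closedBall (0 : Plane) 1)) discArea :=
    quadraticGrowth_volume.mono Measure.restrict_le_self
  have hfin : IsFiniteMeasure (volume.restrict (Metric.closedBall (0 : Plane) 1)) :=
    ⟨by simpa only [Measure.restrict_apply_univ] using Metric.isBounded_closedBall.measure_lt_top⟩
  have h1 : IntegrableOn (fun z : Plane => 1 / ‖z‖) (Metric.closedBall 0 1) := by
    have h := hq.integrable_inv_dist discArea_nonneg 0
    simp only [sub_zero] at h
    exact h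
  have h2 : Integrable fun z : Plane => (Metric.closedBall (0 : Plane) 1).indicator
      (fun z => 1 / ‖z‖) z + 2 * (1 + ‖z‖ ^ 2) ^ (-3 / 2 : ℝ) :=
    (h1.integrable_indicator Metric.isClosed_closedBall.measurableSet).add
      ((integrable_bracket (by norm_num)).const_mul 2)
  refine h2.mono' hm.aestronglyMeasurable (Eventually.of_forall fun z => ?_)
  rw [Real.norm_of_nonneg (kerMajorant_nonneg z), kerMajorant]
  have hpos : 0 ≤ 2 * (1 + ‖z‖ ^ 2) ^ (-3 / 2 : ℝ) := by positivity
  by_cases hz : z ∈ Metric.closedBall (0 : Plane) 1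
  · rw [indicator_of_mem hz]
    have : 1 / (‖z‖ * (‖z‖ ^ 2 + 1)) ≤ 1 / ‖z‖ := by
      rcases (norm_nonneg z).eq_or_lt with h0 | h0
      · rw [← h0]; simp
      · apply one_div_le_one_div_of_le h0
        nlinarith [sq_nonneg ‖z‖, mul_nonneg h0.le (sq_nonneg ‖z‖)]
    linarith
  · rw [indicator_of_notMem hz, zero_add]
    rw [mem_closedBall_zero_iff, not_le] at hz
    have e : (1 + ‖z‖ ^ 2) ^ (-3 / 2 : ℝ) = 1 / ((1 + ‖z‖ ^ 2) * √(1 + ‖z‖ ^ 2)) := by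
      rw [show (-3 / 2 : ℝ) = -(1 + 1 / 2) by norm_num, Real.rpow_neg (by positivity),
        Real.rpow_add (by positivity), Real.rpow_one, Real.sqrt_eq_rpow]
      exact (one_div _).symm
    have hs : √(1 + ‖z‖ ^ 2) ≤ 2 * ‖z‖ := by
      rw [Real.sqrt_le_left (by positivity)]; nlinarith
    rw [e, mul_one_div, div_le_div_iff₀ (by positivity) (by positivity)]
    nlinarith [sq_nonneg ‖z‖, mul_le_mul_of_nonneg_left hs (show 0 ≤ 1 + ‖z‖ ^ 2 by positivity)]

/-- With `A`, `B` the two roots, `1/A - 1/B = (B² - A²) / (A B (A + B))`. The numerator is `1 - h²`,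
and the denominator is at least `s B²`. -/
theorem abs_inv_sqrt_sub_le {s h H : ℝ} (hs : 0 < s) (hh : |h| ≤ H) :
    |1 / √(s ^ 2 + h ^ 2) - 1 / √(s ^ 2 + 1)| ≤ (1 + H ^ 2) * (1 / (s * (s ^ 2 + 1))) := by
  set A := √(s ^ 2 + h ^ 2) with hA
  set B := √(s ^ 2 + 1) with hB
  have hA2 : A ^ 2 = s ^ 2 + h ^ 2 := Real.sq_sqrt (by positivity)
  have hB2 : B ^ 2 = s ^ 2 + 1 := Real.sq_sqrt (by positivity)
  have hAs : s ≤ A := Real.le_sqrt_of_sq_le (by nlinarith [sq_nonneg h])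
  have hB0 : 0 < B := Real.sqrt_pos.mpr (by positivity)
  have hA0 : 0 < A := hs.trans_le hAs
  have e : 1 / A - 1 / B = (1 - h ^ 2) / (A * B * (A + B)) := by
    rw [div_sub_div _ _ hA0.ne' hB0.ne', div_eq_div_iff (by positivity) (by positivity)]
    have : 1 - h ^ 2 = B ^ 2 - A ^ 2 := by rw [hA2, hB2]; ring
    rw [this]; ring
  rw [e, abs_div, abs_of_pos (show 0 < A * B * (A + B) by positivity), ← hB2, mul_one_div]
  have hn : |1 - h ^ 2| ≤ 1 + H ^ 2 := by
    have : h ^ 2 ≤ H ^ 2 := by rw [← sq_abs]; gcongr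
    rw [abs_le]; constructor <;> nlinarith [sq_nonneg h]
  have hd : s * B ^ 2 ≤ A * B * (A + B) := by
    have h1 : s * B ^ 2 ≤ A * B ^ 2 := by gcongr
    nlinarith [mul_pos (mul_pos hA0 hB0) hA0]
  exact div_le_div₀ (by positivity) hn (by positivity) hd

/-- The difference between a Coulomb kernel at height at most `εH` and the regularized kernel. -/
theorem abs_inv_norm_join_sub_ker_le {ε H t : ℝ} (hε : 0 < ε) (ht : |t| ≤ ε * H) {z : Plane}
    (hz : z ≠ 0) :
    |1 / ‖join z t‖ - ker ε z| ≤ (1 + H ^ 2) * ε⁻¹ * kerMajorant (ε⁻¹ • z) := by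
  have hz0 : 0 < ‖z‖ := norm_pos_iff.mpr hz
  have hh : |ε⁻¹ * t| ≤ H := by
    rw [abs_mul, abs_of_pos (inv_pos.mpr hε), inv_mul_le_iff₀ hε]; exact ht
  have h := abs_inv_sqrt_sub_le (s := ε⁻¹ * ‖z‖) (by positivity) hh
  have e1 : √((ε⁻¹ * ‖z‖) ^ 2 + (ε⁻¹ * t) ^ 2) = ε⁻¹ * ‖join z t‖ := by
    rw [norm_join, ← Real.sqrt_sq (inv_pos.mpr hε).le, ← Real.sqrt_mul (by positivity),
      Real.sqrt_sq (inv_pos.mpr hε).le]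
    congr 1; ring
  have e2 : √((ε⁻¹ * ‖z‖) ^ 2 + 1) = ε⁻¹ * rad ε z := by
    rw [rad, ← Real.sqrt_sq (inv_pos.mpr hε).le, ← Real.sqrt_mul (by positivity),
      Real.sqrt_sq (inv_pos.mpr hε).le]
    congr 1; field_simp
  rw [e1, e2] at h
  have e3 : 1 / ‖join z t‖ - ker ε z = ε⁻¹ * (1 / (ε⁻¹ * ‖join z t‖) - 1 / (ε⁻¹ * rad ε z)) := by
    rw [ker]; field_simp
  rw [e3, abs_mul, abs_of_pos (inv_pos.mpr hε), kerMajorant, norm_smul, norm_inv,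
    Real.norm_of_nonneg hε.le]
  refine (mul_le_mul_of_nonneg_left h (inv_pos.mpr hε).le).trans_eq ?_
  ring

/-! ### Consequences of weak convergence -/

/-- Banach–Steinhaus applies to sequences. If the norms were not eventually bounded, countable
generation of the filter would give a sequence along it with norms exceeding `n`, although all its
pairings converge. -/
theorem exists_eventually_norm_le_of_tendsto_inner {H ι : Type*} [NormedAddCommGroup H]
    [InnerProductSpace ℝ H] [CompleteSpace H] {l : Filter ι} [l.IsCountablyGenerated]
    {x : ι → H} (hx : ∀ y, ∃ a : ℝ, Tendsto (fun i => inner ℝ (x i) y) l (𝓝 a)) :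
    ∃ C : ℝ, ∀ᶠ i in l, ‖x i‖ ≤ C := by
  by_contra hC
  push Not at hC
  obtain ⟨s, hs⟩ := l.exists_antitone_basis
  have hex : ∀ n : ℕ, ∃ i ∈ s n, (n : ℝ) < ‖x i‖ := fun n => by
    obtain ⟨i, h1, h2⟩ := ((hC n).and_eventually (hs.mem n)).exists
    exact ⟨i, h2, h1⟩
  choose e hes hen using hex
  have he : Tendsto e atTop l := hs.tendsto hes
  obtain ⟨C, hC'⟩ := banach_steinhaus (g := fun n => innerSL ℝ (x (e n))) fun y => by
    obtain ⟨a, ha⟩ := hx y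
    obtain ⟨C, hC⟩ := (Metric.isBounded_range_of_tendsto _ (ha.comp he)).exists_norm_le
    exact ⟨C, fun n => hC _ ⟨n, rfl⟩⟩
  obtain ⟨n, hn⟩ := exists_nat_gt C
  have := hC' n
  rw [innerSL_apply_norm] at this
  linarith [hen n]

theorem WeakTendstoL2.exists_integral_norm_sq_le {ω : Set Plane} {v : ℝ → Plane → Space}
    {w : Plane → Space} (hv : ∀ ε > 0, MemLp (v ε) 2 (volume.restrict ω))
    (h : WeakTendstoL2 ω v w) :
    ∃ C : ℝ, ∀ᶠ ε in 𝓝[>] 0, ∫ x in ω, ‖v ε x‖ ^ 2 ≤ C := by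
  classical
  set X : ℝ → Lp Space 2 (volume.restrict ω) := fun ε =>
    if hε : 0 < ε then (hv ε hε).toLp (v ε) else 0 with hX
  have hae : ∀ ε > 0, X ε =ᵐ[volume.restrict ω] v ε := fun ε hε => by
    simp only [hX, dif_pos hε]
    exact (hv ε hε).coeFn_toLp
  obtain ⟨C, hC⟩ := exists_eventually_norm_le_of_tendsto_inner (l := 𝓝[>] (0 : ℝ)) (x := X)
    fun y => by
      refine ⟨_, (h y (Lp.memLp y)).congr' ?_⟩
      filter_upwards [self_mem_nhdsWithin] with ε hε
      rw [L2.inner_def]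
      refine integral_congr_ae ?_
      filter_upwards [hae ε hε] with x hx
      rw [hx]
  refine ⟨C ^ 2, ?_⟩
  filter_upwards [hC, self_mem_nhdsWithin] with ε hε hε0
  have e : ∫ x in ω, ‖v ε x‖ ^ 2 = ‖X ε‖ ^ 2 := by
    rw [← real_inner_self_eq_norm_sq, L2.inner_def]
    refine integral_congr_ae ?_
    filter_upwards [hae ε hε0] with x hx
    rw [hx, real_inner_self_eq_norm_sq]
  rw [e]
  gcongr

/-- For unit vectors `‖v - w‖² = 2 - 2 v · w`, and testing the weak convergence with `w` itself
sends the integral of this to zero. The inequality `a ≤ (δ + a²/δ) / 2` then passes from `L²` to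
`L¹`. -/
theorem WeakTendstoL2.tendsto_integral_norm_sub {ω : Set Plane} (hω : Bornology.IsBounded ω)
    {v : ℝ → Plane → Space} {w : Plane → Space}
    (hv : ∀ ε > 0, MemLp (v ε) 2 (volume.restrict ω)) (hw : MemLp w 2 (volume.restrict ω))
    (hv1 : ∀ ε > 0, ∀ᵐ x ∂(volume.restrict ω), ‖v ε x‖ = 1)
    (hw1 : ∀ᵐ x ∂(volume.restrict ω), ‖w x‖ = 1) (h : WeakTendstoL2 ω v w) :
    Tendsto (fun ε => ∫ x in ω, ‖v ε x - w x‖) (𝓝[>] 0) (𝓝 0) := by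
  have hfin : IsFiniteMeasure (volume.restrict ω) :=
    ⟨by rw [Measure.restrict_apply_univ]; exact hω.measure_lt_top⟩
  have hsq : Tendsto (fun ε => ∫ x in ω, ‖v ε x - w x‖ ^ 2) (𝓝[>] 0) (𝓝 0) := by
    have hbi : ∀ u : Plane → Space, MemLp u 2 (volume.restrict ω) →
        (∀ᵐ x ∂(volume.restrict ω), ‖u x‖ = 1) →
        Integrable (fun x => inner ℝ (u x) (w x)) (volume.restrict ω) := fun u hu hu1 => by
      refine Integrable.of_bound (hu.1.inner hw.1) 1 ?_
      filter_upwards [hu1, hw1] with x h1 h2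
      simpa [h1, h2] using norm_inner_le_norm (𝕜 := ℝ) (u x) (w x)
    have h1 := ((h w hw).const_mul 2).const_sub (2 * ∫ x in ω, inner ℝ (w x) (w x))
    rw [sub_self] at h1
    refine h1.congr' ?_
    filter_upwards [self_mem_nhdsWithin] with ε hε
    rw [← integral_const_mul, ← integral_const_mul, ← integral_sub ((hbi w hw hw1).const_mul 2)
      ((hbi _ (hv ε hε) (hv1 ε hε)).const_mul 2)]
    refine integral_congr_ae ?_
    filter_upwards [hv1 ε hε, hw1] with x h1 h2
    rw [norm_sub_sq_real, h1, real_inner_self_eq_norm_sq, h2]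
    ring
  set V := volume.real ω
  have hV : 0 ≤ V := measureReal_nonneg
  rw [Metric.tendsto_nhds]
  intro e he
  set δ := e / (V + 1) with hδ
  have hδ0 : 0 < δ := by positivity
  have hlim : Tendsto (fun ε => (δ * V + (∫ x in ω, ‖v ε x - w x‖ ^ 2) / δ) / 2) (𝓝[>] 0)
      (𝓝 ((δ * V + 0 / δ) / 2)) := ((hsq.div_const δ).const_add _).div_const 2
  have hlt : (δ * V + 0 / δ) / 2 < e := by
    rw [zero_div, add_zero, hδ, div_mul_eq_mul_div, div_div, div_lt_iff₀ (by positivity)]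
    nlinarith
  filter_upwards [hlim.eventually_lt_const hlt, self_mem_nhdsWithin] with ε hε hε0
  rw [Real.dist_0_eq_abs, abs_of_nonneg (integral_nonneg fun x => norm_nonneg _)]
  refine lt_of_le_of_lt ?_ hε
  have hm : MemLp (fun x => v ε x - w x) 2 (volume.restrict ω) := (hv ε hε0).sub hw
  have hi2 : Integrable (fun x => ‖v ε x - w x‖ ^ 2) (volume.restrict ω) := hm.norm.integrable_sq
  have hc : Integrable (fun _ : Plane => δ) (volume.restrict ω) := integrable_const δ
  calc ∫ x in ω, ‖v ε x - w x‖ ≤ ∫ x in ω, (δ + ‖v ε x - w x‖ ^ 2 / δ) / 2 := by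
        refine integral_mono (hm.integrable (by norm_num)).norm
          ((hc.add (hi2.div_const δ)).div_const 2) fun x => ?_
        rw [le_div_iff₀ two_pos, ← sub_nonneg]
        have : δ + ‖v ε x - w x‖ ^ 2 / δ - ‖v ε x - w x‖ * 2 = (δ - ‖v ε x - w x‖) ^ 2 / δ := by
          field_simp; ring
        rw [this]; positivity
    _ = _ := by
        rw [integral_div, integral_add hc (hi2.div_const δ), integral_div δ, setIntegral_const,
          smul_eq_mul, mul_comm δ]

/-! ### From surface charges to dipoles -/

theorem integrable_prod_kernel {ν ν' : Measure Plane} [SFinite ν] [SFinite ν'] {p q : Plane → ℝ}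
    (hp : Integrable p ν) (hq : Integrable q ν') {K : Plane → ℝ} (hK : Continuous K) {B : ℝ}
    (hB : ∀ z, |K z| ≤ B) :
    Integrable (Function.uncurry fun x y => p x * (q y * K (y - x))) (ν.prod ν') := by
  have h := (hp.mul_prod hq).mul_bdd (c := B) (g := fun z : Plane × Plane => K (z.2 - z.1))
    (Continuous.aestronglyMeasurable (by fun_prop)) (Eventually.of_forall fun z => hB _)
  refine h.congr (Eventually.of_forall fun z => ?_)
  simp only [Function.uncurry]
  ring

theorem integrable_mul_kernel {ν : Measure Plane} {q : Plane → ℝ}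
    (hq : Integrable q ν) {K : Plane → ℝ} (hK : Continuous K) {B : ℝ}
    (hB : ∀ z, |K z| ≤ B) (y : Plane) : Integrable (fun x => q x * K (x - y)) ν :=
  hq.mul_bdd (c := B) (Continuous.aestronglyMeasurable (by fun_prop))
    (Eventually.of_forall fun z => hB _)

theorem abs_ker_le {ε : ℝ} (hε : 0 < ε) (z : Plane) : |ker ε z| ≤ 1 / ε := by
  rw [abs_of_nonneg (ker_nonneg ε z)]; exact ker_le hε z

theorem abs_dker_le_const {ε : ℝ} (hε : 0 < ε) (i : Fin 2) (z : Plane) :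
    |dker ε i z| ≤ 1 / ε ^ 2 :=
  (abs_dker_le hε i z).trans (one_div_le_one_div_of_le (by positivity)
    (by nlinarith [sq_nonneg ‖z‖]))

theorem abs_ddker_le_const {ε : ℝ} (hε : 0 < ε) (i j : Fin 2) (z : Plane) :
    |ddker ε i j z| ≤ 4 / ε ^ 3 :=
  (abs_ddker_le hε i j z).trans (div_le_div_of_nonneg_left (by norm_num) (by positivity)
    (by gcongr; exact le_rad ε z))

theorem pderiv_comp_sub (i : Fin 2) (ψ : Plane → ℝ) (y x : Plane) :
    pderiv i (fun x => ψ (x - y)) x = pderiv i ψ (x - y) := by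
  rw [pderiv, pderiv, fderiv_comp_sub]

theorem lipschitz_comp_sub {ψ : Plane → ℝ} {L : ℝ≥0} (h : LipschitzWith L ψ) (y : Plane) :
    LipschitzWith L fun x => ψ (x - y) :=
  LipschitzWith.of_dist_le_mul fun a b => by
    simpa [dist_sub_right] using h.dist_le_mul (a - y) (b - y)

theorem differentiable_comp_sub {ψ : Plane → ℝ} (h : Differentiable ℝ ψ) (y : Plane) :
    Differentiable ℝ fun x => ψ (x - y) :=
  h.comp (differentiable_id.sub_const y)

/-- The charge density `ρ` on `ν` is the sum of `c` and minus the divergence of `p`. -/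
def IsDipoleDecomposition (ν : Measure Plane) (ρ : Plane → ℝ) (p : Fin 2 → Plane → ℝ)
    (c : Plane → ℝ) : Prop :=
  ∀ ψ : Plane → ℝ, (∃ L, LipschitzWith L ψ) → (∃ B : ℝ, ∀ x, |ψ x| ≤ B) → Differentiable ℝ ψ →
    ∫ x, ρ x * ψ x ∂ν = ∑ i, ∫ x, p i x * pderiv i ψ x ∂ν + ∫ x, c x * ψ x ∂ν

section Dipole

variable {ν : Measure Plane} {ε : ℝ} {ρ c : Plane → ℝ} {p : Fin 2 → Plane → ℝ}

theorem IsDipoleDecomposition.integral_ker (h : IsDipoleDecomposition ν ρ p c) (hε : 0 < ε)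
    (y : Plane) :
    ∫ x, ρ x * ker ε (x - y) ∂ν =
      ∑ i, ∫ x, p i x * dker ε i (x - y) ∂ν + ∫ x, c x * ker ε (x - y) ∂ν := by
  obtain ⟨L, hL⟩ := exists_lipschitz_ker hε
  rw [h (fun x => ker ε (x - y)) ⟨L, lipschitz_comp_sub hL y⟩ ⟨_, fun x => abs_ker_le hε _⟩
    (differentiable_comp_sub (fun x => (hasFDerivAt_ker hε x).differentiableAt) y)]
  simp only [pderiv_comp_sub, pderiv_ker hε]

theorem IsDipoleDecomposition.integral_dker (h : IsDipoleDecomposition ν ρ p c) (hε : 0 < ε)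
    (i : Fin 2) (y : Plane) :
    ∫ x, ρ x * dker ε i (x - y) ∂ν =
      -∑ j, ∫ x, p j x * ddker ε i j (x - y) ∂ν + ∫ x, c x * dker ε i (x - y) ∂ν := by
  obtain ⟨L, hL⟩ := exists_lipschitz_dker hε i
  rw [h (fun x => dker ε i (x - y)) ⟨L, lipschitz_comp_sub hL y⟩
    ⟨_, fun x => abs_dker_le_const hε i _⟩
    (differentiable_comp_sub (fun x => (hasFDerivAt_dker hε i x).differentiableAt) y)]
  simp only [pderiv_comp_sub, pderiv_dker hε, mul_neg, integral_neg, Finset.sum_neg_distrib]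

theorem IsDipoleDecomposition.abs_potential_le (h : IsDipoleDecomposition ν ρ p c) (hε : 0 < ε)
    {S T : ℝ} {y : Plane} (hS : ∀ i, ∫ x, |p i x * dker ε i (x - y)| ∂ν ≤ S)
    (hT : ∫ x, |c x * ker ε (x - y)| ∂ν ≤ T) :
    |∫ x, ρ x * ker ε (x - y) ∂ν| ≤ 2 * S + T := by
  rw [h.integral_ker hε]
  refine (abs_add_le _ _).trans (add_le_add ?_ ((abs_integral_le_integral_abs).trans hT))
  refine (Finset.abs_sum_le_sum_abs _ _).trans ?_
  rw [Fin.sum_univ_two, two_mul]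
  exact add_le_add (abs_integral_le_integral_abs.trans (hS 0))
    (abs_integral_le_integral_abs.trans (hS 1))

theorem abs_integral_mul_le {μ : Measure Plane} {u v : Plane → ℝ} {N S : ℝ} (hu : Integrable u μ)
    (hS : 0 ≤ S) (hN : ∫ x, |u x| ∂μ ≤ N) (hv : ∀ᵐ x ∂μ, |v x| ≤ S) :
    |∫ x, u x * v x ∂μ| ≤ N * S := by
  calc |∫ x, u x * v x ∂μ| ≤ ∫ x, |u x| * S ∂μ := by
        refine norm_integral_le_of_norm_le (f := fun x => u x * v x) (hu.abs.mul_const S) ?_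
        filter_upwards [hv] with x hx
        rw [norm_mul]
        exact mul_le_mul_of_nonneg_left hx (abs_nonneg _)
    _ ≤ N * S := by rw [integral_mul_const]; gcongr

/-- Using the decomposition in one variable and then in the other turns `ρ ρ ker` into `p p ddker`,
plus terms containing `c`. Fubini puts `c` in the outer integral, so each of these is at most `N`
times a potential: `S` for each of the two components of `p`, and `2S + T` for `ρ`. The total is `4S
+ T`. -/
theorem IsDipoleDecomposition.abs_energy_sub_le [SFinite ν] (h : IsDipoleDecomposition ν ρ p c)
    (hε : 0 < ε) (hρ : Integrable ρ ν) (hc : Integrable c ν) (hp : ∀ i, Integrable (p i) ν)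
    {S T N : ℝ} (hS0 : 0 ≤ S) (hT0 : 0 ≤ T)
    (hS : ∀ᵐ y ∂ν, ∀ i, ∫ x, |p i x * dker ε i (x - y)| ∂ν ≤ S)
    (hT : ∀ᵐ y ∂ν, ∫ x, |c x * ker ε (x - y)| ∂ν ≤ T) (hN : ∫ x, |c x| ∂ν ≤ N) :
    |(∫ x, ρ x * ∫ y, ρ y * ker ε (y - x) ∂ν ∂ν) -
      ∑ i, ∑ j, ∫ x, p i x * ∫ y, p j y * ddker ε i j (y - x) ∂ν ∂ν| ≤ N * (4 * S + T) := by
  have hswap : ∀ {a b K : Plane → ℝ} {B : ℝ}, Integrable a ν → Integrable b ν → Continuous K →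
      (∀ z, |K z| ≤ B) → ∫ x, a x * ∫ y, b y * K (y - x) ∂ν ∂ν =
        ∫ y, b y * ∫ x, a x * K (y - x) ∂ν ∂ν := fun {a b K B} ha hb hK hB => by
    simp only [← integral_const_mul]
    rw [integral_integral_swap (integrable_prod_kernel ha hb hK hB)]
    refine integral_congr_ae (Eventually.of_forall fun y => integral_congr_ae
      (Eventually.of_forall fun x => ?_))
    simp only
    ring
  have hout : ∀ {a b K : Plane → ℝ} {B : ℝ}, Integrable a ν → Integrable b ν → Continuous K →
      (∀ z, |K z| ≤ B) → Integrable (fun x => a x * ∫ y, b y * K (y - x) ∂ν) ν :=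
    fun {a b K B} ha hb hK hB => by
      simp only [← integral_const_mul]
      exact (integrable_prod_kernel ha hb hK hB).integral_prod_left
  have hkc := continuous_ker hε
  have hdc := fun i => continuous_dker hε i
  have hddc := fun i j => continuous_ddker hε i j
  have e1 : ∫ x, ρ x * ∫ y, ρ y * ker ε (y - x) ∂ν ∂ν =
      ∑ i, ∫ x, ρ x * ∫ y, p i y * dker ε i (y - x) ∂ν ∂ν +
        ∫ x, ρ x * ∫ y, c y * ker ε (y - x) ∂ν ∂ν := by
    simp only [h.integral_ker hε, mul_add, Finset.mul_sum]
    rw [integral_add (integrable_finsetSum _ fun i _ =>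
      hout hρ (hp i) (hdc i) (abs_dker_le_const hε i)) (hout hρ hc hkc (abs_ker_le hε)),
      integral_finsetSum _ fun i _ => hout hρ (hp i) (hdc i) (abs_dker_le_const hε i)]
  have e2 : ∀ i, ∫ x, ρ x * ∫ y, p i y * dker ε i (y - x) ∂ν ∂ν =
      ∑ j, (∫ x, p i x * ∫ y, p j y * ddker ε i j (y - x) ∂ν ∂ν) -
        ∫ x, p i x * ∫ y, c y * dker ε i (y - x) ∂ν ∂ν := fun i => by
    rw [hswap hρ (hp i) (hdc i) (abs_dker_le_const hε i)]
    have : ∀ x y : Plane, dker ε i (x - y) = -dker ε i (y - x) := fun x y => by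
      rw [← dker_neg, neg_sub]
    have e : ∀ y, ∫ x, ρ x * dker ε i (y - x) ∂ν =
        ∑ j, ∫ x, p j x * ddker ε i j (x - y) ∂ν - ∫ x, c x * dker ε i (x - y) ∂ν := fun y => by
      simp only [this y, mul_neg, integral_neg]
      rw [h.integral_dker hε i y]; ring
    simp only [e, mul_sub, Finset.mul_sum]
    rw [integral_sub (integrable_finsetSum _ fun j _ =>
      hout (hp i) (hp j) (hddc i j) (abs_ddker_le_const hε i j))
      (hout (hp i) hc (hdc i) (abs_dker_le_const hε i)),
      integral_finsetSum _ fun j _ => hout (hp i) (hp j) (hddc i j) (abs_ddker_le_const hε i j)]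
  have e3 : ∀ i, |∫ x, p i x * ∫ y, c y * dker ε i (y - x) ∂ν ∂ν| ≤ N * S := fun i => by
    rw [hswap (hp i) hc (hdc i) (abs_dker_le_const hε i)]
    refine abs_integral_mul_le hc hS0 hN ?_
    filter_upwards [hS] with y hy
    refine abs_integral_le_integral_abs.trans ((le_of_eq ?_).trans (hy i))
    refine integral_congr_ae (Eventually.of_forall fun x => ?_)
    simp only [abs_mul]
    rw [← abs_neg (dker ε i (y - x)), ← dker_neg, neg_sub]
  have e4 : |∫ x, ρ x * ∫ y, c y * ker ε (y - x) ∂ν ∂ν| ≤ N * (2 * S + T) := by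
    rw [hswap hρ hc hkc (abs_ker_le hε)]
    refine abs_integral_mul_le hc (by positivity) hN ?_
    filter_upwards [hS, hT] with y hy hy'
    have e : ∀ x, ker ε (y - x) = ker ε (x - y) := fun x => by rw [← ker_neg, neg_sub]
    simp only [e]
    exact h.abs_potential_le hε hy hy'
  rw [e1]
  simp only [e2, Finset.sum_sub_distrib]
  set DD := ∑ i, ∑ j, ∫ x, p i x * ∫ y, p j y * ddker ε i j (y - x) ∂ν ∂ν
  rw [Fin.sum_univ_two]
  have h0 := abs_le.mp (e3 0)
  have h1 := abs_le.mp (e3 1)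
  have h4 := abs_le.mp e4
  rw [abs_le]
  constructor <;> nlinarith

end Dipole

/-! ### The truncated film thickness -/

/-- A cutoff function vanishing within distance `ε` of the complement of `ω` and equal to `1` at
distance at least `2 ε`. -/
def cutoff (ω : Set Plane) (ε : ℝ) (x : Plane) : ℝ :=
  max 0 (min 1 (ε⁻¹ * Metric.infDist x ωᶜ - 1))

theorem cutoff_nonneg (ω : Set Plane) (ε : ℝ) (x : Plane) : 0 ≤ cutoff ω ε x := le_max_left _ _

theorem cutoff_le_one (ω : Set Plane) (ε : ℝ) (x : Plane) : cutoff ω ε x ≤ 1 :=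
  max_le zero_le_one (min_le_left _ _)

theorem abs_cutoff_le_one (ω : Set Plane) (ε : ℝ) (x : Plane) : |cutoff ω ε x| ≤ 1 := by
  rw [abs_of_nonneg (cutoff_nonneg ω ε x)]; exact cutoff_le_one ω ε x

theorem lipschitz_cutoff (ω : Set Plane) (ε : ℝ≥0) : LipschitzWith ε⁻¹ (cutoff ω ε) := by
  have h : LipschitzWith ε⁻¹ fun x => (ε : ℝ)⁻¹ * Metric.infDist x ωᶜ - 1 :=
    LipschitzWith.of_dist_le_mul fun x y => by
      have := (Metric.lipschitz_infDist_pt ωᶜ).dist_le_mul x y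
      rw [NNReal.coe_one, one_mul, Real.dist_eq] at this
      rw [Real.dist_eq, sub_sub_sub_cancel_right, ← mul_sub, abs_mul, abs_of_nonneg (by positivity),
        NNReal.coe_inv]
      gcongr
  exact (h.const_min 1).const_max 0

theorem tsupport_cutoff_subset {ω : Set Plane} {ε : ℝ} (hε : 0 < ε) :
    tsupport (cutoff ω ε) ⊆ {x | ε ≤ Metric.infDist x ωᶜ} := by
  refine closure_minimal (fun x hx => ?_)
    (isClosed_le continuous_const (Metric.continuous_infDist_pt _))
  by_contra h
  rw [mem_ofPred_eq, not_le] at h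
  refine hx (max_eq_left ((min_le_right _ _).trans ?_))
  have : ε⁻¹ * Metric.infDist x ωᶜ ≤ ε⁻¹ * ε := by gcongr
  rw [inv_mul_cancel₀ hε.ne'] at this
  linarith

theorem tsupport_cutoff_subset_self {ω : Set Plane} {ε : ℝ} (hε : 0 < ε) :
    tsupport (cutoff ω ε) ⊆ ω := fun x hx => by
  by_contra h
  have := tsupport_cutoff_subset hε hx
  rw [mem_ofPred_eq, Metric.infDist_zero_of_mem h] at this
  linarith

theorem hasCompactSupport_cutoff {ω : Set Plane} (hb : Bornology.IsBounded ω) {ε : ℝ} (hε : 0 < ε) :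
    HasCompactSupport (cutoff ω ε) :=
  Metric.isCompact_of_isClosed_isBounded (isClosed_tsupport _)
    (hb.subset (tsupport_cutoff_subset_self hε))

/-- A bounded `ω` is not the whole plane, so the distance to its complement is attained on the
frontier; a distance above `2ε` stays above `2ε` nearby. -/
theorem cutoff_eventually_eq_one {ω : Set Plane} (hb : Bornology.IsBounded ω) {ε : ℝ} (hε : 0 < ε)
    {x : Plane} (hx : x ∈ ω) (h : ∀ y ∈ frontier ω, 2 * ε < dist x y) :
    ∀ᶠ y in 𝓝 x, cutoff ω ε y = 1 := by
  have hne : ω ≠ univ := fun hu => by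
    rw [hu] at hb
    exact NoncompactSpace.noncompact_univ (X := Plane) (by simpa using hb.isCompact_closure)
  obtain ⟨y, hy, hxy⟩ := exists_mem_frontier_infDist_compl_eq_dist hx hne
  have h2 : 2 * ε < Metric.infDist x ωᶜ := by rw [hxy]; exact h y hy
  filter_upwards [(Metric.continuous_infDist_pt ωᶜ).continuousAt.eventually_const_lt h2] with z hz
  have : 1 ≤ ε⁻¹ * Metric.infDist z ωᶜ - 1 := by
    have : ε⁻¹ * (2 * ε) ≤ ε⁻¹ * Metric.infDist z ωᶜ := by gcongr
    rw [show ε⁻¹ * (2 * ε) = 2 by field_simp] at this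
    linarith
  rw [cutoff, min_eq_left this, max_eq_right zero_le_one]

/-- The thickness of the film, cut off near the boundary of `ω`. -/
def thickness (ω : Set Plane) (f₁ f₂ : Plane → ℝ) (ε : ℝ) (x : Plane) : ℝ :=
  (rescale ε f₂ x - rescale ε f₁ x) * cutoff ω ε x

theorem pderiv_eq_gradient (i : Fin 2) (f : Plane → ℝ) (x : Plane) : pderiv i f x = (∇ f x) i := by
  rw [pderiv, ← inner_single (∇ f x) i, gradient, InnerProductSpace.toDual_symm_apply]

section Thickness

variable {ω : Set Plane} {f₁ f₂ : Plane → ℝ} {ε : ℝ} {K₁ K₂ G : ℝ≥0}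

theorem abs_rescale_sub_le (hε : 0 < ε) (hG : ∀ x, |f₂ x - f₁ x| ≤ G) (x : Plane) :
    |rescale ε f₂ x - rescale ε f₁ x| ≤ ε * G := by
  rw [rescale, rescale, ← mul_sub, abs_mul, abs_of_pos hε]
  gcongr
  exact hG _

theorem abs_thickness_le (hε : 0 < ε) (hG : ∀ x, |f₂ x - f₁ x| ≤ G) (x : Plane) :
    |thickness ω f₁ f₂ ε x| ≤ ε * G := by
  rw [thickness, abs_mul, ← mul_one (ε * (G : ℝ))]
  exact mul_le_mul (abs_rescale_sub_le hε hG x) (abs_cutoff_le_one ω ε x) (abs_nonneg _)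
    (by positivity)

/-- The slope `1/ε` of the cutoff multiplies a thickness of at most `εG`, so the Lipschitz constant
does not depend on `ε`. -/
theorem lipschitz_thickness (h₁ : LipschitzWith K₁ f₁) (h₂ : LipschitzWith K₂ f₂) (hε : 0 < ε)
    (hG : ∀ x, |f₂ x - f₁ x| ≤ G) :
    LipschitzWith (G + (K₂ + K₁)) (thickness ω f₁ f₂ ε) := by
  lift ε to ℝ≥0 using hε.le
  have h := lipschitz_mul_of_bounded (A := ε * G) (B := 1)
    ((lipschitz_rescale hε h₂).sub (lipschitz_rescale hε h₁)) (lipschitz_cutoff ω ε)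
    (fun x => by simpa using abs_rescale_sub_le hε hG x)
    (fun x => by simpa using abs_cutoff_le_one ω ε x)
  have e : ε * G * ε⁻¹ + 1 * (K₂ + K₁) = G + (K₂ + K₁) := by
    rw [one_mul, mul_right_comm, mul_inv_cancel₀ (by exact_mod_cast hε.ne'), one_mul]
  rw [e] at h
  exact h

theorem hasCompactSupport_thickness (hb : Bornology.IsBounded ω) (hε : 0 < ε) :
    HasCompactSupport (thickness ω f₁ f₂ ε) :=
  (hasCompactSupport_cutoff hb hε).mul_left

theorem tsupport_thickness_subset (hε : 0 < ε) : tsupport (thickness ω f₁ f₂ ε) ⊆ ω :=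
  (closure_mono (Function.support_mul_subset_right _ _)).trans (tsupport_cutoff_subset_self hε)

/-- The difference of the charge densities on the top and the bottom of the film. -/
def netCharge (f₁ f₂ : Plane → ℝ) (ε : ℝ) (M : Plane → Space) (x : Plane) : ℝ :=
  inner ℝ (M x) (graphNormal f₂ (ε⁻¹ • x)) - inner ℝ (M x) (graphNormal f₁ (ε⁻¹ • x))

/-- The remainder of the dipole decomposition of the net charge. -/
def netRemainder (ω : Set Plane) (f₁ f₂ : Plane → ℝ) (ε : ℝ) (M : Plane → Space)
    (DM : Fin 2 → Plane → Space) (x : Plane) : ℝ :=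
  thickness ω f₁ f₂ ε x * ∑ i : Fin 2, DM i x i.castSucc +
    (netCharge f₁ f₂ ε M x + ∑ i : Fin 2, pderiv i (thickness ω f₁ f₂ ε) x * M x i.castSucc)

/-- The vertical components of the two normals cancel. The net charge is thus a gradient of the
thickness paired with `M`, which is what permits integration by parts. -/
theorem netCharge_eq (hε : ε ≠ 0) (M : Plane → Space) (x : Plane) :
    netCharge f₁ f₂ ε M x =
      -∑ i : Fin 2, (pderiv i (rescale ε f₂) x - pderiv i (rescale ε f₁) x) * M x i.castSucc := by
  simp only [pderiv_eq_gradient, gradient_rescale hε, netCharge, graphNormal, inner_space,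
    Fin.sum_univ_two]
  simp
  ring

theorem abs_netCharge_le (h₁ : LipschitzWith K₁ f₁) (h₂ : LipschitzWith K₂ f₂) (hε : 0 < ε)
    {M : Plane → Space} {x : Plane} (hM : ‖M x‖ ≤ 1) :
    |netCharge f₁ f₂ ε M x| ≤ 2 * (K₁ + K₂) := by
  rw [netCharge_eq hε.ne', abs_neg, Fin.sum_univ_two, two_mul]
  have h : ∀ i : Fin 2, |(pderiv i (rescale ε f₂) x - pderiv i (rescale ε f₁) x) * M x i.castSucc|
      ≤ K₁ + K₂ := fun i => by
    rw [abs_mul, ← mul_one ((K₁ : ℝ) + K₂)]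
    refine mul_le_mul ?_ ((abs_apply_le_norm_space _ _).trans hM) (abs_nonneg _) (by positivity)
    rw [add_comm]
    exact (abs_sub _ _).trans (add_le_add (abs_pderiv_le (lipschitz_rescale hε h₂) i x)
      (abs_pderiv_le (lipschitz_rescale hε h₁) i x))
  exact (abs_add_le _ _).trans (add_le_add (h 0) (h 1))

theorem abs_netCharge_add_le (h₁ : LipschitzWith K₁ f₁) (h₂ : LipschitzWith K₂ f₂) (hε : 0 < ε)
    (hG : ∀ x, |f₂ x - f₁ x| ≤ G) {M : Plane → Space} {x : Plane} (hM : ‖M x‖ ≤ 1) :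
    |netCharge f₁ f₂ ε M x + ∑ i : Fin 2, pderiv i (thickness ω f₁ f₂ ε) x * M x i.castSucc| ≤
      4 * (G + K₁ + K₂) := by
  have h : ∀ i : Fin 2, |pderiv i (thickness ω f₁ f₂ ε) x * M x i.castSucc| ≤ G + K₁ + K₂ :=
    fun i => by
      rw [abs_mul, ← mul_one ((G : ℝ) + K₁ + K₂)]
      refine mul_le_mul ?_ ((abs_apply_le_norm_space _ _).trans hM) (abs_nonneg _) (by positivity)
      have := abs_pderiv_le (lipschitz_thickness (ω := ω) h₁ h₂ hε hG) i x
      push_cast at this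
      linarith
  have h0 := abs_netCharge_le h₁ h₂ hε hM
  rw [Fin.sum_univ_two]
  refine (abs_add_le _ _).trans ((add_le_add h0 ((abs_add_le _ _).trans
    (add_le_add (h 0) (h 1)))).trans ?_)
  linarith [G.coe_nonneg]

/-- Away from the boundary the cutoff is locally `1`, so the truncated thickness has the same
gradient as the true one and the two terms cancel. -/
theorem netCharge_add_eq_zero (hb : Bornology.IsBounded ω) (hε : 0 < ε) {M : Plane → Space}
    {x : Plane} (hx : x ∈ ω)
    (h : ∀ y ∈ frontier ω, 2 * ε < dist x y) (hd₁ : DifferentiableAt ℝ (rescale ε f₁) x)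
    (hd₂ : DifferentiableAt ℝ (rescale ε f₂) x) :
    netCharge f₁ f₂ ε M x + ∑ i : Fin 2, pderiv i (thickness ω f₁ f₂ ε) x * M x i.castSucc = 0 := by
  have he : thickness ω f₁ f₂ ε =ᶠ[𝓝 x] fun x => rescale ε f₂ x - rescale ε f₁ x := by
    filter_upwards [cutoff_eventually_eq_one hb hε hx h] with y hy
    rw [thickness, hy, mul_one]
  have e : ∀ i, pderiv i (thickness ω f₁ f₂ ε) x =
      pderiv i (rescale ε f₂) x - pderiv i (rescale ε f₁) x := fun i => by
    rw [pderiv, he.fderiv_eq, fderiv_fun_sub hd₂ hd₁]; rfl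
  simp only [netCharge_eq hε.ne', e, neg_add_cancel]

end Thickness

/-! ### The net charge as a dipole layer plus a small remainder -/

section NetCharge

variable {ω : Set Plane} {f₁ f₂ : Plane → ℝ} {ε : ℝ} {K₁ K₂ G : ℝ≥0} {M : Plane → Space}
  {DM : Fin 2 → Plane → Space}

theorem measurable_graphNormal_apply (f : Plane → ℝ) (p : Fin 3) :
    Measurable fun x => graphNormal f x p := by
  have h := measurable_gradient f
  fin_cases p
  · exact (measurable_pi_apply (0 : Fin 2)).comp ((WithLp.measurable_ofLp 2 _).comp h) |>.neg
  · exact (measurable_pi_apply (1 : Fin 2)).comp ((WithLp.measurable_ofLp 2 _).comp h) |>.neg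
  · exact measurable_const

theorem abs_graphNormal_apply_le {f : Plane → ℝ} {K : ℝ≥0} (hf : LipschitzWith K f) (x : Plane)
    (p : Fin 3) : |graphNormal f x p| ≤ 1 + K := by
  have h : ∀ i, |(∇ f x) i| ≤ 1 + K := fun i => by
    rw [← pderiv_eq_gradient]
    linarith [abs_pderiv_le hf i x]
  fin_cases p
  · change |-(∇ f x) 0| ≤ _
    rw [abs_neg]; exact h 0
  · change |-(∇ f x) 1| ≤ _
    rw [abs_neg]; exact h 1
  · change |(1 : ℝ)| ≤ _
    rw [abs_one]; linarith [K.coe_nonneg]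

theorem integrableOn_of_norm_le (hb : Bornology.IsBounded ω) {u : Plane → ℝ} {C : ℝ}
    (hu : AEStronglyMeasurable u (volume.restrict ω)) (h : ∀ᵐ x ∂(volume.restrict ω), |u x| ≤ C) :
    IntegrableOn u ω := by
  have hfin : IsFiniteMeasure (volume.restrict ω) :=
    ⟨by rw [Measure.restrict_apply_univ]; exact hb.measure_lt_top⟩
  exact Integrable.of_bound hu C h

theorem aestronglyMeasurable_apply (hM : AEStronglyMeasurable M (volume.restrict ω)) (p : Fin 3) :
    AEStronglyMeasurable (fun x => M x p) (volume.restrict ω) :=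
  (EuclideanSpace.proj (𝕜 := ℝ) p).continuous.comp_aestronglyMeasurable hM

theorem aestronglyMeasurable_inner_graphNormal (hM : AEStronglyMeasurable M (volume.restrict ω))
    (f : Plane → ℝ) :
    AEStronglyMeasurable (fun x => inner ℝ (M x) (graphNormal f (ε⁻¹ • x))) (volume.restrict ω) := by
  have h : ∀ p, AEStronglyMeasurable (fun x => M x p * graphNormal f (ε⁻¹ • x) p)
      (volume.restrict ω) := fun p =>
    (aestronglyMeasurable_apply hM p).mul ((measurable_graphNormal_apply f p).comp
      (measurable_const_smul ε⁻¹)).aestronglyMeasurable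
  simp only [inner_space]
  exact ((h 0).add (h 1)).add (h 2)

theorem aestronglyMeasurable_netCharge (hM : AEStronglyMeasurable M (volume.restrict ω)) :
    AEStronglyMeasurable (netCharge f₁ f₂ ε M) (volume.restrict ω) :=
  (aestronglyMeasurable_inner_graphNormal hM f₂).sub (aestronglyMeasurable_inner_graphNormal hM f₁)

theorem integrableOn_netCharge (hb : Bornology.IsBounded ω) (h₁ : LipschitzWith K₁ f₁)
    (h₂ : LipschitzWith K₂ f₂) (hε : 0 < ε) (hM : AEStronglyMeasurable M (volume.restrict ω))
    (hM1 : ∀ᵐ x ∂(volume.restrict ω), ‖M x‖ ≤ 1) : IntegrableOn (netCharge f₁ f₂ ε M) ω :=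
  integrableOn_of_norm_le hb (aestronglyMeasurable_netCharge hM)
    (hM1.mono fun _ hx => abs_netCharge_le h₁ h₂ hε hx)

/-- The product of the truncated thickness and `ψ` is Lipschitz with compact support in `ω`, hence
admissible in the weak derivative of `M`, and no boundary term arises. The remainder consists of the
thickness times the divergence of `M`, and of the charge created by the truncation. -/
theorem isDipoleDecomposition_netCharge (hω : IsOpen ω) (hb : Bornology.IsBounded ω)
    (h₁ : LipschitzWith K₁ f₁) (h₂ : LipschitzWith K₂ f₂) (hε : 0 < ε)
    (hG : ∀ x, |f₂ x - f₁ x| ≤ G) (hM : IsH1With ω M DM)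
    (hM1 : ∀ᵐ x ∂(volume.restrict ω), ‖M x‖ ≤ 1) :
    IsDipoleDecomposition (volume.restrict ω) (netCharge f₁ f₂ ε M)
      (fun i x => thickness ω f₁ f₂ ε x * M x i.castSucc) (netRemainder ω f₁ f₂ ε M DM) := by
  rintro ψ ⟨L, hL⟩ ⟨B, hB⟩ hd
  have hfin : IsFiniteMeasure (volume.restrict ω) :=
    ⟨by rw [Measure.restrict_apply_univ]; exact hb.measure_lt_top⟩
  set w := thickness ω f₁ f₂ ε with hw
  set ρ := netCharge f₁ f₂ ε M
  have hwL : LipschitzWith (G + (K₂ + K₁)) w := lipschitz_thickness h₁ h₂ hε hG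
  lift ε to ℝ≥0 using hε.le
  have hwA : ∀ x, |w x| ≤ ((ε * G : ℝ≥0) : ℝ) := fun x => by
    push_cast; exact abs_thickness_le hε hG x
  lift B to ℝ≥0 using (abs_nonneg _).trans (hB 0)
  have hMi : IntegrableOn M ω := hM.1.integrable (by norm_num)
  have hDi : ∀ i, IntegrableOn (DM i) ω := fun i => (hM.2 i).1.integrable (by norm_num)
  have hMj : ∀ p : Fin 3, IntegrableOn (fun x => M x p) ω := fun p =>
    (EuclideanSpace.proj (𝕜 := ℝ) p).integrable_comp hMi
  have hDj : ∀ i (p : Fin 3), IntegrableOn (fun x => DM i x p) ω := fun i p =>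
    (EuclideanSpace.proj (𝕜 := ℝ) p).integrable_comp (hDi i)
  have ibp := fun i : Fin 2 => (hM.2 i).2.integral_pderiv_mul hω hMi (hDi i) hwL hL hwA hB
    (hasCompactSupport_thickness hb hε) (tsupport_thickness_subset hε) hd i.castSucc
  have i1 : Integrable (fun x => ρ x * ψ x) (volume.restrict ω) :=
    (integrableOn_netCharge hb h₁ h₂ hε hM.1.1 hM1).mul_bdd (c := B)
      hL.continuous.aestronglyMeasurable (Eventually.of_forall hB)
  have i2 : ∀ i : Fin 2, Integrable (fun x => w x * ψ x * DM i x i.castSucc) (volume.restrict ω) :=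
    fun i => (hDj i _).bdd_mul (c := ((ε * G : ℝ≥0) : ℝ) * B)
      (hwL.continuous.mul hL.continuous).aestronglyMeasurable
      (Eventually.of_forall fun x => by
        rw [norm_mul]
        exact mul_le_mul (hwA x) (hB x) (norm_nonneg _) (NNReal.coe_nonneg _))
  have i3 : ∀ i : Fin 2, Integrable (fun x => pderiv i w x * ψ x * M x i.castSucc)
      (volume.restrict ω) := fun i => by
    refine (hMj _).bdd_mul (c := ((G + (K₂ + K₁) : ℝ≥0) : ℝ) * B) ?_ (Eventually.of_forall fun x => ?_)
    · exact ((measurable_pderiv i w).mul hL.continuous.measurable).aestronglyMeasurable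
    · rw [norm_mul]
      exact mul_le_mul (abs_pderiv_le hwL i x) (hB x) (norm_nonneg _) (NNReal.coe_nonneg _)
  have e : ∀ x, netRemainder ω f₁ f₂ ε M DM x * ψ x =
      ρ x * ψ x + ∑ i : Fin 2, (w x * ψ x * DM i x i.castSucc + pderiv i w x * ψ x * M x i.castSucc) :=
    fun x => by
      rw [netRemainder, Fin.sum_univ_two, Fin.sum_univ_two, Fin.sum_univ_two]; ring
  have i4 : ∀ i : Fin 2, Integrable (fun x => w x * ψ x * DM i x i.castSucc +
      pderiv i w x * ψ x * M x i.castSucc) (volume.restrict ω) := fun i => (i2 i).add (i3 i)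
  simp only [e]
  rw [integral_add i1 (integrable_finsetSum _ fun i _ => i4 i),
    integral_finsetSum _ fun i _ => i4 i]
  have e2 : ∀ i : Fin 2, ∫ x in ω, (w x * ψ x * DM i x i.castSucc + pderiv i w x * ψ x * M x i.castSucc)
      = -∫ x in ω, w x * M x i.castSucc * pderiv i ψ x := fun i => by
    rw [integral_add (i2 i) (i3 i), ibp i]
    simp only [mul_right_comm (w _) (M _ _)]
    ring
  simp only [e2, Finset.sum_neg_distrib]
  ring

/-- The points within distance `2 ε` of the boundary of `ω`. -/
def tube (ω : Set Plane) (ε : ℝ) : Set Plane :=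
  toMeasurable volume {x | ∃ y ∈ frontier ω, dist x y ≤ 2 * ε}

theorem abs_netRemainder_le (hω : IsOpen ω) (hb : Bornology.IsBounded ω)
    (h₁ : LipschitzWith K₁ f₁) (h₂ : LipschitzWith K₂ f₂) (hε : 0 < ε)
    (hG : ∀ x, |f₂ x - f₁ x| ≤ G) (hM1 : ∀ᵐ x ∂(volume.restrict ω), ‖M x‖ ≤ 1) :
    ∀ᵐ x ∂(volume.restrict ω), |netRemainder ω f₁ f₂ ε M DM x| ≤
      ε * G * (‖DM 0 x‖ + ‖DM 1 x‖) + (tube ω ε).indicator (fun _ => 4 * (G + K₁ + K₂ : ℝ)) x := by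
  filter_upwards [hM1, ae_restrict_mem hω.measurableSet,
    ae_restrict_of_ae (lipschitz_rescale hε h₁).ae_differentiableAt,
    ae_restrict_of_ae (lipschitz_rescale hε h₂).ae_differentiableAt] with x hx hxω hd₁ hd₂
  rw [netRemainder]
  refine (abs_add_le _ _).trans (add_le_add ?_ ?_)
  · rw [abs_mul]
    refine mul_le_mul (abs_thickness_le hε hG x) ?_ (abs_nonneg _) (by positivity)
    rw [Fin.sum_univ_two]
    exact (abs_add_le _ _).trans (add_le_add (abs_apply_le_norm_space _ _)
      (abs_apply_le_norm_space _ _))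
  · by_cases ht : x ∈ tube ω ε
    · rw [indicator_of_mem ht]
      exact abs_netCharge_add_le h₁ h₂ hε hG hx
    · rw [indicator_of_notMem ht, netCharge_add_eq_zero hb hε hxω _ hd₁ hd₂, abs_zero]
      intro y hy
      by_contra hc
      exact ht (subset_toMeasurable _ _ ⟨y, hy, not_lt.mp hc⟩)

theorem aestronglyMeasurable_netRemainder (h₁ : LipschitzWith K₁ f₁) (h₂ : LipschitzWith K₂ f₂)
    (hε : 0 < ε) (hG : ∀ x, |f₂ x - f₁ x| ≤ G) (hM : IsH1With ω M DM) :
    AEStronglyMeasurable (netRemainder ω f₁ f₂ ε M DM) (volume.restrict ω) := by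
  have hw := (lipschitz_thickness (ω := ω) h₁ h₂ hε hG).continuous
  unfold netRemainder
  simp only [Fin.sum_univ_two]
  refine (hw.aestronglyMeasurable.mul ((aestronglyMeasurable_apply (hM.2 0).1.1 _).add
    (aestronglyMeasurable_apply (hM.2 1).1.1 _))).add ((aestronglyMeasurable_netCharge hM.1.1).add
    (.add ?_ ?_)) <;>
  exact (measurable_pderiv _ _).aestronglyMeasurable.mul (aestronglyMeasurable_apply hM.1.1 _)

end NetCharge

/-! ### Mass and potentials of the dipole layer and of the remainder -/

section Estimates

variable {ω : Set Plane} {ε : ℝ}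

theorem measureReal_tube_inter_le {Ct : ℝ} (hCt0 : 0 ≤ Ct) (hε : 0 < ε)
    (hCt : volume {x | ∃ y ∈ frontier ω, dist x y ≤ 2 * ε} ≤ ENNReal.ofReal (Ct * ε)) :
    volume.real (tube ω ε ∩ ω) ≤ Ct * ε := by
  refine ENNReal.toReal_le_of_le_ofReal (by positivity) ?_
  refine (measure_mono inter_subset_left).trans ?_
  rw [tube, measure_toMeasurable]
  exact hCt

/-- The threshold `T = 1/√ε` balances the mass `O(ε)` of the tube against the tail `discArea / T`.
-/
theorem setIntegral_tube_inv_dist_le (hb : Bornology.IsBounded ω) {Ct : ℝ}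
    (hCt0 : 0 ≤ Ct) (hε : 0 < ε)
    (hCt : volume {x | ∃ y ∈ frontier ω, dist x y ≤ 2 * ε} ≤ ENNReal.ofReal (Ct * ε)) (y : Plane) :
    IntegrableOn (fun x => 1 / ‖x - y‖) (tube ω ε ∩ ω) ∧
    ∫ x in tube ω ε ∩ ω, 1 / ‖x - y‖ ≤ (Ct + discArea) * √ε := by
  have hfin : IsFiniteMeasure (volume.restrict (tube ω ε ∩ ω)) :=
    ⟨by
      rw [Measure.restrict_apply_univ]
      exact (hb.subset inter_subset_right).measure_lt_top⟩
  have hq : QuadraticGrowth (volume.restrict (tube ω ε ∩ ω)) discArea :=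
    quadraticGrowth_volume.mono Measure.restrict_le_self
  refine ⟨hq.integrable_inv_dist discArea_nonneg y, ?_⟩
  have hs : 0 < √ε := Real.sqrt_pos.mpr hε
  have hss : √ε * √ε = ε := Real.mul_self_sqrt hε.le
  refine (hq.integral_inv_dist_le discArea_nonneg y (inv_pos.mpr hs)).trans ?_
  have h := measureReal_tube_inter_le hCt0 hε hCt
  rw [measureReal_restrict_apply_univ]
  calc (√ε)⁻¹ * volume.real (tube ω ε ∩ ω) + discArea / (√ε)⁻¹
      ≤ (√ε)⁻¹ * (Ct * ε) + discArea / (√ε)⁻¹ := by gcongr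
    _ = _ := by
      nth_rewrite 2 [← hss]
      field_simp

theorem integral_mul_dker_le (hε : 0 < ε) {p : Plane → ℝ}
    {A Cs : ℝ} (hA : 0 ≤ A) (hp : ∀ᵐ x ∂(volume.restrict ω), |p x| ≤ ε * A) {y : Plane}
    (hCs : IntegrableOn (fun x => 1 / (‖x - y‖ ^ 2 + ε ^ 2)) ω ∧
      ∫ x in ω, 1 / (‖x - y‖ ^ 2 + ε ^ 2) ≤ Cs / √ε) (i : Fin 2) :
    ∫ x in ω, |p x * dker ε i (x - y)| ≤ A * Cs * √ε := by
  have hs : 0 < √ε := Real.sqrt_pos.mpr hε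
  have hss : √ε * √ε = ε := Real.mul_self_sqrt hε.le
  calc ∫ x in ω, |p x * dker ε i (x - y)| ≤ ∫ x in ω, ε * A * (1 / (‖x - y‖ ^ 2 + ε ^ 2)) := by
        refine integral_mono_of_nonneg (Eventually.of_forall fun x => abs_nonneg _)
          (hCs.1.const_mul _) ?_
        filter_upwards [hp] with x hx
        rw [abs_mul]
        exact mul_le_mul hx (abs_dker_le hε i _) (abs_nonneg _) (by positivity)
    _ ≤ ε * A * (Cs / √ε) := by
        rw [integral_const_mul]
        gcongr
        exact hCs.2
    _ = _ := by
        nth_rewrite 1 [← hss]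
        field_simp

/-- The derivatives are only square integrable, so `‖D‖ ker ≤ (‖D‖² + ker²) / 2` is used; `ker²` is
the borderline kernel, whose integral is at most `Cs/√ε`. On the tube the charge is bounded and
`ker` is compared with `1/‖x - y‖`. -/
theorem integral_remainder_ker_le (hb : Bornology.IsBounded ω) (hε : 0 < ε)
    (hε1 : ε ≤ 1) {c : Plane → ℝ} {D : Fin 2 → Plane → Space}
    (hD : ∀ i, MemLp (D i) 2 (volume.restrict ω)) {A H Ct Cs E : ℝ} (hA : 0 ≤ A) (hH : 0 ≤ H)
    (hCt0 : 0 ≤ Ct) (hE : ∀ i, ∫ x in ω, ‖D i x‖ ^ 2 ≤ E)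
    (hc : ∀ᵐ x ∂(volume.restrict ω), |c x| ≤
      ε * A * (‖D 0 x‖ + ‖D 1 x‖) + (tube ω ε).indicator (fun _ => H) x)
    (hCt : volume {x | ∃ y ∈ frontier ω, dist x y ≤ 2 * ε} ≤ ENNReal.ofReal (Ct * ε)) {y : Plane}
    (hCs : IntegrableOn (fun x => 1 / (‖x - y‖ ^ 2 + ε ^ 2)) ω ∧
      ∫ x in ω, 1 / (‖x - y‖ ^ 2 + ε ^ 2) ≤ Cs / √ε) :
    ∫ x in ω, |c x * ker ε (x - y)| ≤ (A * E + A * Cs + H * (Ct + discArea)) * √ε := by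
  have hs : 0 < √ε := Real.sqrt_pos.mpr hε
  have hss : √ε * √ε = ε := Real.mul_self_sqrt hε.le
  have hs1 : √ε ≤ 1 := Real.sqrt_le_one.mpr hε1
  have hE0 : 0 ≤ E := (integral_nonneg fun x => by positivity).trans (hE 0)
  have hDi : ∀ i, IntegrableOn (fun x => ‖D i x‖ ^ 2) ω := fun i => (hD i).norm.integrable_sq
  have hti := setIntegral_tube_inv_dist_le hb hCt0 hε hCt y
  have hmt : MeasurableSet (tube ω ε) := measurableSet_toMeasurable _ _
  have hInt : IntegrableOn ((tube ω ε).indicator fun x => 1 / ‖x - y‖) ω := by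
    rw [integrableOn_indicator_iff hmt]; exact hti.1
  have hind : ∫ x in ω, (tube ω ε).indicator (fun x => 1 / ‖x - y‖) x ≤ (Ct + discArea) * √ε := by
    rw [setIntegral_indicator hmt, inter_comm]; exact hti.2
  have hI2 : IntegrableOn (fun x => ‖D 0 x‖ ^ 2 / 2 + ‖D 1 x‖ ^ 2 / 2) ω :=
    ((hDi 0).div_const 2).add ((hDi 1).div_const 2)
  have hI : IntegrableOn (fun x => ‖D 0 x‖ ^ 2 / 2 + ‖D 1 x‖ ^ 2 / 2 + 1 / (‖x - y‖ ^ 2 + ε ^ 2)) ω :=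
    hI2.add hCs.1
  calc ∫ x in ω, |c x * ker ε (x - y)|
      ≤ ∫ x in ω, (ε * A * (‖D 0 x‖ ^ 2 / 2 + ‖D 1 x‖ ^ 2 / 2 + 1 / (‖x - y‖ ^ 2 + ε ^ 2)) +
          H * (tube ω ε).indicator (fun x => 1 / ‖x - y‖) x) := by
        refine integral_mono_of_nonneg (Eventually.of_forall fun x => abs_nonneg _)
          ((hI.const_mul _).add (hInt.const_mul _)) ?_
        have hne : ∀ᵐ x ∂(volume.restrict ω), x ≠ y :=
          ae_restrict_of_ae (measure_eq_zero_iff_ae_notMem.mp (measure_singleton y))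
        filter_upwards [hc, hne] with x hx hxy
        have hk := ker_nonneg ε (x - y)
        rw [abs_mul, abs_of_nonneg hk]
        refine (mul_le_mul_of_nonneg_right hx hk).trans ?_
        rw [add_mul]
        refine add_le_add ?_ ?_
        · rw [mul_assoc, ← ker_sq]
          gcongr
          nlinarith [sq_nonneg (‖D 0 x‖ - ker ε (x - y)), sq_nonneg (‖D 1 x‖ - ker ε (x - y))]
        · by_cases ht : x ∈ tube ω ε
          · rw [indicator_of_mem ht, indicator_of_mem ht]
            gcongr
            exact ker_le_inv_norm ε (sub_ne_zero.mpr hxy)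
          · rw [indicator_of_notMem ht, indicator_of_notMem ht, zero_mul, mul_zero]
    _ = ε * A * ((∫ x in ω, ‖D 0 x‖ ^ 2) / 2 + (∫ x in ω, ‖D 1 x‖ ^ 2) / 2 +
          ∫ x in ω, 1 / (‖x - y‖ ^ 2 + ε ^ 2)) +
          H * ∫ x in ω, (tube ω ε).indicator (fun x => 1 / ‖x - y‖) x := by
        rw [integral_add (hI.const_mul _) (hInt.const_mul _), integral_const_mul,
          integral_const_mul, integral_add hI2 hCs.1,
          integral_add ((hDi 0).div_const 2) ((hDi 1).div_const 2), integral_div, integral_div]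
    _ ≤ ε * A * (E / 2 + E / 2 + Cs / √ε) + H * ((Ct + discArea) * √ε) := by
        gcongr
        · exact hE 0
        · exact hE 1
        · exact hCs.2
    _ ≤ _ := by
        have h1 : √ε * √ε * (A * E) ≤ √ε * 1 * (A * E) := by gcongr
        have h2 : ε * (Cs / √ε) = √ε * Cs := by nth_rewrite 1 [← hss]; field_simp
        rw [hss] at h1
        linear_combination h1 + A * h2

theorem integral_remainder_le (hb : Bornology.IsBounded ω) (hε : 0 < ε)
    {c : Plane → ℝ} {D : Fin 2 → Plane → Space}
    (hD : ∀ i, MemLp (D i) 2 (volume.restrict ω)) {A H Ct E : ℝ} (hA : 0 ≤ A) (hH : 0 ≤ H)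
    (hCt0 : 0 ≤ Ct) (hE : ∀ i, ∫ x in ω, ‖D i x‖ ^ 2 ≤ E)
    (hcm : AEStronglyMeasurable c (volume.restrict ω))
    (hc : ∀ᵐ x ∂(volume.restrict ω), |c x| ≤
      ε * A * (‖D 0 x‖ + ‖D 1 x‖) + (tube ω ε).indicator (fun _ => H) x)
    (hCt : volume {x | ∃ y ∈ frontier ω, dist x y ≤ 2 * ε} ≤ ENNReal.ofReal (Ct * ε)) :
    IntegrableOn c ω ∧ ∫ x in ω, |c x| ≤ (A * (volume.real ω + E) + H * Ct) * ε := by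
  have hfin : IsFiniteMeasure (volume.restrict ω) :=
    ⟨by rw [Measure.restrict_apply_univ]; exact hb.measure_lt_top⟩
  have hDi : ∀ i, IntegrableOn (fun x => ‖D i x‖ ^ 2) ω := fun i => (hD i).norm.integrable_sq
  have hmt : MeasurableSet (tube ω ε) := measurableSet_toMeasurable _ _
  have hInt : IntegrableOn ((tube ω ε).indicator fun _ => H) ω :=
    (integrable_const H).indicator hmt
  have hI2 : IntegrableOn (fun x => ‖D 0 x‖ ^ 2 / 2 + ‖D 1 x‖ ^ 2 / 2) ω :=
    ((hDi 0).div_const 2).add ((hDi 1).div_const 2)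
  have hI : IntegrableOn (fun x => ‖D 0 x‖ ^ 2 / 2 + ‖D 1 x‖ ^ 2 / 2 + 1) ω :=
    hI2.add (integrable_const 1)
  have hle : ∀ᵐ x ∂(volume.restrict ω), |c x| ≤
      ε * A * (‖D 0 x‖ ^ 2 / 2 + ‖D 1 x‖ ^ 2 / 2 + 1) + (tube ω ε).indicator (fun _ => H) x := by
    filter_upwards [hc] with x hx
    refine hx.trans (add_le_add ?_ le_rfl)
    refine mul_le_mul_of_nonneg_left ?_ (by positivity)
    nlinarith [sq_nonneg (‖D 0 x‖ - 1), sq_nonneg (‖D 1 x‖ - 1)]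
  refine ⟨((hI.const_mul _).add hInt).mono' hcm hle, ?_⟩
  calc ∫ x in ω, |c x| ≤ ∫ x in ω, (ε * A * (‖D 0 x‖ ^ 2 / 2 + ‖D 1 x‖ ^ 2 / 2 + 1) +
        (tube ω ε).indicator (fun _ => H) x) :=
        integral_mono_of_nonneg (Eventually.of_forall fun x => abs_nonneg _)
          ((hI.const_mul _).add hInt) hle
    _ = ε * A * ((∫ x in ω, ‖D 0 x‖ ^ 2) / 2 + (∫ x in ω, ‖D 1 x‖ ^ 2) / 2 + volume.real ω) +
          volume.real (tube ω ε ∩ ω) * H := by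
        rw [integral_add (hI.const_mul _) hInt, integral_const_mul,
          integral_add hI2 (integrable_const 1),
          integral_add ((hDi 0).div_const 2) ((hDi 1).div_const 2), integral_div, integral_div,
          setIntegral_indicator hmt, setIntegral_const, setIntegral_const, smul_eq_mul, smul_eq_mul,
          mul_one, inter_comm]
    _ ≤ ε * A * (E / 2 + E / 2 + volume.real ω) + Ct * ε * H := by
        gcongr
        · exact hE 0
        · exact hE 1
        · exact measureReal_tube_inter_le hCt0 hε hCt
    _ = _ := by ring

end Estimates

/-- The dipole layer has density `O(ε)` and potential `O(√ε)`; the remainder has mass `O(ε)` and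
potential `O(√ε)`. The constant depends on the map only through the bound `E` on its derivatives.
The potential bound includes boundary points because it is later evaluated below the lateral face.
-/
theorem exists_netCharge_estimates {ω : Set Plane} (hω : IsOpen ω) (hb : Bornology.IsBounded ω)
    (hl : HasLipschitzBoundary ω) {f₁ f₂ : Plane → ℝ} {K₁ K₂ G : ℝ≥0} (h₁ : LipschitzWith K₁ f₁)
    (h₂ : LipschitzWith K₂ f₂) (hG : ∀ x, |f₂ x - f₁ x| ≤ G) (E : ℝ) :
    ∃ C : ℝ, ∀ ε, 0 < ε → ε ≤ 1 → ∀ (M : Plane → Space) (DM : Fin 2 → Plane → Space),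
      IsH1With ω M DM → (∀ᵐ x ∂(volume.restrict ω), ‖M x‖ ≤ 1) →
      (∀ i, ∫ x in ω, ‖DM i x‖ ^ 2 ≤ E) →
      (∀ y ∈ closure ω, |∫ x in ω, netCharge f₁ f₂ ε M x * ker ε (x - y)| ≤ C * √ε) ∧
      |(∫ x in ω, netCharge f₁ f₂ ε M x * ∫ y in ω, netCharge f₁ f₂ ε M y * ker ε (y - x)) -
        ∑ i : Fin 2, ∑ j : Fin 2, ∫ x in ω, thickness ω f₁ f₂ ε x * M x i.castSucc *
          ∫ y in ω, thickness ω f₁ f₂ ε y * M y j.castSucc * ddker ε i j (y - x)| ≤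
        C * (ε * √ε) := by
  obtain ⟨Cs, hCs0, hCs⟩ := exists_integral_inv_sq_le (Metric.diam (closure ω))
  obtain ⟨cc⟩ := exists_curveCover hb hl
  obtain ⟨Ct, hCt0, hCt⟩ := exists_volume_tube_le cc
  set H : ℝ := 4 * (G + K₁ + K₂) with hH
  have hH0 : 0 ≤ H := by positivity
  -- For negative `E` no map satisfies the bound on the derivatives, and any constant will do.
  by_cases hE0 : 0 ≤ E
  swap
  · refine ⟨0, fun ε hε hε1 M DM hM hM1 hE => ?_⟩
    exact absurd ((integral_nonneg fun x => by positivity).trans (hE 0)) hE0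
  set A : ℝ := G * E + G * Cs + H * (Ct + discArea) with hA
  set N : ℝ := G * (volume.real ω + E) + H * Ct with hN
  have hd0 := discArea_nonneg
  have hA0 : 0 ≤ A := by positivity
  have hN0 : 0 ≤ N := by positivity
  refine ⟨4 * (G * Cs) + A + N * (4 * (G * Cs) + A), fun ε hε hε1 M DM hM hM1 hE => ?_⟩
  have hs : 0 < √ε := Real.sqrt_pos.mpr hε
  have hball : ∀ y ∈ closure ω, ω ⊆ Metric.closedBall y (Metric.diam (closure ω)) :=
    fun y hy x hx => Metric.dist_le_diam_of_mem hb.closure (subset_closure hx) hy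
  have hCsy := fun y hy => hCs ε hε hε1 y ω hω.measurableSet (hball y hy)
  have hdec := isDipoleDecomposition_netCharge hω hb h₁ h₂ hε hG hM hM1
  have hrem := abs_netRemainder_le (DM := DM) hω hb h₁ h₂ hε hG hM1
  have hpb : ∀ i : Fin 2, ∀ᵐ x ∂(volume.restrict ω),
      |thickness ω f₁ f₂ ε x * M x i.castSucc| ≤ ε * G := fun i => by
    filter_upwards [hM1] with x hx
    rw [abs_mul, ← mul_one (ε * (G : ℝ))]
    exact mul_le_mul (abs_thickness_le hε hG x) ((abs_apply_le_norm_space _ _).trans hx)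
      (abs_nonneg _) (by positivity)
  have hpi : ∀ i : Fin 2, IntegrableOn (fun x => thickness ω f₁ f₂ ε x * M x i.castSucc) ω :=
    fun i => integrableOn_of_norm_le hb ((lipschitz_thickness h₁ h₂ hε
      hG).continuous.aestronglyMeasurable.mul (aestronglyMeasurable_apply hM.1.1 _)) (hpb i)
  have hS : ∀ y ∈ closure ω, ∀ i : Fin 2,
      ∫ x in ω, |thickness ω f₁ f₂ ε x * M x i.castSucc * dker ε i (x - y)| ≤ G * Cs * √ε :=
    fun y hy i => integral_mul_dker_le hε G.2 (hpb i) (hCsy y hy) i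
  have hT : ∀ y ∈ closure ω,
      ∫ x in ω, |netRemainder ω f₁ f₂ ε M DM x * ker ε (x - y)| ≤ A * √ε := fun y hy =>
    integral_remainder_ker_le hb hε hε1 (fun i => (hM.2 i).1) G.2 hH0 hCt0 hE hrem (hCt ε hε hε1)
      (hCsy y hy)
  obtain ⟨hci, hcN⟩ := integral_remainder_le hb hε (fun i => (hM.2 i).1) G.2 hH0 hCt0 hE
    (aestronglyMeasurable_netRemainder h₁ h₂ hε hG hM) hrem (hCt ε hε hε1)
  constructor
  · intro y hy
    refine (hdec.abs_potential_le hε (hS y hy) (hT y hy)).trans ?_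
    have h1 : 0 ≤ G * Cs * √ε := by positivity
    have h2 : 0 ≤ N * (4 * (G * Cs) + A) * √ε := by positivity
    linarith
  · have hmem : ∀ᵐ y ∂(volume.restrict ω), y ∈ closure ω :=
      (ae_restrict_mem hω.measurableSet).mono fun y hy => subset_closure hy
    refine (hdec.abs_energy_sub_le hε (integrableOn_netCharge hb h₁ h₂ hε hM.1.1 hM1) hci hpi
      (S := G * Cs * √ε) (T := A * √ε) (N := N * ε) (by positivity) (by positivity) (hmem.mono hS)
      (hmem.mono hT) hcN).trans ?_
    have h1 : 0 ≤ (4 * (G * Cs) + A) * (ε * √ε) := by positivity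
    linear_combination h1

/-! ### Limits of interaction energies at the scale of the roughness -/

/-- `u ε → u₀` in `L¹(ω)` with all functions bounded by `1`. -/
structure BoundedTendsto (ω : Set Plane) (u : ℝ → Plane → ℝ) (u₀ : Plane → ℝ) : Prop where
  meas : ∀ᶠ ε in 𝓝[>] 0, AEStronglyMeasurable (u ε) (volume.restrict ω)
  bound : ∀ᶠ ε in 𝓝[>] 0, ∀ᵐ x ∂(volume.restrict ω), |u ε x| ≤ 1
  meas_lim : AEStronglyMeasurable u₀ (volume.restrict ω)
  bound_lim : ∀ᵐ x ∂(volume.restrict ω), |u₀ x| ≤ 1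
  tendsto : Tendsto (fun ε => ∫ x in ω, |u ε x - u₀ x|) (𝓝[>] 0) (𝓝 0)

section Scale

variable {ω : Set Plane} {ε : ℝ}

theorem ae_abs_indicator_le {u : Plane → ℝ} (hω : MeasurableSet ω)
    (h : ∀ᵐ x ∂(volume.restrict ω), |u x| ≤ 1) : ∀ᵐ x, |ω.indicator u x| ≤ 1 := by
  filter_upwards [(ae_restrict_iff' hω).mp h] with x hx
  by_cases hxω : x ∈ ω
  · rw [indicator_of_mem hxω]; exact hx hxω
  · rw [indicator_of_notMem hxω, abs_zero]; exact zero_le_one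

theorem integral_abs_indicator_sub (hω : MeasurableSet ω) (u v : Plane → ℝ) :
    ∫ x, |ω.indicator u x - ω.indicator v x| = ∫ x in ω, |u x - v x| := by
  rw [← integral_indicator hω]
  congr 1 with x
  by_cases hx : x ∈ ω <;> simp [hx]

/-- Substitution `y = x + εz`, with Jacobian `ε²`; the indicators keep track of the domain. -/
theorem integral_integral_scale (hω : MeasurableSet ω) (hε : 0 < ε) (a : Plane → Plane → ℝ)
    (u v : Plane → ℝ) :
    ∫ x in ω, u x * ∫ y in ω, v y * a (ε⁻¹ • x) (ε⁻¹ • (y - x)) =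
      ε ^ 2 * ∫ x, ∫ z, a (ε⁻¹ • x) z * (ω.indicator u x * ω.indicator v (x + ε • z)) := by
  rw [← integral_const_mul, ← integral_indicator hω]
  congr 1 with x
  rw [← integral_comp_scale hε _ x]
  by_cases hx : x ∈ ω
  · rw [indicator_of_mem hx, ← integral_indicator hω, ← integral_const_mul]
    congr 1 with y
    rw [smul_smul, mul_inv_cancel₀ hε.ne', one_smul, add_sub_cancel, indicator_of_mem hx]
    by_cases hy : y ∈ ω
    · rw [indicator_of_mem hy, indicator_of_mem hy]; ring
    · rw [indicator_of_notMem hy, indicator_of_notMem hy]; ring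
  · simp [hx]

theorem tendsto_integral_scale (hω : MeasurableSet ω) (hb : Bornology.IsBounded ω)
    {a : Plane → Plane → ℝ}
    (ham : Measurable (Function.uncurry a)) (hap : ∀ z, IsCellPeriodic fun x => a x z)
    {Φ : Plane → ℝ} (hΦ : Integrable Φ) (haΦ : ∀ x z, |a x z| ≤ Φ z)
    {u v : ℝ → Plane → ℝ} {u₀ v₀ : Plane → ℝ} (hu : BoundedTendsto ω u u₀)
    (hv : BoundedTendsto ω v v₀) :
    Tendsto (fun ε : ℝ => ε⁻¹ ^ 2 *
        ∫ x in ω, u ε x * ∫ y in ω, v ε y * a (ε⁻¹ • x) (ε⁻¹ • (y - x))) (𝓝[>] 0)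
      (𝓝 ((∫ x in unitCell, ∫ z, a x z) * ∫ x in ω, u₀ x * v₀ x)) := by
  have hInt : ∀ {w : Plane → ℝ}, AEStronglyMeasurable w (volume.restrict ω) →
      (∀ᵐ x ∂(volume.restrict ω), |w x| ≤ 1) → Integrable (ω.indicator w) := fun hm h =>
    (integrable_indicator_iff hω).mpr (integrableOn_of_norm_le hb hm h)
  have h := tendsto_integral_homogenization ham hap hΦ haΦ (u := fun ε => ω.indicator (u ε))
    (v := fun ε => ω.indicator (v ε)) (u₀ := ω.indicator u₀) (v₀ := ω.indicator v₀)
    (by filter_upwards [hu.meas, hu.bound] with ε h1 h2 using hInt h1 h2)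
    (by filter_upwards [hv.meas, hv.bound] with ε h1 h2 using hInt h1 h2)
    (hInt hu.meas_lim hu.bound_lim) (hInt hv.meas_lim hv.bound_lim)
    (hv.bound.mono fun ε h => ae_abs_indicator_le hω h) (ae_abs_indicator_le hω hu.bound_lim)
    (by simpa only [integral_abs_indicator_sub hω] using hu.tendsto)
    (by simpa only [integral_abs_indicator_sub hω] using hv.tendsto)
  have e : ∫ x, ω.indicator u₀ x * ω.indicator v₀ x = ∫ x in ω, u₀ x * v₀ x := by
    rw [← integral_indicator hω]
    congr 1 with x
    by_cases hx : x ∈ ω <;> simp [hx]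
  rw [e] at h
  refine h.congr' ?_
  filter_upwards [self_mem_nhdsWithin] with ε hε
  have hε0 : (0 : ℝ) < ε := hε
  rw [integral_integral_scale hω hε0, ← mul_assoc, ← mul_pow, inv_mul_cancel₀ hε0.ne', one_pow,
    one_mul]

theorem boundedTendsto_apply {M : ℝ → Plane → Space} {m : Plane → Space}
    (hM : ∀ ε > 0, MemLp (M ε) 2 (volume.restrict ω)) (hm : MemLp m 2 (volume.restrict ω))
    (hM1 : ∀ ε > 0, ∀ᵐ x ∂(volume.restrict ω), ‖M ε x‖ ≤ 1)
    (hm1 : ∀ᵐ x ∂(volume.restrict ω), ‖m x‖ ≤ 1) (hb : Bornology.IsBounded ω)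
    (h : Tendsto (fun ε => ∫ x in ω, ‖M ε x - m x‖) (𝓝[>] 0) (𝓝 0)) (p : Fin 3) :
    BoundedTendsto ω (fun ε x => M ε x p) fun x => m x p := by
  have hfin : IsFiniteMeasure (volume.restrict ω) :=
    ⟨by rw [Measure.restrict_apply_univ]; exact hb.measure_lt_top⟩
  refine ⟨?_, ?_, aestronglyMeasurable_apply hm.1 p,
    hm1.mono fun x hx => (abs_apply_le_norm_space _ _).trans hx, ?_⟩
  · filter_upwards [self_mem_nhdsWithin] with ε hε using aestronglyMeasurable_apply (hM ε hε).1 p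
  · filter_upwards [self_mem_nhdsWithin] with ε hε
    exact (hM1 ε hε).mono fun x hx => (abs_apply_le_norm_space _ _).trans hx
  · refine squeeze_zero' (Eventually.of_forall fun ε => integral_nonneg fun x => abs_nonneg _) ?_ h
    filter_upwards [self_mem_nhdsWithin] with ε hε
    refine integral_mono_of_nonneg (Eventually.of_forall fun x => abs_nonneg _)
      (((hM ε hε).sub hm).integrable (by norm_num)).norm (Eventually.of_forall fun x => ?_)
    exact abs_apply_le_norm_space (M ε x - m x) p

/-- The cutoff differs from `1` only on a tube of area `O(ε)`, where everything is bounded. -/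
theorem BoundedTendsto.cutoff_mul (hω : IsOpen ω) (hb : Bornology.IsBounded ω)
    (hl : HasLipschitzBoundary ω) {u : ℝ → Plane → ℝ} {u₀ : Plane → ℝ}
    (h : BoundedTendsto ω u u₀) : BoundedTendsto ω (fun ε x => cutoff ω ε x * u ε x) u₀ := by
  have hfin : IsFiniteMeasure (volume.restrict ω) :=
    ⟨by rw [Measure.restrict_apply_univ]; exact hb.measure_lt_top⟩
  obtain ⟨cc⟩ := exists_curveCover hb hl
  obtain ⟨Ct, hCt0, hCt⟩ := exists_volume_tube_le cc
  have hle1 : ∀ᶠ ε : ℝ in 𝓝[>] 0, ε ≤ 1 :=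
    (eventually_le_nhds zero_lt_one).filter_mono nhdsWithin_le_nhds
  refine ⟨?_, ?_, h.meas_lim, h.bound_lim, ?_⟩
  · filter_upwards [h.meas, self_mem_nhdsWithin] with ε hm hε
    have hc : Continuous (cutoff ω ε) := by
      have hε0 : (0 : ℝ) < ε := hε
      lift ε to ℝ≥0 using hε0.le
      exact (lipschitz_cutoff ω ε).continuous
    exact hc.aestronglyMeasurable.mul hm
  · filter_upwards [h.bound] with ε hε
    filter_upwards [hε] with x hx
    rw [abs_mul]
    exact mul_le_one₀ (abs_cutoff_le_one ω ε x) (abs_nonneg _) hx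
  · have hlim : Tendsto (fun ε => (∫ x in ω, |u ε x - u₀ x|) + Ct * ε) (𝓝[>] 0) (𝓝 0) := by
      have h2 : Tendsto (fun ε : ℝ => Ct * ε) (𝓝[>] 0) (𝓝 0) := by
        have : Tendsto (fun ε : ℝ => Ct * ε) (𝓝 0) (𝓝 (Ct * 0)) := tendsto_id.const_mul Ct
        rw [mul_zero] at this
        exact this.mono_left nhdsWithin_le_nhds
      simpa using h.tendsto.add h2
    refine squeeze_zero' (Eventually.of_forall fun ε => integral_nonneg fun x => abs_nonneg _) ?_
      hlim
    filter_upwards [h.meas, h.bound, self_mem_nhdsWithin, hle1] with ε hm hbd hε hε1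
    have hε0 : (0 : ℝ) < ε := hε
    have hmt : MeasurableSet (tube ω ε) := measurableSet_toMeasurable _ _
    have i1 : IntegrableOn (fun x => |u ε x - u₀ x|) ω :=
      ((integrableOn_of_norm_le hb hm hbd).sub
        (integrableOn_of_norm_le hb h.meas_lim h.bound_lim)).abs
    have i2 : IntegrableOn ((tube ω ε).indicator fun _ => (1 : ℝ)) ω :=
      (integrable_const 1).indicator hmt
    calc ∫ x in ω, |cutoff ω ε x * u ε x - u₀ x|
        ≤ ∫ x in ω, (|u ε x - u₀ x| + (tube ω ε).indicator (fun _ => 1) x) := by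
          refine integral_mono_of_nonneg (Eventually.of_forall fun x => abs_nonneg _) (i1.add i2) ?_
          filter_upwards [hbd, ae_restrict_mem hω.measurableSet] with x hx hxω
          by_cases ht : x ∈ tube ω ε
          · rw [indicator_of_mem ht]
            have e : cutoff ω ε x * u ε x - u₀ x =
              u ε x - u₀ x + -((1 - cutoff ω ε x) * u ε x) := by ring
            rw [e]
            refine (abs_add_le _ _).trans (add_le_add le_rfl ?_)
            rw [abs_neg, abs_mul]
            refine mul_le_one₀ ?_ (abs_nonneg _) hx
            rw [abs_le]
            constructor <;> linarith [cutoff_nonneg ω ε x, cutoff_le_one ω ε x]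
          · rw [indicator_of_notMem ht, (cutoff_eventually_eq_one hb hε0 hxω ?_).self_of_nhds,
              one_mul, add_zero]
            intro y hy
            by_contra hc
            exact ht (subset_toMeasurable _ _ ⟨y, hy, not_lt.mp hc⟩)
      _ = (∫ x in ω, |u ε x - u₀ x|) + volume.real (tube ω ε ∩ ω) := by
          rw [integral_add i1 i2, setIntegral_indicator hmt, setIntegral_const, smul_eq_mul, mul_one,
            inter_comm]
      _ ≤ _ := by
          gcongr
          exact measureReal_tube_inter_le hCt0 hε0 (hCt ε hε0 hε1)

end Scale

/-! ### The dipole term -/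

theorem integrable_inv_rad_pow_three : Integrable fun z : Plane => 1 / rad 1 z ^ 3 := by
  refine (integrable_bracket (r := 3) (by norm_num)).congr (Eventually.of_forall fun z => ?_)
  simp only [rad]
  rw [Real.sqrt_eq_rpow, ← Real.rpow_natCast _ 3, ← Real.rpow_mul (by positivity), one_div,
    ← Real.rpow_neg (by positivity)]
  norm_num [add_comm]

theorem dipoleMatrix_castSucc (f₁ f₂ : Plane → ℝ) (i j : Fin 2) :
    dipoleMatrix f₁ f₂ i.castSucc j.castSucc =
      ∫ x in unitCell, ∫ z, (f₂ x - f₁ x) * (f₂ (x + z) - f₁ (x + z)) * ddker 1 i j z := by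
  rw [dipoleMatrix]
  refine integral_congr_ae (Eventually.of_forall fun x => integral_congr_ae
    (Eventually.of_forall fun z => ?_))
  have hr : ∀ n : ℕ, (‖z‖ ^ 2 + 1) ^ ((n : ℝ) / 2) = rad 1 z ^ n := fun n => by
    rw [rad, Real.sqrt_eq_rpow, ← Real.rpow_natCast _ n, ← Real.rpow_mul (by positivity), one_pow]
    congr 1; ring
  have h3 := hr 3
  have h5 := hr 5
  push_cast at h3 h5
  have hi : ∀ i : Fin 2, lift z i.castSucc = z i := fun i => by fin_cases i <;> rfl
  have hh : horizontalId i.castSucc j.castSucc = if i = j then 1 else 0 := by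
    rw [horizontalId, Matrix.sub_apply, Matrix.one_apply, Matrix.single_apply]
    fin_cases i <;> fin_cases j <;> simp
  simp only
  rw [h3, h5, hi, hi, hh, ddker, add_comm z x]
  ring

/-- Only the horizontal magnetization interacts through dipoles, so the sums over `Fin 3` in the
limit reduce to the sums over `Fin 2` produced by integration by parts. -/
theorem dipoleMatrix_last_left (f₁ f₂ : Plane → ℝ) (j : Fin 3) : dipoleMatrix f₁ f₂ 2 j = 0 := by
  have hh : horizontalId 2 j = 0 := by
    rw [horizontalId, Matrix.sub_apply, Matrix.one_apply, Matrix.single_apply]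
    fin_cases j <;> simp
  have hl : ∀ z, lift z 2 = 0 := fun z => rfl
  simp [dipoleMatrix, hh, hl]

theorem dipoleMatrix_last_right (f₁ f₂ : Plane → ℝ) (j : Fin 3) : dipoleMatrix f₁ f₂ j 2 = 0 := by
  have hh : horizontalId j 2 = 0 := by
    rw [horizontalId, Matrix.sub_apply, Matrix.one_apply, Matrix.single_apply]
    fin_cases j <;> simp
  have hl : ∀ z, lift z 2 = 0 := fun z => rfl
  simp [dipoleMatrix, hh, hl]

/-- The powers match: `ε⁻¹` in front, a factor `ε` from each thickness and `ε⁻³` from the Hessian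
give the `ε⁻²` of `tendsto_integral_scale`. The cutoffs are absorbed into `u` and `v`. -/
theorem tendsto_dipole {ω : Set Plane} (hω : IsOpen ω) (hb : Bornology.IsBounded ω)
    (hl : HasLipschitzBoundary ω) {f₁ f₂ : Plane → ℝ} (h₁ : Continuous f₁) (h₂ : Continuous f₂)
    (hp₁ : IsCellPeriodic f₁) (hp₂ : IsCellPeriodic f₂) {G : ℝ} (hG : ∀ x, |f₂ x - f₁ x| ≤ G)
    {u v : ℝ → Plane → ℝ} {u₀ v₀ : Plane → ℝ} (hu : BoundedTendsto ω u u₀)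
    (hv : BoundedTendsto ω v v₀) (i j : Fin 2) :
    Tendsto (fun ε : ℝ => ε⁻¹ * ∫ x in ω, thickness ω f₁ f₂ ε x * u ε x *
        ∫ y in ω, thickness ω f₁ f₂ ε y * v ε y * ddker ε i j (y - x)) (𝓝[>] 0)
      (𝓝 (dipoleMatrix f₁ f₂ i.castSucc j.castSucc * ∫ x in ω, u₀ x * v₀ x)) := by
  set a : Plane → Plane → ℝ := fun x z =>
    (f₂ x - f₁ x) * (f₂ (x + z) - f₁ (x + z)) * ddker 1 i j z with ha
  have hG0 : 0 ≤ G := (abs_nonneg _).trans (hG 0)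
  have hdd := continuous_ddker one_pos i j
  have hm : Measurable (Function.uncurry a) := by
    have : Continuous (Function.uncurry a) := by
      rw [ha]; simp only [Function.uncurry_def]; fun_prop
    exact this.measurable
  have hper : ∀ z, IsCellPeriodic fun x => a x z := fun z x k => by
    simp only [ha]
    rw [hp₁, hp₂, add_right_comm, hp₁, hp₂]
  have hΦ : ∀ x z, |a x z| ≤ 4 * G ^ 2 * (1 / rad 1 z ^ 3) := fun x z => by
    simp only [ha]
    rw [abs_mul, abs_mul]
    have := abs_ddker_le one_pos i j z
    calc |f₂ x - f₁ x| * |f₂ (x + z) - f₁ (x + z)| * |ddker 1 i j z| ≤ G * G * (4 / rad 1 z ^ 3) := by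
          gcongr
          · exact hG _
          · exact hG _
      _ = _ := by ring
  have h := tendsto_integral_scale hω.measurableSet hb hm hper
    (integrable_inv_rad_pow_three.const_mul (4 * G ^ 2)) hΦ (hu.cutoff_mul hω hb hl)
    (hv.cutoff_mul hω hb hl)
  rw [dipoleMatrix_castSucc]
  refine h.congr' ?_
  filter_upwards [self_mem_nhdsWithin] with ε hε
  have hε0 : (0 : ℝ) < ε := hε
  rw [← integral_const_mul, ← integral_const_mul]
  refine integral_congr_ae (Eventually.of_forall fun x => ?_)
  simp only
  rw [← integral_const_mul, ← integral_const_mul, ← integral_const_mul, ← integral_const_mul]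
  refine integral_congr_ae (Eventually.of_forall fun y => ?_)
  have e1 : ddker ε i j (y - x) = ε⁻¹ ^ 3 * ddker 1 i j (ε⁻¹ • (y - x)) := by
    rw [← ddker_smul hε0, smul_smul, mul_inv_cancel₀ hε0.ne', one_smul]
  have e2 : ε⁻¹ • x + ε⁻¹ • (y - x) = ε⁻¹ • y := by rw [← smul_add, add_sub_cancel]
  simp only [ha, e1, e2, thickness, rescale]
  field_simp

/-! ### The charge terms -/

theorem graphNormal_periodic {f : Plane → ℝ} (hf : IsCellPeriodic f) (p : Fin 3) :
    IsCellPeriodic fun x => graphNormal f x p := by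
  intro x i
  have e : (fun y => f (y + EuclideanSpace.single i 1)) = f := funext fun y => hf y i
  have h : ∇ f (x + EuclideanSpace.single i 1) = ∇ f x := by
    rw [gradient, gradient, ← fderiv_comp_add_right, e]
  simp only [graphNormal, h]

/-- The integrand of `chargeMatrix`, put equal to zero at `z = 0`. -/
def chargeKernel (f g : Plane → ℝ) (p q : Fin 3) (x z : Plane) : ℝ :=
  if z = 0 then 0 else graphNormal f x p * graphNormal g (x + z) q *
    (1 / √(‖z‖ ^ 2 + (g (x + z) - f x) ^ 2) - 1 / √(‖z‖ ^ 2 + 1))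

theorem chargeMatrix_eq (f g : Plane → ℝ) (p q : Fin 3) :
    chargeMatrix f g p q = ∫ x in unitCell, ∫ z, chargeKernel f g p q x z := by
  rw [chargeMatrix]
  refine integral_congr_ae (Eventually.of_forall fun x => integral_congr_ae ?_)
  filter_upwards [measure_eq_zero_iff_ae_notMem.mp (measure_singleton (0 : Plane))] with z hz
  rw [chargeKernel, if_neg (show z ≠ 0 from hz), sq_abs, add_comm z x]
  ring

theorem measurable_chargeKernel {f g : Plane → ℝ} (hf : Continuous f) (hg : Continuous g)
    (p q : Fin 3) : Measurable (Function.uncurry (chargeKernel f g p q)) := by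
  have h1 : Measurable fun y : Plane × Plane => graphNormal f y.1 p :=
    (measurable_graphNormal_apply f p).comp measurable_fst
  have h2 : Measurable fun y : Plane × Plane => graphNormal g (y.1 + y.2) q :=
    (measurable_graphNormal_apply g q).comp (measurable_fst.add measurable_snd)
  have h3 : Measurable fun y : Plane × Plane => √(‖y.2‖ ^ 2 + (g (y.1 + y.2) - f y.1) ^ 2) :=
    Continuous.measurable (by fun_prop)
  have h4 : Measurable fun y : Plane × Plane => √(‖y.2‖ ^ 2 + 1) :=
    Continuous.measurable (by fun_prop)
  refine Measurable.ite (measurableSet_eq_fun measurable_snd measurable_const) measurable_const ?_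
  exact (h1.mul h2).mul ((measurable_const.div h3).sub (measurable_const.div h4))

theorem chargeKernel_periodic {f g : Plane → ℝ} (hf : IsCellPeriodic f) (hg : IsCellPeriodic g)
    (p q : Fin 3) (z : Plane) : IsCellPeriodic fun x => chargeKernel f g p q x z := by
  intro x i
  have h1 : graphNormal f (x + EuclideanSpace.single i 1) p = graphNormal f x p :=
    graphNormal_periodic hf p x i
  have h2 : graphNormal g (x + z + EuclideanSpace.single i 1) q = graphNormal g (x + z) q :=
    graphNormal_periodic hg q (x + z) i
  simp only [chargeKernel]
  rw [add_right_comm, h1, h2, hf, hg]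

/-- The bound holds at every `z`, including `z = 0`: there `kerMajorant` is `1 / 0 = 0`, which is
why `chargeKernel` is set to zero at that point. -/
theorem abs_chargeKernel_le {f g : Plane → ℝ} {K L : ℝ≥0} (hf : LipschitzWith K f)
    (hg : LipschitzWith L g) {H : ℝ} (hH : ∀ x y, |g y - f x| ≤ H) (p q : Fin 3) (x z : Plane) :
    |chargeKernel f g p q x z| ≤ (1 + K) * (1 + L) * (1 + H ^ 2) * kerMajorant z := by
  have hm := kerMajorant_nonneg z
  by_cases hz : z = 0
  · rw [chargeKernel, if_pos hz, abs_zero]; positivity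
  · rw [chargeKernel, if_neg hz, abs_mul, abs_mul, mul_assoc _ (1 + H ^ 2)]
    have h := abs_inv_sqrt_sub_le (norm_pos_iff.mpr hz) (hH x (x + z))
    refine mul_le_mul (mul_le_mul (abs_graphNormal_apply_le hf _ _)
      (abs_graphNormal_apply_le hg _ _) (abs_nonneg _) (by positivity)) h (abs_nonneg _)
      (by positivity)

/-- The Coulomb energy of the charges on two graphs, with the kernel replaced by the difference
of the Coulomb kernel and `ker ε`. -/
def graphEnergyDiff (ω : Set Plane) (f g : Plane → ℝ) (ε : ℝ) (M : Plane → Space) : ℝ :=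
  ∫ x in ω, inner ℝ (M x) (graphNormal f (ε⁻¹ • x)) * ∫ y in ω,
    inner ℝ (M y) (graphNormal g (ε⁻¹ • y)) *
      (1 / ‖graphMap (rescale ε g) y - graphMap (rescale ε f) x‖ - ker ε (y - x))

/-- Both kernels are homogeneous of degree `-1` under simultaneous scaling of distances, heights and
`ε`. -/
theorem inv_norm_graphMap_sub_ker {f g : Plane → ℝ} {ε : ℝ} (hε : 0 < ε) (x y : Plane) :
    1 / ‖graphMap (rescale ε g) y - graphMap (rescale ε f) x‖ - ker ε (y - x) =
      ε⁻¹ * (1 / √(‖ε⁻¹ • (y - x)‖ ^ 2 + (g (ε⁻¹ • x + ε⁻¹ • (y - x)) - f (ε⁻¹ • x)) ^ 2) -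
        1 / √(‖ε⁻¹ • (y - x)‖ ^ 2 + 1)) := by
  have hi := inv_pos.mpr hε
  have e2 : ε⁻¹ • x + ε⁻¹ • (y - x) = ε⁻¹ • y := by rw [← smul_add, add_sub_cancel]
  have hs : ∀ s t : ℝ, √((ε⁻¹ * s) ^ 2 + t ^ 2) = ε⁻¹ * √(s ^ 2 + (ε * t) ^ 2) := fun s t => by
    rw [← Real.sqrt_sq hi.le, ← Real.sqrt_mul (by positivity), Real.sqrt_sq hi.le]
    congr 1; field_simp
  have h1 := hs ‖y - x‖ 1
  rw [one_pow, mul_one] at h1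
  rw [e2, norm_smul, norm_inv, Real.norm_of_nonneg hε.le, hs, h1, graphMap, graphMap, join_sub,
    norm_join, ker, rad, rescale, rescale, ← mul_sub]
  field_simp

theorem ae_prod_ne (ν ν' : Measure Plane) [SFinite ν'] [NullSingletonClass ν'] [SFinite ν] :
    ∀ᵐ z ∂(ν.prod ν'), z.2 ≠ z.1 := by
  have hm : MeasurableSet {z : Plane × Plane | z.2 ≠ z.1} :=
    (measurableSet_eq_fun measurable_snd measurable_fst).compl
  rw [Measure.ae_prod_iff_ae_ae hm]
  exact Eventually.of_forall fun x => measure_eq_zero_iff_ae_notMem.mp (measure_singleton x)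

/-- The majorant depends on `y - x` only, so the product with `u` is the integrand of a convolution
of two integrable functions. -/
theorem integrable_prod_of_majorant {ω : Set Plane} {u v : Plane → ℝ}
    {C : ℝ} (hu : IntegrableOn u ω)
    (hvm : AEStronglyMeasurable v (volume.restrict ω))
    (hv : ∀ᵐ x ∂(volume.restrict ω), |v x| ≤ C) {J : Plane → Plane → ℝ}
    (hJ : Measurable (Function.uncurry J)) {Ψ : Plane → ℝ} (hΨ : Integrable Ψ)
    (hJΨ : ∀ x y, y ≠ x → |J x y| ≤ Ψ (y - x)) :
    Integrable (Function.uncurry fun x y => u x * (v y * J x y))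
      ((volume.restrict ω).prod (volume.restrict ω)) := by
  have h1 : Integrable (fun p : Plane × Plane => u p.1 * Ψ (p.2 - p.1))
      ((volume.restrict ω).prod (volume.restrict ω)) := by
    have h := (Integrable.convolution_integrand (ContinuousLinearMap.mul ℝ ℝ) hu hΨ).swap
    exact h.mono_measure (Measure.prod_mono le_rfl Measure.restrict_le_self)
  have h2 := h1.norm.const_mul C
  refine h2.mono' ?_ ?_
  · exact hu.aestronglyMeasurable.comp_fst.mul (hvm.comp_snd.mul hJ.aestronglyMeasurable)
  · filter_upwards [ae_prod_ne (volume.restrict ω) (volume.restrict ω),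
      Measure.quasiMeasurePreserving_snd.ae hv] with p hp hpv
    have hC : 0 ≤ C := (abs_nonneg _).trans hpv
    simp only [Function.uncurry, norm_mul]
    have h := hJΨ p.1 p.2 hp
    calc ‖u p.1‖ * (‖v p.2‖ * ‖J p.1 p.2‖) ≤ ‖u p.1‖ * (C * ‖Ψ (p.2 - p.1)‖) := by
          gcongr
          · exact hpv
          · exact h.trans (le_abs_self _)
      _ = _ := by ring

section GraphEnergy

variable {ω : Set Plane} {f g : Plane → ℝ} {K L : ℝ≥0} {H ε : ℝ}

theorem measurable_scaled_kernel {a : Plane → Plane → ℝ} (ha : Measurable (Function.uncurry a))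
    (ε : ℝ) : Measurable (Function.uncurry fun x y : Plane => a (ε⁻¹ • x) (ε⁻¹ • (y - x))) :=
  ha.comp (show Measurable fun p : Plane × Plane => (ε⁻¹ • p.1, ε⁻¹ • (p.2 - p.1)) by fun_prop)

/-- One factor `ε⁻¹` is the prefactor and the other comes from the homogeneity of the kernel. The
inner products are expanded in coordinates, and the majorant justifies interchanging sums and
integrals. -/
theorem graphEnergyDiff_eq (hb : Bornology.IsBounded ω) (hf : LipschitzWith K f)
    (hg : LipschitzWith L g) (hH : ∀ x y, |g y - f x| ≤ H) (hε : 0 < ε) {M : Plane → Space}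
    (hM : AEStronglyMeasurable M (volume.restrict ω))
    (hM1 : ∀ᵐ x ∂(volume.restrict ω), ‖M x‖ ≤ 1) :
    ε⁻¹ * graphEnergyDiff ω f g ε M = ∑ p, ∑ q, ε⁻¹ ^ 2 * ∫ x in ω, M x p * ∫ y in ω,
      M y q * chargeKernel f g p q (ε⁻¹ • x) (ε⁻¹ • (y - x)) := by
  set Φ : Plane → ℝ := fun z => (1 + K) * (1 + L) * (1 + H ^ 2) * kerMajorant z with hΦ
  have hΦi : Integrable Φ := integrable_kerMajorant.const_mul _
  have hMp : ∀ p, AEStronglyMeasurable (fun x => M x p) (volume.restrict ω) := fun p =>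
    aestronglyMeasurable_apply hM p
  have hMb : ∀ p, ∀ᵐ x ∂(volume.restrict ω), |M x p| ≤ 1 := fun p =>
    hM1.mono fun x hx => (abs_apply_le_norm_space _ _).trans hx
  have hJm := fun p q => measurable_scaled_kernel
    (measurable_chargeKernel hf.continuous hg.continuous p q) ε
  have hprod := fun p q => integrable_prod_of_majorant
    (integrableOn_of_norm_le hb (hMp p) (hMb p)) (hMp q) (hMb q) (hJm p q)
    ((integrable_comp_scale hε hΦi 0).congr (Eventually.of_forall fun z => by
      simp only [sub_zero])) (Ψ := fun z => Φ (ε⁻¹ • z))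
    fun x y _ => abs_chargeKernel_le hf hg hH p q _ _
  have hin : ∀ p q x, IntegrableOn (fun y => M y q *
      chargeKernel f g p q (ε⁻¹ • x) (ε⁻¹ • (y - x))) ω := fun p q x => by
    refine Integrable.bdd_mul (c := 1) ?_ (hMp q) (hMb q)
    refine ((integrable_comp_scale hε hΦi x).integrableOn (s := ω)).mono' ?_
      (Eventually.of_forall fun y => abs_chargeKernel_le hf hg hH p q _ _)
    exact ((hJm p q).comp measurable_prodMk_left).aestronglyMeasurable
  have hout : ∀ p q, IntegrableOn (fun x => M x p * ∫ y in ω, M y q *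
      chargeKernel f g p q (ε⁻¹ • x) (ε⁻¹ • (y - x))) ω := fun p q => by
    simp only [← integral_const_mul]
    exact (hprod p q).integral_prod_left
  have hpt : ∀ x, ε⁻¹ * (inner ℝ (M x) (graphNormal f (ε⁻¹ • x)) * ∫ y in ω,
      inner ℝ (M y) (graphNormal g (ε⁻¹ • y)) *
        (1 / ‖graphMap (rescale ε g) y - graphMap (rescale ε f) x‖ - ker ε (y - x))) =
      ∑ p, ∑ q, ε⁻¹ ^ 2 * (M x p * ∫ y in ω,
        M y q * chargeKernel f g p q (ε⁻¹ • x) (ε⁻¹ • (y - x))) := fun x => by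
    simp only [← integral_const_mul]
    have hi : ∀ p q, IntegrableOn (fun y => ε⁻¹ ^ 2 * (M x p * (M y q *
        chargeKernel f g p q (ε⁻¹ • x) (ε⁻¹ • (y - x))))) ω := fun p q =>
      ((hin p q x).const_mul _).const_mul _
    rw [show (∑ p, ∑ q, ∫ y in ω, ε⁻¹ ^ 2 * (M x p * (M y q *
        chargeKernel f g p q (ε⁻¹ • x) (ε⁻¹ • (y - x))))) = ∑ p, ∫ y in ω, ∑ q, ε⁻¹ ^ 2 *
        (M x p * (M y q * chargeKernel f g p q (ε⁻¹ • x) (ε⁻¹ • (y - x)))) from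
      Finset.sum_congr rfl fun p _ => (integral_finsetSum _ fun q _ => hi p q).symm,
      ← integral_finsetSum _ fun p _ => integrable_finsetSum _ fun q _ => hi p q]
    refine integral_congr_ae (ae_restrict_of_ae ?_)
    filter_upwards [measure_eq_zero_iff_ae_notMem.mp (measure_singleton x)] with y hy
    have hz : ε⁻¹ • (y - x) ≠ 0 := smul_ne_zero (inv_pos.mpr hε).ne' (sub_ne_zero.mpr hy)
    have e2 : ε⁻¹ • x + ε⁻¹ • (y - x) = ε⁻¹ • y := by rw [← smul_add, add_sub_cancel]
    simp only [inv_norm_graphMap_sub_ker hε, chargeKernel, if_neg hz, e2, inner_space,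
      Fin.sum_univ_three]
    ring
  rw [graphEnergyDiff, ← integral_const_mul]
  simp only [hpt]
  rw [integral_finsetSum _ fun p _ => integrable_finsetSum _ fun q _ => (hout p q).const_mul _]
  refine Finset.sum_congr rfl fun p _ => ?_
  rw [integral_finsetSum _ fun q _ => (hout p q).const_mul _]
  exact Finset.sum_congr rfl fun q _ => integral_const_mul _ _

theorem tendsto_graphEnergyDiff (hω : IsOpen ω) (hb : Bornology.IsBounded ω)
    (hf : LipschitzWith K f) (hg : LipschitzWith L g) (hpf : IsCellPeriodic f)
    (hpg : IsCellPeriodic g) (hH : ∀ x y, |g y - f x| ≤ H) {M : ℝ → Plane → Space}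
    {m : Plane → Space} (hM : ∀ ε > 0, AEStronglyMeasurable (M ε) (volume.restrict ω))
    (hM1 : ∀ ε > 0, ∀ᵐ x ∂(volume.restrict ω), ‖M ε x‖ ≤ 1)
    (h : ∀ p, BoundedTendsto ω (fun ε x => M ε x p) fun x => m x p) :
    Tendsto (fun ε => ε⁻¹ * graphEnergyDiff ω f g ε (M ε)) (𝓝[>] 0)
      (𝓝 (∑ p, ∑ q, chargeMatrix f g p q * ∫ x in ω, m x p * m x q)) := by
  have hlim := tendsto_finsetSum Finset.univ fun p (_ : p ∈ Finset.univ) =>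
    tendsto_finsetSum Finset.univ fun q (_ : q ∈ Finset.univ) =>
      tendsto_integral_scale hω.measurableSet hb
        (measurable_chargeKernel hf.continuous hg.continuous p q) (chargeKernel_periodic hpf hpg p q)
        (integrable_kerMajorant.const_mul ((1 + K) * (1 + L) * (1 + H ^ 2) : ℝ))
        (abs_chargeKernel_le hf hg hH p q) (h p) (h q)
  simp only [chargeMatrix_eq]
  refine hlim.congr' ?_
  filter_upwards [self_mem_nhdsWithin] with ε hε
  exact (graphEnergyDiff_eq hb hf hg hH hε (hM ε hε) (hM1 ε hε)).symm

end GraphEnergy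

/-! ### Coulomb potentials of measures with quadratic growth -/

/-- The Coulomb potential of the charge `q` on `σ`. -/
def potential (σ : Measure Space) (q : Space → ℝ) (y : Space) : ℝ := ∫ x, 1 / ‖x - y‖ * q x ∂σ

/-- The Coulomb interaction energy of the charges `q` on `σ` and on `τ`. -/
def interaction (σ τ : Measure Space) (q : Space → ℝ) : ℝ := ∫ y, q y * potential σ q y ∂τ

theorem interaction_eq_integral (σ τ : Measure Space) (q : Space → ℝ) :
    interaction σ τ q = ∫ y, ∫ x, 1 / ‖x - y‖ * q x * q y ∂σ ∂τ := by
  simp only [interaction, potential, integral_mul_const]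
  simp only [mul_comm]

theorem abs_interaction_le {σ τ : Measure Space} [IsFiniteMeasure τ] {q : Space → ℝ}
    (hq1 : ∀ x, |q x| ≤ 1) {B : ℝ}
    (hB : ∀ᵐ y ∂τ, |potential σ q y| ≤ B) : |interaction σ τ q| ≤ B * τ.real univ := by
  refine norm_integral_le_of_norm_le_const (f := fun y => q y * potential σ q y) ?_
  filter_upwards [hB] with y hy
  rw [norm_mul]
  exact (mul_le_of_le_one_left (abs_nonneg _) (hq1 y)).trans hy

section Interaction

variable {σ σ' τ τ' : Measure Space} [IsFiniteMeasure σ] [IsFiniteMeasure σ'] [IsFiniteMeasure τ]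
  [IsFiniteMeasure τ'] {C C' : ℝ} {q : Space → ℝ}

theorem integrable_potential (hC : 0 ≤ C) (hσ : QuadraticGrowth σ C) (hq : Measurable q)
    (hq1 : ∀ x, |q x| ≤ 1) (y : Space) : Integrable (fun x => 1 / ‖x - y‖ * q x) σ :=
  (hσ.integrable_inv_dist hC y).mul_bdd (c := 1) hq.aestronglyMeasurable (Eventually.of_forall hq1)

theorem integral_abs_potential_le (hC : 0 ≤ C) (hσ : QuadraticGrowth σ C)
    (hq1 : ∀ x, |q x| ≤ 1) (y : Space) {T : ℝ} (hT : 0 < T) :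
    ∫ x, |1 / ‖x - y‖ * q x| ∂σ ≤ T * σ.real univ + C / T := by
  refine le_trans ?_ (hσ.integral_inv_dist_le hC y hT)
  refine integral_mono_of_nonneg (Eventually.of_forall fun x => abs_nonneg _)
    (hσ.integrable_inv_dist hC y) (Eventually.of_forall fun x => ?_)
  simp only [abs_mul]
  rw [abs_of_nonneg (by positivity : (0 : ℝ) ≤ 1 / ‖x - y‖)]
  exact mul_le_of_le_one_right (by positivity) (hq1 x)

/-- Quadratic growth bounds the absolute potential of `σ` uniformly in `y`, and `τ` is finite, so
Tonelli applies. -/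
theorem integrable_coulomb (hC : 0 ≤ C) (hσ : QuadraticGrowth σ C) (hq : Measurable q)
    (hq1 : ∀ x, |q x| ≤ 1) :
    Integrable (fun p : Space × Space => 1 / ‖p.1 - p.2‖ * q p.1 * q p.2) (σ.prod τ) := by
  have hm : Measurable fun p : Space × Space => 1 / ‖p.1 - p.2‖ * q p.1 * q p.2 := by fun_prop
  rw [integrable_prod_iff' hm.aestronglyMeasurable]
  refine ⟨Eventually.of_forall fun y => (integrable_potential hC hσ hq hq1 y).mul_const (q y), ?_⟩
  refine Integrable.of_bound (hm.stronglyMeasurable.norm.integral_prod_left'.aestronglyMeasurable)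
    (1 * σ.real univ + C / 1) (Eventually.of_forall fun y => ?_)
  rw [Real.norm_of_nonneg (integral_nonneg fun x => norm_nonneg _)]
  refine le_trans ?_ (integral_abs_potential_le hC hσ hq1 y one_pos)
  refine integral_mono_of_nonneg (Eventually.of_forall fun x => norm_nonneg _)
    (integrable_potential hC hσ hq hq1 y).abs (Eventually.of_forall fun x => ?_)
  simp only [norm_mul _ (q y)]
  exact mul_le_of_le_one_right (norm_nonneg _) (hq1 y)

theorem integrable_mul_potential (hC : 0 ≤ C) (hσ : QuadraticGrowth σ C) (hq : Measurable q)
    (hq1 : ∀ x, |q x| ≤ 1) : Integrable (fun y => q y * potential σ q y) τ := by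
  have h := (integrable_coulomb (τ := τ) hC hσ hq hq1).integral_prod_right
  refine h.congr (Eventually.of_forall fun y => ?_)
  simp only [potential]
  rw [integral_mul_const, mul_comm]

theorem interaction_comm (hC : 0 ≤ C) (hσ : QuadraticGrowth σ C)
    (hq : Measurable q) (hq1 : ∀ x, |q x| ≤ 1) : interaction σ τ q = interaction τ σ q := by
  rw [interaction_eq_integral, interaction_eq_integral,
    ← integral_integral_swap (f := fun x y => 1 / ‖x - y‖ * q x * q y)
      (integrable_coulomb hC hσ hq hq1)]
  refine integral_congr_ae (Eventually.of_forall fun x => integral_congr_ae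
    (Eventually.of_forall fun y => ?_))
  simp only [norm_sub_rev x y]
  ring

theorem interaction_add_left (hC : 0 ≤ C) (hσ : QuadraticGrowth σ C) (hC' : 0 ≤ C')
    (hσ' : QuadraticGrowth σ' C') (hq : Measurable q) (hq1 : ∀ x, |q x| ≤ 1) :
    interaction (σ + σ') τ q = interaction σ τ q + interaction σ' τ q := by
  have e : ∀ y, potential (σ + σ') q y = potential σ q y + potential σ' q y := fun y =>
    integral_add_measure (integrable_potential hC hσ hq hq1 y)
      (integrable_potential hC' hσ' hq hq1 y)
  simp only [interaction, e, mul_add]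
  exact integral_add (integrable_mul_potential hC hσ hq hq1)
    (integrable_mul_potential hC' hσ' hq hq1)

theorem interaction_add_right (hC : 0 ≤ C) (hσ : QuadraticGrowth σ C) (hq : Measurable q)
    (hq1 : ∀ x, |q x| ≤ 1) :
    interaction σ (τ + τ') q = interaction σ τ q + interaction σ τ' q :=
  integral_add_measure (integrable_mul_potential hC hσ hq hq1)
    (integrable_mul_potential hC hσ hq hq1)

end Interaction

/-- Bilinearity and symmetry. The two graphs are kept together in the term with `l`, since only
their combined potential is small. -/
theorem interaction_decomposition {σ₁ σ₂ l : Measure Space} [IsFiniteMeasure σ₁]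
    [IsFiniteMeasure σ₂] [IsFiniteMeasure l] {C₁ C₂ C : ℝ} {q : Space → ℝ} (hC₁ : 0 ≤ C₁)
    (hσ₁ : QuadraticGrowth σ₁ C₁) (hC₂ : 0 ≤ C₂) (hσ₂ : QuadraticGrowth σ₂ C₂) (hC : 0 ≤ C)
    (hl : QuadraticGrowth l C) (hq : Measurable q) (hq1 : ∀ x, |q x| ≤ 1) :
    interaction (σ₁ + σ₂ + l) (σ₁ + σ₂ + l) q =
      interaction σ₁ σ₁ q + interaction σ₂ σ₂ q + 2 * interaction σ₂ σ₁ q +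
        2 * interaction (σ₁ + σ₂) l q + interaction l l q := by
  have h12 : QuadraticGrowth (σ₁ + σ₂) (C₁ + C₂) := hσ₁.add hC₁ hC₂ hσ₂
  have hC12 : 0 ≤ C₁ + C₂ := add_nonneg hC₁ hC₂
  rw [interaction_add_left hC12 h12 hC hl hq hq1, interaction_add_right hC12 h12 hq hq1,
    interaction_add_right hC hl hq hq1, interaction_comm hC hl hq hq1,
    interaction_add_left (τ := σ₁ + σ₂) hC₁ hσ₁ hC₂ hσ₂ hq hq1, interaction_add_right hC₁ hσ₁ hq hq1,
    interaction_add_right hC₂ hσ₂ hq hq1, interaction_comm (τ := σ₂) hC₁ hσ₁ hq hq1]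
  ring

/-! ### Interactions of charged graphs -/

theorem potential_graph {f : Plane → ℝ} {K : ℝ≥0} (hf : LipschitzWith K f) {s : Set Plane}
    (hs : MeasurableSet s) {q : Space → ℝ} {ρ : Plane → ℝ}
    (hρ : ∀ᵐ x ∂(volume.restrict s), areaElement f x * q (graphMap f x) = ρ x) (y : Space) :
    potential ((Measure.euclideanHausdorffMeasure 2).restrict (graphMap f '' s)) q y =
      ∫ x in s, ρ x * (1 / ‖graphMap f x - y‖) := by
  rw [potential, integral_graph hf hs]
  refine integral_congr_ae ?_
  filter_upwards [hρ] with x hx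
  rw [← hx]; ring

theorem interaction_graph {f g : Plane → ℝ} {K L : ℝ≥0} (hf : LipschitzWith K f)
    (hg : LipschitzWith L g) {s : Set Plane} (hs : MeasurableSet s) {q : Space → ℝ}
    {ρ θ : Plane → ℝ}
    (hρ : ∀ᵐ x ∂(volume.restrict s), areaElement f x * q (graphMap f x) = ρ x)
    (hθ : ∀ᵐ x ∂(volume.restrict s), areaElement g x * q (graphMap g x) = θ x) :
    interaction ((Measure.euclideanHausdorffMeasure 2).restrict (graphMap g '' s))
        ((Measure.euclideanHausdorffMeasure 2).restrict (graphMap f '' s)) q =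
      ∫ x in s, ρ x * ∫ y in s, θ y * (1 / ‖graphMap g y - graphMap f x‖) := by
  rw [interaction, integral_graph hf hs]
  refine integral_congr_ae ?_
  filter_upwards [hρ] with x hx
  rw [potential_graph hg hs hθ, ← hx]; ring

section Split

variable {ω : Set Plane} {f g : Plane → ℝ} {H ε A : ℝ} {ρ θ : Plane → ℝ}

theorem abs_inv_norm_graphMap_sub_ker_le (hH : ∀ x y, |g y - f x| ≤ H) (hε : 0 < ε) {x y : Plane}
    (hxy : y ≠ x) :
    |1 / ‖graphMap (rescale ε g) y - graphMap (rescale ε f) x‖ - ker ε (y - x)| ≤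
      (1 + H ^ 2) * ε⁻¹ * kerMajorant (ε⁻¹ • (y - x)) := by
  rw [graphMap, graphMap, join_sub]
  refine abs_inv_norm_join_sub_ker_le hε ?_ (sub_ne_zero.mpr hxy)
  rw [rescale, rescale, ← mul_sub, abs_mul, abs_of_pos hε]
  gcongr
  exact hH _ _

theorem integrable_scaled_kerMajorant (hε : 0 < ε) (c : ℝ) (y : Plane) :
    Integrable fun x : Plane => c * kerMajorant (ε⁻¹ • (x - y)) :=
  (integrable_comp_scale hε integrable_kerMajorant y).const_mul c

/-- Each part is integrable by itself: the difference because of `kerMajorant`, and `ker ε` because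
it is bounded for fixed `ε`. -/
theorem integral_graph_kernel_split (hb : Bornology.IsBounded ω) (hf : Continuous f)
    (hg : Continuous g)
    (hH : ∀ x y, |g y - f x| ≤ H) (hε : 0 < ε)
    (hρm : AEStronglyMeasurable ρ (volume.restrict ω))
    (hρ : ∀ᵐ x ∂(volume.restrict ω), |ρ x| ≤ A) (hθm : AEStronglyMeasurable θ (volume.restrict ω))
    (hθ : ∀ᵐ x ∂(volume.restrict ω), |θ x| ≤ A) :
    ∫ x in ω, ρ x * ∫ y in ω, θ y * (1 / ‖graphMap (rescale ε g) y - graphMap (rescale ε f) x‖) =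
      (∫ x in ω, ρ x * ∫ y in ω, θ y *
        (1 / ‖graphMap (rescale ε g) y - graphMap (rescale ε f) x‖ - ker ε (y - x))) +
      ∫ x in ω, ρ x * ∫ y in ω, θ y * ker ε (y - x) := by
  have hρi := integrableOn_of_norm_le hb hρm hρ
  have hθi := integrableOn_of_norm_le hb hθm hθ
  have hcg : Continuous (graphMap (rescale ε g)) :=
    continuous_join.comp (continuous_id.prodMk (continuous_rescale hg))
  have hcf : Continuous (graphMap (rescale ε f)) :=
    continuous_join.comp (continuous_id.prodMk (continuous_rescale hf))
  have hJm : Measurable (Function.uncurry fun x y : Plane =>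
      1 / ‖graphMap (rescale ε g) y - graphMap (rescale ε f) x‖ - ker ε (y - x)) := by
    have h1 : Measurable fun p : Plane × Plane =>
        ‖graphMap (rescale ε g) p.2 - graphMap (rescale ε f) p.1‖ :=
      Continuous.measurable (by fun_prop)
    have h2 : Measurable fun p : Plane × Plane => ker ε (p.2 - p.1) :=
      ((continuous_ker hε).comp (continuous_snd.sub continuous_fst)).measurable
    exact (measurable_const.div h1).sub h2
  have hprod := integrable_prod_of_majorant hρi hθm hθ hJm
    (Ψ := fun z => (1 + H ^ 2) * ε⁻¹ * kerMajorant (ε⁻¹ • z))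
    (by simpa using integrable_scaled_kerMajorant hε ((1 + H ^ 2) * ε⁻¹) 0)
    fun x y hxy => abs_inv_norm_graphMap_sub_ker_le hH hε hxy
  have i1 : ∀ x, IntegrableOn (fun y => θ y *
      (1 / ‖graphMap (rescale ε g) y - graphMap (rescale ε f) x‖ - ker ε (y - x))) ω := fun x => by
    refine Integrable.bdd_mul (c := A) ?_ hθm hθ
    refine ((integrable_scaled_kerMajorant hε ((1 + H ^ 2) * ε⁻¹) x).integrableOn (s := ω)).mono'
      (hJm.comp measurable_prodMk_left).aestronglyMeasurable (ae_restrict_of_ae ?_)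
    filter_upwards [measure_eq_zero_iff_ae_notMem.mp (measure_singleton x)] with y hy
    exact abs_inv_norm_graphMap_sub_ker_le hH hε hy
  have i2 := fun x => integrable_mul_kernel hθi (continuous_ker hε) (abs_ker_le hε) x
  have e : ∀ x, ∫ y in ω, θ y * (1 / ‖graphMap (rescale ε g) y - graphMap (rescale ε f) x‖) =
      (∫ y in ω, θ y *
        (1 / ‖graphMap (rescale ε g) y - graphMap (rescale ε f) x‖ - ker ε (y - x))) +
        ∫ y in ω, θ y * ker ε (y - x) := fun x => by
    rw [← integral_add (i1 x) (i2 x)]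
    refine integral_congr_ae (Eventually.of_forall fun y => ?_)
    simp only
    ring
  simp only [e, mul_add]
  refine integral_add ?_ ?_
  · simp only [← integral_const_mul]
    exact hprod.integral_prod_left
  · simp only [← integral_const_mul]
    exact (integrable_prod_kernel hρi hθi (continuous_ker hε) (abs_ker_le hε)).integral_prod_left

/-- Bilinearity, where the two cross terms coincide because `ker ε` is even. -/
theorem integral_ker_sub_sub (hε : 0 < ε) (hρ : IntegrableOn ρ ω) (hθ : IntegrableOn θ ω) :
    ∫ x in ω, (θ x - ρ x) * ∫ y in ω, (θ y - ρ y) * ker ε (y - x) =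
      (∫ x in ω, ρ x * ∫ y in ω, ρ y * ker ε (y - x)) +
      (∫ x in ω, θ x * ∫ y in ω, θ y * ker ε (y - x)) -
      2 * ∫ x in ω, ρ x * ∫ y in ω, θ y * ker ε (y - x) := by
  have hk := continuous_ker hε
  have hin : ∀ {b : Plane → ℝ}, IntegrableOn b ω → ∀ x,
      IntegrableOn (fun y => b y * ker ε (y - x)) ω := fun hb x =>
    integrable_mul_kernel hb hk (abs_ker_le hε) x
  have hout : ∀ {a b : Plane → ℝ}, IntegrableOn a ω → IntegrableOn b ω →
      IntegrableOn (fun x => a x * ∫ y in ω, b y * ker ε (y - x)) ω := fun ha hb => by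
    simp only [← integral_const_mul]
    exact (integrable_prod_kernel ha hb hk (abs_ker_le hε)).integral_prod_left
  have hsymm : ∫ x in ω, θ x * ∫ y in ω, ρ y * ker ε (y - x) =
      ∫ x in ω, ρ x * ∫ y in ω, θ y * ker ε (y - x) := by
    simp only [← integral_const_mul]
    rw [integral_integral_swap (integrable_prod_kernel hθ hρ hk (abs_ker_le hε))]
    refine integral_congr_ae (Eventually.of_forall fun y => integral_congr_ae
      (Eventually.of_forall fun x => ?_))
    simp only
    rw [← ker_neg ε (y - x), neg_sub]
    ring
  have e : ∀ x, (θ x - ρ x) * ∫ y in ω, (θ y - ρ y) * ker ε (y - x) =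
      θ x * (∫ y in ω, θ y * ker ε (y - x)) - θ x * (∫ y in ω, ρ y * ker ε (y - x)) -
      (ρ x * (∫ y in ω, θ y * ker ε (y - x)) - ρ x * ∫ y in ω, ρ y * ker ε (y - x)) := fun x => by
    simp only [sub_mul _ _ (ker ε _)]
    rw [integral_sub (hin hθ x) (hin hρ x)]
    ring
  simp only [e]
  have hsub : ∀ {a : Plane → ℝ}, IntegrableOn a ω →
      IntegrableOn (fun x => a x * (∫ y in ω, θ y * ker ε (y - x)) -
        a x * ∫ y in ω, ρ y * ker ε (y - x)) ω := fun ha => (hout ha hθ).sub (hout ha hρ)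
  rw [integral_sub (hsub hθ) (hsub hρ), integral_sub (hout hθ hθ) (hout hθ hρ),
    integral_sub (hout hρ hθ) (hout hρ hρ), hsymm]
  ring

end Split

/-! ### Decomposition of the magnetostatic energy -/

theorem QuadraticGrowth.isFiniteMeasure {s : Set Space} (hs : Bornology.IsBounded s) {C : ℝ}
    (h : QuadraticGrowth ((Measure.euclideanHausdorffMeasure 2).restrict s) C) :
    IsFiniteMeasure ((Measure.euclideanHausdorffMeasure 2 : Measure Space).restrict s) := by
  obtain ⟨r, hr0, hr⟩ := hs.subset_closedBall_lt 0 0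
  refine ⟨?_⟩
  have e : (Measure.euclideanHausdorffMeasure 2).restrict s univ =
      (Measure.euclideanHausdorffMeasure 2).restrict s (Metric.closedBall 0 r) := by
    rw [Measure.restrict_apply_univ, Measure.restrict_apply Metric.isClosed_closedBall.measurableSet,
      inter_eq_right.mpr hr]
  rw [e]
  exact (h 0 r hr0).trans_lt ENNReal.ofReal_lt_top

theorem quadraticGrowth_graph {f : Plane → ℝ} {K : ℝ≥0} (hf : LipschitzWith K f) (s : Set Plane) :
    QuadraticGrowth ((Measure.euclideanHausdorffMeasure 2).restrict (graphMap f '' s))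
      (4 * ((1 + K : ℝ≥0) : ℝ) ^ 2 * discArea) :=
  quadraticGrowth_of_param (lipschitz_graphMap hf) (norm_sub_le_graphMap f) (image_subset_range _ _)

theorem abs_inner_graphNormal_le {f : Plane → ℝ} {K : ℝ≥0} (hf : LipschitzWith K f) {m : Space}
    (hm : ‖m‖ ≤ 1) (x : Plane) : |inner ℝ m (graphNormal f x)| ≤ 3 * (1 + K) := by
  have h : ∀ p, |m p * graphNormal f x p| ≤ 1 + K := fun p => by
    rw [abs_mul, ← one_mul ((1 : ℝ) + K)]
    exact mul_le_mul ((abs_apply_le_norm_space m p).trans hm) (abs_graphNormal_apply_le hf x p)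
      (abs_nonneg _) zero_le_one
  rw [inner_space]
  refine (abs_add_three _ _ _).trans ?_
  linarith [h 0, h 1, h 2]

/-- At a point within height `εH` of the graph, the kernel difference has size `ε⁻¹` at scale `ε`,
and its integral is `O(ε)` after the Jacobian `ε²`. The potentials of the graphs on the lateral face
are thereby reduced to those of `ker ε`. -/
theorem abs_integral_graph_sub_ker_le {ω : Set Plane} (hb : Bornology.IsBounded ω) {f : Plane → ℝ}
    (hf : Continuous f) {ε H A : ℝ} (hε : 0 < ε) (hA : 0 ≤ A) {θ : Plane → ℝ}
    (hθm : AEStronglyMeasurable θ (volume.restrict ω))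
    (hθ : ∀ᵐ x ∂(volume.restrict ω), |θ x| ≤ A) {y : Space}
    (hy : ∀ x, |rescale ε f x - y 2| ≤ ε * H) :
    |(∫ x in ω, θ x * (1 / ‖graphMap (rescale ε f) x - y‖)) -
      ∫ x in ω, θ x * ker ε (x - proj y)| ≤ A * (1 + H ^ 2) * ε * ∫ z, kerMajorant z := by
  have hθi := integrableOn_of_norm_le hb hθm hθ
  have hcf : Continuous (graphMap (rescale ε f)) :=
    continuous_join.comp (continuous_id.prodMk (continuous_rescale hf))
  have ey : ∀ x, graphMap (rescale ε f) x - y = join (x - proj y) (rescale ε f x - y 2) := fun x => by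
    rw [graphMap, ← join_sub, join_proj]
  have hle : ∀ᵐ x ∂(volume.restrict ω), |1 / ‖graphMap (rescale ε f) x - y‖ - ker ε (x - proj y)| ≤
      (1 + H ^ 2) * ε⁻¹ * kerMajorant (ε⁻¹ • (x - proj y)) := by
    refine ae_restrict_of_ae ?_
    filter_upwards [measure_eq_zero_iff_ae_notMem.mp (measure_singleton (proj y))] with x hx
    rw [ey]
    exact abs_inv_norm_join_sub_ker_le hε (hy x) (sub_ne_zero.mpr hx)
  have hm : Measurable fun x => 1 / ‖graphMap (rescale ε f) x - y‖ - ker ε (x - proj y) := by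
    have h1 : Measurable fun x => ‖graphMap (rescale ε f) x - y‖ :=
      Continuous.measurable (by fun_prop)
    exact (measurable_const.div h1).sub
      ((continuous_ker hε).comp (continuous_id.sub continuous_const)).measurable
  have hmaj := integrable_scaled_kerMajorant hε ((1 + H ^ 2) * ε⁻¹) (proj y)
  have i1 : IntegrableOn (fun x => 1 / ‖graphMap (rescale ε f) x - y‖ - ker ε (x - proj y)) ω :=
    hmaj.integrableOn.mono' hm.aestronglyMeasurable hle
  have i2 := integrable_mul_kernel hθi (continuous_ker hε) (abs_ker_le hε) (proj y)
  have i3 : IntegrableOn (fun x => θ x *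
      (1 / ‖graphMap (rescale ε f) x - y‖ - ker ε (x - proj y))) ω := i1.bdd_mul (c := A) hθm hθ
  have e : ∫ x in ω, θ x * (1 / ‖graphMap (rescale ε f) x - y‖) =
      (∫ x in ω, θ x * (1 / ‖graphMap (rescale ε f) x - y‖ - ker ε (x - proj y))) +
        ∫ x in ω, θ x * ker ε (x - proj y) := by
    rw [← integral_add i3 i2]
    refine integral_congr_ae (Eventually.of_forall fun x => ?_)
    simp only
    ring
  rw [e, add_sub_cancel_right]
  calc |∫ x in ω, θ x * (1 / ‖graphMap (rescale ε f) x - y‖ - ker ε (x - proj y))|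
      ≤ ∫ x in ω, A * ((1 + H ^ 2) * ε⁻¹ * kerMajorant (ε⁻¹ • (x - proj y))) := by
        refine norm_integral_le_of_norm_le (f := fun x => θ x *
          (1 / ‖graphMap (rescale ε f) x - y‖ - ker ε (x - proj y)))
          (hmaj.integrableOn.const_mul A) ?_
        filter_upwards [hθ, hle] with x h1 h2
        rw [norm_mul]
        exact mul_le_mul h1 h2 (abs_nonneg _) hA
    _ ≤ ∫ x, A * ((1 + H ^ 2) * ε⁻¹ * kerMajorant (ε⁻¹ • (x - proj y))) :=
        setIntegral_le_integral (hmaj.const_mul A) (Eventually.of_forall fun x => by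
          have := kerMajorant_nonneg (ε⁻¹ • (x - proj y))
          simp only [Pi.zero_apply]
          positivity)
    _ = _ := by
        rw [integral_const_mul, integral_const_mul, integral_comp_scale hε]
        field_simp

section Energy

variable {ω : Set Plane} {f₁ f₂ : Plane → ℝ} {K₁ K₂ : ℝ≥0} {ε : ℝ}

/-- The Coulomb energy of the surface charge. -/
def filmEnergy (ω : Set Plane) (f₁ f₂ : Plane → ℝ) (ε : ℝ) (M : Plane → Space) : ℝ :=
  ∫ y, ∫ x, coulombDensity ω f₁ f₂ ε M x y ∂(surfaceMeasure ω f₁ f₂ ε) ∂(surfaceMeasure ω f₁ f₂ ε)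

theorem filmEnergy_eq_interaction {M : Plane → Space} {q : Space → ℝ}
    (h : surfaceCharge ω f₁ f₂ ε M =ᵐ[surfaceMeasure ω f₁ f₂ ε] q) :
    filmEnergy ω f₁ f₂ ε M =
      interaction (surfaceMeasure ω f₁ f₂ ε) (surfaceMeasure ω f₁ f₂ ε) q := by
  rw [interaction_eq_integral, filmEnergy]
  refine integral_congr_ae ?_
  filter_upwards [h] with y hy
  refine integral_congr_ae ?_
  filter_upwards [h] with x hx
  rw [coulombDensity, hx, hy]

theorem isBounded_graph (hb : Bornology.IsBounded ω) {f : Plane → ℝ} {K : ℝ≥0}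
    (hf : LipschitzWith K f) : Bornology.IsBounded (graphMap f '' ω) :=
  (lipschitz_graphMap hf).isBounded_image hb

theorem isBounded_lateral (hb : Bornology.IsBounded ω) (h₁ : Continuous f₁) (h₂ : Continuous f₂)
    (hε : 0 < ε) (h₁0 : ∀ x, 0 < f₁ x) {H : ℝ} (hH : ∀ x, |f₂ x| ≤ H) :
    Bornology.IsBounded (lateral ω f₁ f₂ ε) := by
  obtain ⟨r, hr⟩ := hb.closure.exists_norm_le
  refine (isBounded_iff_forall_norm_le.mpr ⟨r + ε * H, fun x hx => ?_⟩)
  obtain ⟨hx1, hx2⟩ := lateral_subset h₁ h₂ hε h₁0 hH hx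
  rw [← join_proj x]
  refine (norm_join_le _ _).trans (add_le_add (hr _ (frontier_subset_closure hx1)) ?_)
  rw [abs_of_nonneg hx2.1]
  exact hx2.2

/-- The surface measure is finite with quadratic growth. -/
theorem exists_quadraticGrowth_surfaceMeasure (hω : IsOpen ω) (hb : Bornology.IsBounded ω)
    (hl : HasLipschitzBoundary ω) (h₁ : LipschitzWith K₁ f₁) (h₂ : LipschitzWith K₂ f₂)
    (h₁0 : ∀ x, 0 < f₁ x) (hlt : ∀ x, f₁ x < f₂ x) {H : ℝ} (hH : ∀ x, |f₂ x| ≤ H) (hε : 0 < ε) :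
    IsFiniteMeasure (surfaceMeasure ω f₁ f₂ ε) ∧
      ∃ C, 0 ≤ C ∧ QuadraticGrowth (surfaceMeasure ω f₁ f₂ ε) C := by
  obtain ⟨cc⟩ := exists_curveCover hb hl
  obtain ⟨C, hC0, hC⟩ := exists_quadraticGrowth_cylinder cc
  have hg₁ := quadraticGrowth_graph (lipschitz_rescale hε h₁) ω
  have hg₂ := quadraticGrowth_graph (lipschitz_rescale hε h₂) ω
  have hgl : QuadraticGrowth ((Measure.euclideanHausdorffMeasure 2).restrict
      (lateral ω f₁ f₂ ε)) C := hC.mono (Measure.restrict_mono inter_subset_right le_rfl)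
  have hd := discArea_nonneg
  have := hg₁.isFiniteMeasure (isBounded_graph hb (lipschitz_rescale hε h₁))
  have := hg₂.isFiniteMeasure (isBounded_graph hb (lipschitz_rescale hε h₂))
  have := hgl.isFiniteMeasure (isBounded_lateral hb h₁.continuous h₂.continuous hε h₁0 hH)
  rw [surfaceMeasure_eq hω h₁.continuous h₂.continuous hε hlt]
  exact ⟨inferInstance, _, by positivity, (hg₁.add (by positivity) (by positivity) hg₂).add
    (by positivity) hC0 hgl⟩

theorem integrable_coulombDensity (hω : IsOpen ω) (hb : Bornology.IsBounded ω)
    (hl : HasLipschitzBoundary ω) (h₁ : LipschitzWith K₁ f₁) (h₂ : LipschitzWith K₂ f₂)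
    (h₁0 : ∀ x, 0 < f₁ x) (hlt : ∀ x, f₁ x < f₂ x) {H : ℝ} (hH : ∀ x, |f₂ x| ≤ H) (hε : 0 < ε)
    {M : Plane → Space} (hM : AEStronglyMeasurable M (volume.restrict ω))
    (hM1 : ∀ᵐ x ∂(volume.restrict ω), ‖M x‖ ≤ 1) :
    Integrable (fun p : Space × Space => coulombDensity ω f₁ f₂ ε M p.1 p.2)
      ((surfaceMeasure ω f₁ f₂ ε).prod (surfaceMeasure ω f₁ f₂ ε)) := by
  obtain ⟨hfin, C, hC0, hC⟩ := exists_quadraticGrowth_surfaceMeasure hω hb hl h₁ h₂ h₁0 hlt hH hε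
  obtain ⟨q, hqm, hq1, hq, -, -⟩ := exists_measurable_charge hω h₁ h₂ hε hlt hM hM1
  refine (integrable_coulomb hC0 hC hqm hq1).congr ?_
  filter_upwards [Measure.quasiMeasurePreserving_fst.ae hq,
    Measure.quasiMeasurePreserving_snd.ae hq] with p h1 h2
  rw [coulombDensity, h1, h2]

/-- The three `ker ε` parts of the graph interactions add up to the energy of the net charge, so
only terms involving the lateral face remain as errors. Its area is `O(ε)`; the graphs create on it
a potential at most `B + O(ε)`, and the face itself one of order `√ε`. -/
theorem exists_filmEnergy_estimate (hω : IsOpen ω) (hb : Bornology.IsBounded ω)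
    (hl : HasLipschitzBoundary ω) (h₁ : LipschitzWith K₁ f₁) (h₂ : LipschitzWith K₂ f₂)
    (h₁0 : ∀ x, 0 < f₁ x) (hlt : ∀ x, f₁ x < f₂ x) {H : ℝ} (hH : ∀ x, |f₂ x| ≤ H) :
    ∃ C : ℝ, ∀ ε, 0 < ε → ε ≤ 1 → ∀ M : Plane → Space,
      AEStronglyMeasurable M (volume.restrict ω) → (∀ᵐ x ∂(volume.restrict ω), ‖M x‖ ≤ 1) →
      ∀ B, 0 ≤ B → (∀ y ∈ closure ω, |∫ x in ω, netCharge f₁ f₂ ε M x * ker ε (x - y)| ≤ B) →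
      |filmEnergy ω f₁ f₂ ε M - (graphEnergyDiff ω f₁ f₁ ε M + graphEnergyDiff ω f₂ f₂ ε M -
        2 * graphEnergyDiff ω f₁ f₂ ε M +
        ∫ x in ω, netCharge f₁ f₂ ε M x * ∫ y in ω, netCharge f₁ f₂ ε M y * ker ε (y - x))| ≤
        C * ε * (B + √ε) := by
  obtain ⟨cc⟩ := exists_curveCover hb hl
  obtain ⟨Cq, hCq0, hCq⟩ := exists_quadraticGrowth_cylinder cc
  obtain ⟨Ch, hCh0, hCh⟩ := exists_hausdorff_cylinder_le cc
  have hd := discArea_nonneg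
  have hH0 : 0 ≤ H := (abs_nonneg _).trans (hH 0)
  set I := ∫ z, kerMajorant z with hI
  have hI0 : 0 ≤ I := integral_nonneg kerMajorant_nonneg
  have hf₂H : ∀ x, f₂ x ≤ H := fun x => (le_abs_self _).trans (hH x)
  have hf₁H : ∀ x, f₁ x ≤ H := fun x => (hlt x).le.trans (hf₂H x)
  have h₂0 : ∀ x, 0 < f₂ x := fun x => (h₁0 x).trans (hlt x)
  set A : ℝ := 3 * (1 + K₁) + 3 * (1 + K₂) with hA
  have hA0 : 0 ≤ A := by positivity
  set D : ℝ := 2 * (A * (1 + H ^ 2) * I) with hD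
  have hD0 : 0 ≤ D := by positivity
  -- The first summand bounds twice the interaction of the graphs with the lateral face, the second
  -- the self-interaction of that face, whose area is at most `Ch * H * ε`.
  refine ⟨2 * (1 + D) * (Ch * H) + (Ch * H + Cq) * (Ch * H), fun ε hε hε1 M hM hM1 B hB0 hB => ?_⟩
  have hs : 0 < √ε := Real.sqrt_pos.mpr hε
  have hss : √ε * √ε = ε := Real.mul_self_sqrt hε.le
  have hs1 : √ε ≤ 1 := Real.sqrt_le_one.mpr hε1
  obtain ⟨q, hqm, hq1, hq, hq₁, hq₂⟩ := exists_measurable_charge hω h₁ h₂ hε hlt hM hM1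
  set ρ₁ : Plane → ℝ := fun x => inner ℝ (M x) (graphNormal f₁ (ε⁻¹ • x)) with hρ₁
  set ρ₂ : Plane → ℝ := fun x => inner ℝ (M x) (graphNormal f₂ (ε⁻¹ • x)) with hρ₂
  have hρ₁m : AEStronglyMeasurable ρ₁ (volume.restrict ω) :=
    aestronglyMeasurable_inner_graphNormal hM f₁
  have hρ₂m : AEStronglyMeasurable ρ₂ (volume.restrict ω) :=
    aestronglyMeasurable_inner_graphNormal hM f₂
  have hρ₁b : ∀ᵐ x ∂(volume.restrict ω), |ρ₁ x| ≤ A := hM1.mono fun x hx =>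
    (abs_inner_graphNormal_le h₁ hx _).trans (by rw [hA]; linarith [K₂.coe_nonneg])
  have hρ₂b : ∀ᵐ x ∂(volume.restrict ω), |ρ₂ x| ≤ A := hM1.mono fun x hx =>
    (abs_inner_graphNormal_le h₂ hx _).trans (by rw [hA]; linarith [K₁.coe_nonneg])
  have hr₁ := lipschitz_rescale hε h₁
  have hr₂ := lipschitz_rescale hε h₂
  set σ₁ := (Measure.euclideanHausdorffMeasure 2).restrict (graphMap (rescale ε f₁) '' ω) with hσ₁
  set σ₂ := (Measure.euclideanHausdorffMeasure 2).restrict (graphMap (rescale ε f₂) '' ω) with hσ₂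
  set l := (Measure.euclideanHausdorffMeasure 2).restrict (lateral ω f₁ f₂ ε) with hldef
  have hg₁ : QuadraticGrowth σ₁ _ := quadraticGrowth_graph hr₁ ω
  have hg₂ : QuadraticGrowth σ₂ _ := quadraticGrowth_graph hr₂ ω
  have hgl : QuadraticGrowth l Cq := hCq.mono (Measure.restrict_mono inter_subset_right le_rfl)
  have hfin₁ : IsFiniteMeasure σ₁ := hg₁.isFiniteMeasure (isBounded_graph hb hr₁)
  have hfin₂ : IsFiniteMeasure σ₂ := hg₂.isFiniteMeasure (isBounded_graph hb hr₂)
  have hfinl : IsFiniteMeasure l :=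
    hgl.isFiniteMeasure (isBounded_lateral hb h₁.continuous h₂.continuous hε h₁0 hH)
  have hlε : l.real univ ≤ Ch * H * ε := by
    refine ENNReal.toReal_le_of_le_ofReal (by positivity) ?_
    rw [hldef, Measure.restrict_apply_univ]
    refine (measure_mono (lateral_subset h₁.continuous h₂.continuous hε h₁0 hH)).trans ?_
    refine (hCh (ε * H) (by positivity)).trans (ENNReal.ofReal_le_ofReal ?_)
    linarith
  have hl0 : 0 ≤ l.real univ := measureReal_nonneg
  have hH' : ∀ i j : Plane → ℝ, (i = f₁ ∨ i = f₂) → (j = f₁ ∨ j = f₂) → ∀ x y, |j y - i x| ≤ H := by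
    rintro i j (rfl | rfl) (rfl | rfl) x y <;> rw [abs_le] <;> constructor <;>
      linarith [h₁0 x, h₁0 y, h₂0 x, h₂0 y, hf₁H x, hf₁H y, hf₂H x, hf₂H y]
  have hneg : ∀ᵐ x ∂(volume.restrict ω),
      areaElement (rescale ε f₁) x * q (graphMap (rescale ε f₁) x) = -ρ₁ x := hq₁
  have i11 : interaction σ₁ σ₁ q = graphEnergyDiff ω f₁ f₁ ε M +
      ∫ x in ω, ρ₁ x * ∫ y in ω, ρ₁ y * ker ε (y - x) := by
    rw [interaction_graph hr₁ hr₁ hω.measurableSet hneg hneg]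
    simp only [neg_mul, integral_neg, mul_neg, neg_neg]
    exact integral_graph_kernel_split hb h₁.continuous h₁.continuous
      (hH' f₁ f₁ (.inl rfl) (.inl rfl)) hε hρ₁m hρ₁b hρ₁m hρ₁b
  have i22 : interaction σ₂ σ₂ q = graphEnergyDiff ω f₂ f₂ ε M +
      ∫ x in ω, ρ₂ x * ∫ y in ω, ρ₂ y * ker ε (y - x) := by
    rw [interaction_graph hr₂ hr₂ hω.measurableSet hq₂ hq₂]
    exact integral_graph_kernel_split hb h₂.continuous h₂.continuous
      (hH' f₂ f₂ (.inr rfl) (.inr rfl)) hε hρ₂m hρ₂b hρ₂m hρ₂b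
  -- The sign comes from the opposite orientations of the outer normal on the two faces.
  have i21 : interaction σ₂ σ₁ q = -(graphEnergyDiff ω f₁ f₂ ε M +
      ∫ x in ω, ρ₁ x * ∫ y in ω, ρ₂ y * ker ε (y - x)) := by
    rw [interaction_graph hr₁ hr₂ hω.measurableSet hneg hq₂]
    simp only [neg_mul, integral_neg]
    exact congrArg _ (integral_graph_kernel_split hb h₁.continuous h₂.continuous
      (hH' f₁ f₂ (.inl rfl) (.inr rfl)) hε hρ₁m hρ₁b hρ₂m hρ₂b)
  have hnet := integral_ker_sub_sub hε (integrableOn_of_norm_le hb hρ₁m hρ₁b)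
    (integrableOn_of_norm_le hb hρ₂m hρ₂b)
  have hpot : ∀ᵐ y ∂l, |potential (σ₁ + σ₂) q y| ≤ B + D * ε := by
    filter_upwards [ae_restrict_mem measurableSet_lateral] with y hy
    obtain ⟨hy1, hy2⟩ := lateral_subset h₁.continuous h₂.continuous hε h₁0 hH hy
    have hyf : ∀ f : Plane → ℝ, (∀ x, 0 < f x) → (∀ x, f x ≤ H) → ∀ x,
        |rescale ε f x - y 2| ≤ ε * H := fun f hf0 hfH x => by
      have a1 : 0 ≤ rescale ε f x := mul_nonneg hε.le (hf0 _).le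
      have a2 : rescale ε f x ≤ ε * H := mul_le_mul_of_nonneg_left (hfH _) hε.le
      rw [abs_le]
      constructor <;> linarith [hy2.1, hy2.2]
    have e : potential (σ₁ + σ₂) q y =
        (∫ x in ω, ρ₂ x * (1 / ‖graphMap (rescale ε f₂) x - y‖)) -
          ∫ x in ω, ρ₁ x * (1 / ‖graphMap (rescale ε f₁) x - y‖) := by
      have : potential (σ₁ + σ₂) q y = potential σ₁ q y + potential σ₂ q y :=
        integral_add_measure (integrable_potential (by positivity) hg₁ hqm hq1 y)
          (integrable_potential (by positivity) hg₂ hqm hq1 y)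
      rw [this, potential_graph hr₁ hω.measurableSet hneg, potential_graph hr₂ hω.measurableSet hq₂]
      simp only [neg_mul, integral_neg]
      ring
    have d1 := abs_integral_graph_sub_ker_le hb h₁.continuous hε hA0 hρ₁m hρ₁b (hyf f₁ h₁0 hf₁H)
    have d2 := abs_integral_graph_sub_ker_le hb h₂.continuous hε hA0 hρ₂m hρ₂b (hyf f₂ h₂0 hf₂H)
    have hP := hB (proj y) (frontier_subset_closure hy1)
    have eP : ∫ x in ω, netCharge f₁ f₂ ε M x * ker ε (x - proj y) =
        (∫ x in ω, ρ₂ x * ker ε (x - proj y)) - ∫ x in ω, ρ₁ x * ker ε (x - proj y) := by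
      rw [← integral_sub
        (integrable_mul_kernel (integrableOn_of_norm_le hb hρ₂m hρ₂b) (continuous_ker hε)
          (abs_ker_le hε) _)
        (integrable_mul_kernel (integrableOn_of_norm_le hb hρ₁m hρ₁b) (continuous_ker hε)
          (abs_ker_le hε) _)]
      refine integral_congr_ae (Eventually.of_forall fun x => ?_)
      simp only [netCharge, hρ₁, hρ₂]
      ring
    rw [eP] at hP
    rw [e]
    rw [abs_le] at d1 d2 hP ⊢
    constructor <;> linarith [d1.1, d1.2, d2.1, d2.2, hP.1, hP.2]
  have b1 := abs_interaction_le (σ := σ₁ + σ₂) (τ := l) hq1 hpot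
  -- The potential of the face on itself, with the threshold `T = 1/√ε` balancing its area `O(ε)`
  -- against `Cq / T`.
  have b2 : |interaction l l q| ≤ ((√ε)⁻¹ * l.real univ + Cq / (√ε)⁻¹) * l.real univ :=
    abs_interaction_le hq1 (Eventually.of_forall fun y => abs_integral_le_integral_abs.trans
      (integral_abs_potential_le hCq0 hgl hq1 y (inv_pos.mpr hs)))
  set N := Ch * H with hN
  have hN0 : 0 ≤ N := by positivity
  have hεs : ε ≤ √ε := by nlinarith
  have b1' : |interaction (σ₁ + σ₂) l q| ≤ (B + D * √ε) * (N * ε) :=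
    b1.trans (mul_le_mul (by gcongr) hlε hl0 (by positivity))
  have b2' : |interaction l l q| ≤ ((N + Cq) * √ε) * (N * ε) := by
    refine b2.trans (mul_le_mul ?_ hlε hl0 (by positivity))
    calc (√ε)⁻¹ * l.real univ + Cq / (√ε)⁻¹ ≤ (√ε)⁻¹ * (N * ε) + Cq / (√ε)⁻¹ := by gcongr
      _ = (N + Cq) * √ε := by
        nth_rewrite 2 [← hss]
        field_simp
  rw [filmEnergy_eq_interaction hq, surfaceMeasure_eq hω h₁.continuous h₂.continuous hε hlt,
    interaction_decomposition (by positivity) hg₁ (by positivity) hg₂ hCq0 hgl hqm hq1, i11, i22, i21]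
  have e : ∀ x, netCharge f₁ f₂ ε M x = ρ₂ x - ρ₁ x := fun x => rfl
  simp only [e]
  rw [hnet]
  have p1 : 0 ≤ N * ε * B := by positivity
  have p2 : 0 ≤ N * ε * √ε := by positivity
  have p3 : 0 ≤ D * (N * ε * B) := by positivity
  have p4 : 0 ≤ (N + Cq) * (N * ε * B) := by positivity
  rw [abs_le] at b1' b2' ⊢
  constructor <;> linarith [b1'.1, b1'.2, b2'.1, b2'.2]

end Energy

/-! ### The limit of the energy -/

theorem integral_quadForm {ω : Set Plane} (hb : Bornology.IsBounded ω) (A : Matrix (Fin 3) (Fin 3) ℝ)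
    {m : Plane → Space} (hm : AEStronglyMeasurable m (volume.restrict ω))
    (hm1 : ∀ᵐ x ∂(volume.restrict ω), ‖m x‖ ≤ 1) :
    ∫ x in ω, quadForm A (m x) = ∑ p, ∑ q, A p q * ∫ x in ω, m x p * m x q := by
  have hi : ∀ p q, IntegrableOn (fun x => A p q * (m x p * m x q)) ω := fun p q => by
    refine (integrableOn_of_norm_le hb (C := 1) ((aestronglyMeasurable_apply hm p).mul
      (aestronglyMeasurable_apply hm q)) ?_).const_mul _
    filter_upwards [hm1] with x hx
    rw [Pi.mul_apply, abs_mul]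
    exact mul_le_one₀ ((abs_apply_le_norm_space _ _).trans hx) (abs_nonneg _)
      ((abs_apply_le_norm_space _ _).trans hx)
  have e : ∀ x, quadForm A (m x) = ∑ p, ∑ q, A p q * (m x p * m x q) := fun x => by
    simp only [quadForm, Finset.sum_mul]
    refine Finset.sum_congr rfl fun p _ => Finset.sum_congr rfl fun q _ => ?_
    ring
  simp only [e]
  rw [integral_finsetSum _ fun p _ => integrable_finsetSum _ fun q _ => hi p q]
  refine Finset.sum_congr rfl fun p _ => ?_
  rw [integral_finsetSum _ fun q _ => hi p q]
  exact Finset.sum_congr rfl fun q _ => integral_const_mul _ _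

/-- The weight `1/(2π)` of the mixed matrix is twice `1/(4π)`, which matches the two equal cross
terms of the energy. -/
theorem sum_Ahom_mul (f₁ f₂ : Plane → ℝ) (c : Fin 3 → Fin 3 → ℝ) :
    ∑ p, ∑ q, Ahom f₁ f₂ p q * c p q = 1 / (4 * Real.pi) *
      (∑ p, ∑ q, chargeMatrix f₁ f₁ p q * c p q + ∑ p, ∑ q, chargeMatrix f₂ f₂ p q * c p q -
        2 * ∑ p, ∑ q, chargeMatrix f₁ f₂ p q * c p q +
        ∑ i : Fin 2, ∑ j : Fin 2,
          dipoleMatrix f₁ f₂ i.castSucc j.castSucc * c i.castSucc j.castSucc) := by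
  have hd : ∑ i : Fin 2, ∑ j : Fin 2,
      dipoleMatrix f₁ f₂ i.castSucc j.castSucc * c i.castSucc j.castSucc =
      ∑ p, ∑ q, dipoleMatrix f₁ f₂ p q * c p q := by
    simp only [Fin.sum_univ_castSucc (n := 2)]
    rw [show Fin.last 2 = (2 : Fin 3) from rfl]
    simp only [dipoleMatrix_last_left, dipoleMatrix_last_right, zero_mul, add_zero,
      Finset.sum_const_zero]
  rw [hd]
  simp only [Finset.mul_sum, ← Finset.sum_add_distrib, ← Finset.sum_sub_distrib]
  refine Finset.sum_congr rfl fun p _ => Finset.sum_congr rfl fun q _ => ?_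
  simp only [Ahom, Matrix.add_apply, Matrix.sub_apply, Matrix.smul_apply, smul_eq_mul]
  field_simp
  ring

/-- Weak convergence enters twice: as strong `L¹` convergence of the maps, and as an eventual `L²`
bound on their derivatives. The latter makes the constants of the two error estimates uniform in
`ε`. -/
theorem tendsto_filmEnergy {ω : Set Plane} (hω : IsOpen ω) (hb : Bornology.IsBounded ω)
    (hl : HasLipschitzBoundary ω) {f₁ f₂ : Plane → ℝ} {K₁ K₂ : ℝ≥0} (h₁ : LipschitzWith K₁ f₁)
    (h₂ : LipschitzWith K₂ f₂) (hp₁ : IsCellPeriodic f₁) (hp₂ : IsCellPeriodic f₂)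
    (h₁0 : ∀ x, 0 < f₁ x) (hlt : ∀ x, f₁ x < f₂ x) {M : ℝ → Plane → Space} {m : Plane → Space}
    (hM1 : ∀ ε > 0, ∀ᵐ x ∂(volume.restrict ω), ‖M ε x‖ = 1)
    (hm1 : ∀ᵐ x ∂(volume.restrict ω), ‖m x‖ = 1) (hweak : WeakTendstoH1 ω M m) :
    Tendsto (fun ε => ε⁻¹ * filmEnergy ω f₁ f₂ ε (M ε)) (𝓝[>] 0)
      (𝓝 (∑ p, ∑ q, chargeMatrix f₁ f₁ p q * (∫ x in ω, m x p * m x q) +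
        ∑ p, ∑ q, chargeMatrix f₂ f₂ p q * (∫ x in ω, m x p * m x q) -
        2 * ∑ p, ∑ q, chargeMatrix f₁ f₂ p q * (∫ x in ω, m x p * m x q) +
        ∑ i : Fin 2, ∑ j : Fin 2, dipoleMatrix f₁ f₂ i.castSucc j.castSucc *
          ∫ x in ω, m x i.castSucc * m x j.castSucc)) := by
  obtain ⟨DM, Dm, hMH, hmH, hw, hDw⟩ := hweak
  have hM1' : ∀ ε > 0, ∀ᵐ x ∂(volume.restrict ω), ‖M ε x‖ ≤ 1 := fun ε hε =>
    (hM1 ε hε).mono fun x hx => hx.le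
  have hm1' : ∀ᵐ x ∂(volume.restrict ω), ‖m x‖ ≤ 1 := hm1.mono fun x hx => hx.le
  obtain ⟨H, hH0, hH⟩ := hp₂.exists_bound h₂.continuous
  have hf₂H : ∀ x, f₂ x ≤ H := fun x => (le_abs_self _).trans (hH x)
  have h₂0 : ∀ x, 0 < f₂ x := fun x => (h₁0 x).trans (hlt x)
  have hf₁H : ∀ x, f₁ x ≤ H := fun x => (hlt x).le.trans (hf₂H x)
  have hd : ∀ {i j : Plane → ℝ}, (∀ x, 0 < i x) → (∀ x, i x ≤ H) → (∀ x, 0 < j x) →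
      (∀ x, j x ≤ H) → ∀ x y, |j y - i x| ≤ H := fun {i j} h1 h2 h3 h4 x y => by
    rw [abs_le]
    constructor <;> linarith [h1 x, h2 x, h3 y, h4 y]
  lift H to ℝ≥0 using hH0
  have hG : ∀ x, |f₂ x - f₁ x| ≤ H := fun x => hd h₁0 hf₁H h₂0 hf₂H x x
  have hstrong := hw.tendsto_integral_norm_sub hb (fun ε hε => (hMH ε hε).1) hmH.1 hM1 hm1
  have hbt := boundedTendsto_apply (fun ε hε => (hMH ε hε).1) hmH.1 hM1' hm1' hb hstrong
  obtain ⟨E₀, hE₀⟩ := (hDw 0).exists_integral_norm_sq_le fun ε hε => ((hMH ε hε).2 0).1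
  obtain ⟨E₁, hE₁⟩ := (hDw 1).exists_integral_norm_sq_le fun ε hε => ((hMH ε hε).2 1).1
  obtain ⟨C, hC⟩ := exists_netCharge_estimates hω hb hl h₁ h₂ hG (max E₀ E₁)
  obtain ⟨C', hC'⟩ := exists_filmEnergy_estimate hω hb hl h₁ h₂ h₁0 hlt hH
  have hm := fun ε hε => (hMH ε hε).1.1
  have hlim := (((tendsto_graphEnergyDiff hω hb h₁ h₁ hp₁ hp₁ (hd h₁0 hf₁H h₁0 hf₁H) hm hM1'
      hbt).add (tendsto_graphEnergyDiff hω hb h₂ h₂ hp₂ hp₂ (hd h₂0 hf₂H h₂0 hf₂H) hm hM1'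
      hbt)).sub ((tendsto_graphEnergyDiff hω hb h₁ h₂ hp₁ hp₂ (hd h₁0 hf₁H h₂0 hf₂H) hm hM1'
      hbt).const_mul 2)).add
    (tendsto_finsetSum Finset.univ fun i (_ : i ∈ Finset.univ) =>
      tendsto_finsetSum Finset.univ fun j (_ : j ∈ Finset.univ) =>
        tendsto_dipole hω hb hl h₁.continuous h₂.continuous hp₁ hp₂ hG (hbt i.castSucc)
          (hbt j.castSucc) i j)
  -- The term `C' * (|C| + 1)` comes from the lateral face with `B = |C| * √ε`, and `|C|` from
  -- replacing the net charge by dipoles; both errors have been divided by `ε`.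
  have hsqrt : Tendsto (fun ε : ℝ => (C' * (|C| + 1) + |C|) * √ε) (𝓝[>] 0) (𝓝 0) := by
    have h := (Real.continuous_sqrt.tendsto 0).const_mul (C' * (|C| + 1) + |C|)
    rw [Real.sqrt_zero, mul_zero] at h
    exact h.mono_left nhdsWithin_le_nhds
  have hle1 : ∀ᶠ ε : ℝ in 𝓝[>] 0, ε ≤ 1 :=
    (eventually_le_nhds zero_lt_one).filter_mono nhdsWithin_le_nhds
  refine (tendsto_iff_of_dist ?_).mp hlim
  refine squeeze_zero' (Eventually.of_forall fun ε => dist_nonneg) ?_ hsqrt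
  filter_upwards [self_mem_nhdsWithin, hle1, hE₀, hE₁] with ε hε hε1 he₀ he₁
  have hε0 : (0 : ℝ) < ε := hε
  have hs : 0 < √ε := Real.sqrt_pos.mpr hε0
  have hE : ∀ i, ∫ x in ω, ‖DM ε i x‖ ^ 2 ≤ max E₀ E₁ := fun i => by
    fin_cases i
    · exact he₀.trans (le_max_left _ _)
    · exact he₁.trans (le_max_right _ _)
  obtain ⟨hpot, hdip⟩ := hC ε hε0 hε1 (M ε) (DM ε) (hMH ε hε0) (hM1' ε hε0) hE
  have hen := hC' ε hε0 hε1 (M ε) (hm ε hε0) (hM1' ε hε0) (|C| * √ε) (by positivity)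
    fun y hy => (hpot y hy).trans (by gcongr; exact le_abs_self C)
  have hCC : C * (ε * √ε) ≤ |C| * (ε * √ε) := by gcongr; exact le_abs_self C
  simp only [← Finset.mul_sum]
  set DD := ∑ i : Fin 2, ∑ j : Fin 2, ∫ x in ω, thickness ω f₁ f₂ ε x * M ε x i.castSucc *
    ∫ y in ω, thickness ω f₁ f₂ ε y * M ε y j.castSucc * ddker ε i j (y - x)
  set NN := ∫ x in ω, netCharge f₁ f₂ ε (M ε) x * ∫ y in ω, netCharge f₁ f₂ ε (M ε) y * ker ε (y - x)
  set g11 := graphEnergyDiff ω f₁ f₁ ε (M ε)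
  set g22 := graphEnergyDiff ω f₂ f₂ ε (M ε)
  set g12 := graphEnergyDiff ω f₁ f₂ ε (M ε)
  set X := filmEnergy ω f₁ f₂ ε (M ε)
  rw [dist_comm, Real.dist_eq]
  have e : ε⁻¹ * X - (ε⁻¹ * g11 + ε⁻¹ * g22 - 2 * (ε⁻¹ * g12) + ε⁻¹ * DD) =
      ε⁻¹ * ((X - (g11 + g22 - 2 * g12 + NN)) + (NN - DD)) := by ring
  rw [e, abs_mul, abs_of_pos (inv_pos.mpr hε0), inv_mul_le_iff₀ hε0]
  refine (abs_add_le _ _).trans ((add_le_add hen (hdip.trans hCC)).trans (le_of_eq ?_))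
  ring

end

end RoughFilm

theorem proposition3p11 (ω : Set RoughFilm.Plane) (hω_open : IsOpen ω)
    (hω_bdd : Bornology.IsBounded ω) (hω_lip : RoughFilm.HasLipschitzBoundary ω)
    (f₁ f₂ : RoughFilm.Plane → ℝ)
    (hf₁_lip : ∃ K, LipschitzWith K f₁) (hf₂_lip : ∃ K, LipschitzWith K f₂)
    (hf₁_per : RoughFilm.IsCellPeriodic f₁) (hf₂_per : RoughFilm.IsCellPeriodic f₂)
    (hf₁_pos : ∀ x, 0 < f₁ x) (hf₂_pos : ∀ x, 0 < f₂ x) (hf_lt : ∀ x, f₁ x < f₂ x)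
    (M : ℝ → RoughFilm.Plane → RoughFilm.Space) (m₀ : RoughFilm.Plane → RoughFilm.Space)
    (hM : ∀ ε > 0, RoughFilm.MemH1Sphere ω (M ε)) (hm₀ : RoughFilm.MemH1Sphere ω m₀)
    (hweak : RoughFilm.WeakTendstoH1 ω M m₀) :
    (∀ ε > 0, Integrable
      (fun p : RoughFilm.Space × RoughFilm.Space =>
        RoughFilm.coulombDensity ω f₁ f₂ ε (M ε) p.1 p.2)
      ((RoughFilm.surfaceMeasure ω f₁ f₂ ε).prod (RoughFilm.surfaceMeasure ω f₁ f₂ ε))) ∧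
    Tendsto
      (fun ε : ℝ => 1 / (4 * Real.pi * ε) *
        ∫ y, ∫ x, RoughFilm.coulombDensity ω f₁ f₂ ε (M ε) x y
          ∂(RoughFilm.surfaceMeasure ω f₁ f₂ ε) ∂(RoughFilm.surfaceMeasure ω f₁ f₂ ε))
      (𝓝[>] 0)
      (𝓝 (∫ x in ω, RoughFilm.quadForm (RoughFilm.Ahom f₁ f₂) (m₀ x))) := by
  obtain ⟨K₁, h₁⟩ := hf₁_lip
  obtain ⟨K₂, h₂⟩ := hf₂_lip
  obtain ⟨H, -, hH⟩ := hf₂_per.exists_bound h₂.continuous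
  refine ⟨fun ε hε => ?_, ?_⟩
  · obtain ⟨⟨DM, hDM⟩, hM1⟩ := hM ε hε
    exact RoughFilm.integrable_coulombDensity hω_open hω_bdd hω_lip h₁ h₂ hf₁_pos hf_lt hH hε
      hDM.1.1 (hM1.mono fun x hx => hx.le)
  · obtain ⟨⟨Dm, hDm⟩, hm1⟩ := hm₀
    rw [RoughFilm.integral_quadForm hω_bdd _ hDm.1.1 (hm1.mono fun x hx => hx.le),
      RoughFilm.sum_Ahom_mul f₁ f₂ fun p q => ∫ x in ω, m₀ x p * m₀ x q]
    have h := (RoughFilm.tendsto_filmEnergy hω_open hω_bdd hω_lip h₁ h₂ hf₁_per hf₂_per hf₁_pos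
      hf_lt (fun ε hε => (hM ε hε).2) hm1 hweak).const_mul (1 / (4 * Real.pi))
    refine h.congr fun ε => ?_
    rw [← mul_assoc]
    congr 1
    rw [one_div, one_div, mul_inv (4 * Real.pi) ε]
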